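/- A relational type $\tau$ is a set of finitary relation symbols with arities; a structure of type $\tau$ is a set $\mathcal A=\langle A,\langle R^{\mathcal A}\rangle_{R\in\tau}\rangle$ with non-empty universe $A$. For a set $S$ of structures of type $\tau$, the product $\prod S$ is the structure of type $\tau$ whose universe is the set of all functions $f$ with domain $S$ such that $f(\mathcal A)\in A$ for every $\mathcal A\in S$, with relations defined pointwise. A structure is natural if it is of the form $\langle V_\alpha,\in,A\rangle$ with $A\in V_\alpha$ (a unary relation on $V_\alpha$). Formulas are those of the first-order language of set theory; a $\Pi_1$ formula is a block of universal quantifiers followed by a formula with only bounded quantifiers, and a class is $\Pi_1$-definable if it is $\{x : \varphi(x)\}$ for some $\Pi_1$ formula $\varphi(x)$ without parameters. A cardinal $\kappa$ product-reflects a class $\mathcal C$ of structures of the same type $\tau$ if for every ordinal $\beta\ge\kappa$ there exist a set $S\supseteq \mathcal C\cap V_\beta$ of structures of type $\tau$ and an elementary embedding $h:\prod(\mathcal C\cap V_\kappa)\to\prod S$ such that (1) ($h$ is faithful) $h(f)\restriction(\mathcal C\cap V_\kappa)=f$ for every $f\in\prod(\mathcal C\cap V_\kappa)$; (2) ($h$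 is $\subseteq$-chain-preserving) if $f\in\prod(\mathcal C\cap V_\kappa)$ is such that $f(\mathcal A)\subseteq f(\mathcal A')$ for all $\mathcal A,\mathcal A'\in\mathcal C\cap V_\kappa$ with $A\subseteq A'$, then $h(f)(\mathcal A)\subseteq h(f)(\mathcal A')$ for all $\mathcal A,\mathcal A'\in S$ with $A\subseteq A'$. A cardinal $\kappa$ witnesses $\Pi_1$-PSR (second version) if it product-reflects every $\Pi_1$-definable proper class of relational structures of the same type. A cardinal $\kappa$ is strong if for every cardinal $\lambda>\kappa$ there is an elementary embedding $j:V\to M$ with $M$ a transitive class, $\operatorname{crit}(j)=\kappa$, $j(\kappa)>\lambda$ and $V_\lambda\subseteq M$. Theorem. A cardinal $\kappa$ is strong if and only if it witnesses $\Pi_1$-PSR (second version). Moreover, there is a single $\Pi_1$-definable (without parameters) proper class $\mathcal C$ of natural structures such that every cardinal $\kappa$ that product-reflects $\mathcal C$ is strong. -/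

import Mathlib

universe u

open scoped ZFSet FirstOrder

namespace PSR

/-! ### The language of set theory and the Lévy classes `Δ₀`, `Π₁` -/

/-- The only symbol of the language of set theory: the binary relation symbol `∈`. -/
inductive MemSymbol : ℕ → Type
  | mem : MemSymbol 2

/-- The first-order language of set theory. -/
def LSet : FirstOrder.Language.{0, 0} := ⟨fun _ => Empty, MemSymbol⟩

/-- The universe `V` of all sets, as a structure for the language of set theory. -/
instance : LSet.Structure ZFSet.{u} where
  funMap := fun f => Empty.elim f
  RelMap := fun r v => match r with
    | MemSymbol.mem => v 0 ∈ v 1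

/-- A class `M` of sets with the true membership relation. -/
instance (M : Set ZFSet.{u}) : LSet.Structure M where
  funMap := fun f => Empty.elim f
  RelMap := fun r v => match r with
    | MemSymbol.mem => (v 0 : ZFSet.{u}) ∈ (v 1 : ZFSet.{u})

/-- The atomic formula `x ∈ y`, for variables `x`, `y`. -/
def memAtom {α : Type} {n : ℕ} (x y : α ⊕ Fin n) : LSet.BoundedFormula α n :=
  FirstOrder.Language.BoundedFormula.rel (L := LSet) MemSymbol.mem
    ![FirstOrder.Language.Term.var x, FirstOrder.Language.Term.var y]

/-- `Δ₀` formulas: all quantifiers are bounded. The bounded quantifier `∀ x ∈ y, φ` is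
`∀ x, (x ∈ y → φ)` with `y` a variable different from `x`; since `¬ φ` is `φ → ⊥`, the
connectives and `∃ x ∈ y, φ` are obtained from `→`, `⊥` and `∀ x ∈ y`. -/
inductive IsDelta0 {α : Type} : ∀ {n : ℕ}, LSet.BoundedFormula α n → Prop
  | falsum {n : ℕ} : IsDelta0 (FirstOrder.Language.BoundedFormula.falsum (n := n))
  | equal {n : ℕ} (t s : LSet.Term (α ⊕ Fin n)) :
      IsDelta0 (FirstOrder.Language.BoundedFormula.equal t s)
  | mem {n : ℕ} (x y : α ⊕ Fin n) : IsDelta0 (memAtom x y)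
  | imp {n : ℕ} {φ ψ : LSet.BoundedFormula α n} :
      IsDelta0 φ → IsDelta0 ψ → IsDelta0 (φ.imp ψ)
  | ball {n : ℕ} (y : α ⊕ Fin n) {φ : LSet.BoundedFormula α (n + 1)} :
      IsDelta0 φ →
      IsDelta0 (((memAtom (Sum.inr (Fin.last n)) (Sum.map id Fin.castSucc y)).imp φ).all)

/-- `Π₁` formulas: a block of universal quantifiers followed by a `Δ₀` formula. -/
inductive IsPi1 {α : Type} : ∀ {n : ℕ}, LSet.BoundedFormula α n → Prop
  | delta0 {n : ℕ} {φ : LSet.BoundedFormula α n} : IsDelta0 φ → IsPi1 φ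
  | all {n : ℕ} {φ : LSet.BoundedFormula α (n + 1)} : IsPi1 φ → IsPi1 φ.all

/-- The class `{x | V ⊨ φ[x]}` defined, without parameters, by a formula with one free
variable. -/
def definedClass (φ : LSet.Formula Unit) : Set ZFSet.{u} :=
  {x | φ.Realize (fun _ => x)}

/-- A class of sets is proper if it is not contained in a set. -/
def IsProperClass (C : Set ZFSet.{u}) : Prop :=
  ¬ ∃ s : ZFSet.{u}, ∀ x ∈ C, x ∈ s

/-! ### Strong cardinals -/

/-- `κ` is `lam`-strong: there is an elementary embedding `j : V → M` into a transitive class `M`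
with critical point `κ`, `j(κ) > lam` and `V_lam ⊆ M`. -/
def IsStrongUpTo (κ lam : Cardinal.{u}) : Prop :=
  ∃ (M : Set ZFSet.{u}) (j : ZFSet.{u} ↪ₑ[LSet] M),
    (∀ x ∈ M, ∀ y ∈ x, y ∈ M) ∧
    (∀ α < κ.ord, (j α.toZFSet : ZFSet.{u}) = α.toZFSet) ∧
    (j κ.ord.toZFSet : ZFSet.{u}) ≠ κ.ord.toZFSet ∧
    lam.ord.toZFSet ∈ (j κ.ord.toZFSet : ZFSet.{u}) ∧
    (∀ x ∈ V_ lam.ord, x ∈ M)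

/-- `κ` is strong if it is `lam`-strong for every cardinal `lam > κ`. -/
def IsStrong (κ : Cardinal.{u}) : Prop :=
  ∀ lam : Cardinal.{u}, κ < lam → IsStrongUpTo κ lam

/-! ### Relational structures -/

/-- A relational type: for each `n` a set of `n`-ary relation symbols. -/
structure RelType : Type (u + 1) where
  symbols : ℕ → ZFSet.{u}

/-- The first-order language of a relational type. -/
def RelType.lang (τ : RelType.{u}) : FirstOrder.Language.{0, u + 1} :=
  ⟨fun _ => Empty, fun n => τ.symbols n⟩

/-- A structure of relational type `τ`, whose universe is a non-empty set. -/
structure RelStruct (τ : RelType.{u}) : Type (u + 1) where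
  carrier : ZFSet.{u}
  nonempty : carrier.Nonempty
  rel : ∀ n : ℕ, τ.symbols n → Set (Fin n → carrier)

/-- The usual ordered tuple: `()` is `∅`, `(a)` is `a`, and
`(a₁, …, aₙ, aₙ₊₁)` is the ordered pair of `(a₁, …, aₙ)` and `aₙ₊₁`. -/
noncomputable def tuple : ∀ n : ℕ, (Fin n → ZFSet.{u}) → ZFSet.{u}
  | 0, _ => ∅
  | 1, v => v 0
  | n + 2, v => ZFSet.pair (tuple (n + 1) (Fin.init v)) (v (Fin.last (n + 1)))

/-- The interpretation of a relation symbol, as a set of tuples. -/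
noncomputable def RelStruct.relSet {τ : RelType.{u}} (A : RelStruct τ) (n : ℕ)
    (r : τ.symbols n) : ZFSet.{u} :=
  ZFSet.range (fun v : A.rel n r => tuple n (fun k => ((v : Fin n → A.carrier) k : ZFSet.{u})))

/-- The structure as a set: the pair of its universe and the family of its relations, the latter
a function whose arguments are the pairs `(n, r)` with `r` an `n`-ary relation symbol. -/
noncomputable def RelStruct.code {τ : RelType.{u}} (A : RelStruct τ) : ZFSet.{u} :=
  ZFSet.pair A.carrier
    (ZFSet.range (fun p : Σ n : ℕ, τ.symbols n =>
      ZFSet.pair (ZFSet.pair (p.1 : Ordinal.{u}).toZFSet p.2) (A.relSet p.1 p.2)))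

/-- The type of natural structures: one binary and one unary relation symbol. -/
noncomputable def natType : RelType.{u} where
  symbols := fun n => match n with
    | 1 => {∅}
    | 2 => {∅}
    | _ => ∅

/-- The relations of `⟨V_α, ∈, A⟩`. -/
def natRel (α : Ordinal.{u}) (A : ZFSet.{u}) : ∀ n : ℕ, Set (Fin n → V_ α)
  | 1 => {v | (v 0 : ZFSet.{u}) ∈ A}
  | 2 => {v | (v 0 : ZFSet.{u}) ∈ (v 1 : ZFSet.{u})}
  | _ => ∅

/-- The natural structure `⟨V_α, ∈, A⟩`, where `A ∈ V_α` (hence `A ⊆ V_α`) is a unary relation. -/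
noncomputable def natStruct (α : Ordinal.{u}) (A : ZFSet.{u}) (hA : A ∈ V_ α) :
    RelStruct natType.{u} where
  carrier := V_ α
  nonempty := ⟨A, hA⟩
  rel := fun n _ => natRel α A n

/-! ### Products -/

/-- The universe of the product `∏ S`: all functions `f` on `S` with `f(A)` in the universe of `A`
for every `A ∈ S`. -/
def Product {τ : RelType.{u}} (S : Set (RelStruct τ)) : Type (u + 1) :=
  ∀ A : S, (A : RelStruct τ).carrier

/-- The relations of `∏ S` are defined pointwise. -/
instance {τ : RelType.{u}} (S : Set (RelStruct τ)) : τ.lang.Structure (Product S) where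
  funMap := fun f => Empty.elim f
  RelMap := fun {n} r v => ∀ A : S, (fun k => v k A) ∈ (A : RelStruct τ).rel n r

/-- The set `C ∩ V_β`, for a class `C` of structures of type `τ`. -/
def below (τ : RelType.{u}) (C : Set ZFSet.{u}) (β : Ordinal.{u}) : Set (RelStruct τ) :=
  {A | A.code ∈ C ∧ A.code ∈ V_ β}

/-- `f ∈ ∏ S` is a `⊆`-chain: `f(A) ⊆ f(B)` whenever the universe of `A` is contained in the
universe of `B`. -/
def IsSubsetChain {τ : RelType.{u}} {S : Set (RelStruct τ)} (f : Product S) : Prop :=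
  ∀ A B : S, (A : RelStruct τ).carrier ⊆ (B : RelStruct τ).carrier →
    (f A : ZFSet.{u}) ⊆ (f B : ZFSet.{u})

/-- `h` is faithful: `h(f)` and `f` agree on the domain of `f`. -/
def Faithful {τ : RelType.{u}} {S T : Set (RelStruct τ)} (h : Product S → Product T) : Prop :=
  ∀ (f : Product S) (A : RelStruct τ) (hS : A ∈ S), ∃ hT : A ∈ T, h f ⟨A, hT⟩ = f ⟨A, hS⟩

/-- `h` maps `⊆`-chains to `⊆`-chains. -/
def ChainPreserving {τ : RelType.{u}} {S T : Set (RelStruct τ)}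
    (h : Product S → Product T) : Prop :=
  ∀ f : Product S, IsSubsetChain f → IsSubsetChain (h f)

/-- `κ` product-reflects the class `C` of structures of type `τ`: for every `β ≥ κ` there are a set
`S ⊇ C ∩ V_β` of structures of type `τ` and a faithful, `⊆`-chain-preserving elementary embedding
of `∏ (C ∩ V_κ)` into `∏ S`. -/
def ProductReflects (τ : RelType.{u}) (C : Set ZFSet.{u}) (κ : Cardinal.{u}) : Prop :=
  ∀ β : Ordinal.{u}, κ.ord ≤ β →
    ∃ S : Set (RelStruct τ), Small.{u} S ∧ below τ C β ⊆ S ∧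
      ∃ h : Product (below τ C κ.ord) ↪ₑ[τ.lang] Product S, Faithful h ∧ ChainPreserving h

/-- `κ` witnesses `Π₁`-PSR: it product-reflects every proper class of relational structures of the
same type that is defined by a `Π₁` formula without parameters. -/
def WitnessesPi1PSR (κ : Cardinal.{u}) : Prop :=
  ∀ (φ : LSet.Formula Unit) (τ : RelType.{u}), IsPi1 φ →
    IsProperClass (definedClass.{u} φ) →
    (∀ x ∈ definedClass.{u} φ, ∃ A : RelStruct τ, A.code = x) →
    ProductReflects τ (definedClass.{u} φ) κ

end PSR

/-! ### Absoluteness of `Δ₀` and `Π₁` formulas, and a calculus of `Δ₀` predicates -/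

namespace PSR

open FirstOrder.Language

/-! ### Semantics of `Δ₀` formulas -/

/-! From strength to reflection, the map of products is an elementary embedding `j : V → M` applied
to functions. For given `β`, take `j` with `V_l ⊆ M` and `j(κ) > l` for a large cardinal `l`, put `K
= C ∩ V_κ`, and let `S` consist of the structures of type `τ` with code in `j(K)`. `Π₁` formulas go
down to `M` and `V_l ⊆ j(V_κ)`, so `C ∩ V_l ⊆ j(K)`. The map `f ↦ j(f)` is faithful because `j`
fixes sets of rank below `κ`, and it preserves chains because being a chain is `Δ₀`. Elementarity
needs an argument: `∏ S` is formed in `V` and may contain functions that are not in `M`. The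
Feferman–Vaught analysis (`exists_realize_iff_of_similarColouring`) reduces truth in a product to
counting, up to a finite threshold, the factors in which certain formulas hold, and satisfaction in
one factor is `Δ₀`. Infinite counts stay infinite because the factors from `K` survive in `S`; a
finite count is kept because its finitely many factors are fixed by `j`
(`min_encard_realize_productMap`).

Conversely, an extender is read off from a product embedding for one class, `linkClass`, of
structures `⟨V_{α+1}, ∈, links α⟩`. For a class `X` of `ω`-sequences of sets, the codes in `V_α` of
members of `X` form, as `α` varies, a chain `seqs X`. The value of its image at the factor with `α =
γ = λ⁺` is a set `ev X ⊆ V_γ`, and every `ω`-sequence `c` of sets of rank below `γ` yields the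
ultrafilter of those `X` with `encode c ∈ ev X`. The unary relation `links α` records reindexing of
sequences and prefixing a member of the first entry; this makes the ultrafilters cohere and supplies
bounded witnesses. As seeds are infinite sequences, countably many of them can be joined into one,
so well-foundedness of the ultrapower follows from countable completeness. In its collapse the
`i`-th coordinate function at seed `c` represents `c i`, which puts `V_γ` into the model, and almost
all sequences have entries of rank below `κ`, which gives `λ < j(κ)`.

Only properties that a product computes coordinatewise can be transferred to the single factor `γ`
(`CoordDef`): atoms, conjunctions, existential quantifiers, and universal ones whose guard is
satisfiable. For this reason every `seqs X` contains the dummy element `∅`, complements are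
expressed by covers, and constants are recovered from faithfulness together with chain preservation
(`value_const`). -/

theorem LSet_term_eq_var {β : Type} (t : LSet.Term β) : ∃ x, t = Term.var x := by
  cases t with
  | var x => exact ⟨x, rfl⟩
  | func f _ => exact Empty.elim f

theorem realize_memAtom {α : Type} {n : ℕ} (x y : α ⊕ Fin n) (p : α → ZFSet.{u})
    (v : Fin n → ZFSet.{u}) :
    (memAtom x y).Realize p v ↔ Sum.elim p v x ∈ Sum.elim p v y := Iff.rfl

theorem realize_memAtom_class {M : Set ZFSet.{u}} {α : Type} {n : ℕ} (x y : α ⊕ Fin n) (p : α → M)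
    (v : Fin n → M) :
    (memAtom x y).Realize p v ↔
      ((Sum.elim p v x : M) : ZFSet.{u}) ∈ ((Sum.elim p v y : M) : ZFSet.{u}) := Iff.rfl

theorem realize_ball {α : Type} {n : ℕ} (y : α ⊕ Fin n) (φ : LSet.BoundedFormula α (n + 1))
    (p : α → ZFSet.{u}) (v : Fin n → ZFSet.{u}) :
    (((memAtom (Sum.inr (Fin.last n)) (Sum.map id Fin.castSucc y)).imp φ).all).Realize p v ↔
      ∀ x ∈ Sum.elim p v y, φ.Realize p (Fin.snoc v x) := by
  simp only [BoundedFormula.realize_all, BoundedFormula.realize_imp, realize_memAtom]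
  refine forall_congr' fun x => ?_
  cases y <;> simp

theorem realize_ball_class {M : Set ZFSet.{u}} {α : Type} {n : ℕ} (y : α ⊕ Fin n)
    (φ : LSet.BoundedFormula α (n + 1)) (p : α → M) (v : Fin n → M) :
    (((memAtom (Sum.inr (Fin.last n)) (Sum.map id Fin.castSucc y)).imp φ).all).Realize p v ↔
      ∀ x : M, (x : ZFSet.{u}) ∈ ((Sum.elim p v y : M) : ZFSet.{u}) →
        φ.Realize p (Fin.snoc v x) := by
  simp only [BoundedFormula.realize_all, BoundedFormula.realize_imp, realize_memAtom_class]
  refine forall_congr' fun x => ?_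
  cases y <;> simp

/-- `Δ₀` formulas are absolute for transitive classes. -/
theorem IsDelta0.realize_class_iff {M : Set ZFSet.{u}} (hM : ∀ x ∈ M, ∀ y ∈ x, y ∈ M)
    {α : Type} {n : ℕ} {φ : LSet.BoundedFormula α n} (hφ : IsDelta0 φ) (p : α → M)
    (v : Fin n → M) :
    φ.Realize p v ↔ φ.Realize (fun a => (p a : ZFSet.{u})) (fun i => (v i : ZFSet.{u})) := by
  have key : ∀ {n : ℕ} (v : Fin n → M) (x : α ⊕ Fin n), ((Sum.elim p v x : M) : ZFSet.{u}) =
      Sum.elim (fun a => (p a : ZFSet.{u})) (fun i => (v i : ZFSet.{u})) x := by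
    rintro n v (x | x) <;> rfl
  induction hφ with
  | falsum => exact Iff.rfl
  | equal t s =>
    obtain ⟨x, rfl⟩ := LSet_term_eq_var t
    obtain ⟨y, rfl⟩ := LSet_term_eq_var s
    simp only [BoundedFormula.Realize, Term.realize_var, ← key, Subtype.ext_iff]
  | mem x y => rw [realize_memAtom_class, realize_memAtom, key, key]
  | imp _ _ ih₁ ih₂ => exact imp_congr (ih₁ v) (ih₂ v)
  | @ball n y φ _ ih =>
    rw [realize_ball_class, realize_ball]
    have hs : ∀ x : M, (fun i => ((Fin.snoc (α := fun _ => M) v x i : M) : ZFSet.{u})) =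
        Fin.snoc (α := fun _ => ZFSet.{u}) (fun i => (v i : ZFSet.{u})) (x : ZFSet.{u}) := by
      intro x
      funext i
      refine Fin.lastCases ?_ (fun i => ?_) i <;> simp
    constructor
    · intro h x hx
      rw [← key] at hx
      have := (ih _).1 (h ⟨x, hM _ (Subtype.coe_prop _) _ hx⟩ hx)
      rwa [hs] at this
    · intro h x hx
      rw [key] at hx
      refine (ih _).2 ?_
      rw [hs]
      exact h x hx

/-- `Π₁` formulas are downward absolute for transitive classes. -/
theorem IsPi1.realize_class {M : Set ZFSet.{u}} (hM : ∀ x ∈ M, ∀ y ∈ x, y ∈ M)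
    {α : Type} {n : ℕ} {φ : LSet.BoundedFormula α n} (hφ : IsPi1 φ) (p : α → M) (v : Fin n → M)
    (h : φ.Realize (fun a => (p a : ZFSet.{u})) (fun i => (v i : ZFSet.{u}))) :
    φ.Realize p v := by
  induction hφ with
  | delta0 hφ => exact (hφ.realize_class_iff hM p v).2 h
  | all _ ih =>
    rw [BoundedFormula.realize_all] at h ⊢
    intro x
    apply ih
    convert h x using 1
    funext i
    refine Fin.lastCases ?_ (fun i => ?_) i <;> simp

/-- Formulas carry free variables of two kinds. Letting `σ` mix the kinds is what allows parameters
to be merged, reordered and substituted in the calculus below. -/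
theorem IsDelta0.exists_rename {α : Type} {n : ℕ} {φ : LSet.BoundedFormula α n} (hφ : IsDelta0 φ)
    {β : Type} {m : ℕ} (σ : α ⊕ Fin n → β ⊕ Fin m) :
    ∃ ψ : LSet.BoundedFormula β m, IsDelta0 ψ ∧ ∀ (p : β → ZFSet.{u}) (v : Fin m → ZFSet.{u}),
      ψ.Realize p v ↔ φ.Realize (fun a => Sum.elim p v (σ (Sum.inl a)))
        (fun i => Sum.elim p v (σ (Sum.inr i))) := by
  induction hφ generalizing m with
  | falsum => exact ⟨_, .falsum, fun _ _ => Iff.rfl⟩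
  | equal t s =>
    obtain ⟨x, rfl⟩ := LSet_term_eq_var t
    obtain ⟨y, rfl⟩ := LSet_term_eq_var s
    refine ⟨_, .equal (Term.var (σ x)) (Term.var (σ y)), fun p v => ?_⟩
    cases x <;> cases y <;> exact Iff.rfl
  | mem x y =>
    refine ⟨_, .mem (σ x) (σ y), fun p v => ?_⟩
    rw [realize_memAtom, realize_memAtom]
    cases x <;> cases y <;> exact Iff.rfl
  | imp _ _ ih₁ ih₂ =>
    obtain ⟨ψ₁, h₁, r₁⟩ := ih₁ σ
    obtain ⟨ψ₂, h₂, r₂⟩ := ih₂ σ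
    exact ⟨_, h₁.imp h₂, fun p v => by
      rw [BoundedFormula.realize_imp, BoundedFormula.realize_imp, r₁, r₂]⟩
  | @ball n y φ _ ih =>
    obtain ⟨ψ, h, r⟩ := ih (m := m + 1) (Sum.elim (fun a => Sum.map id Fin.castSucc (σ (Sum.inl a)))
      (Fin.lastCases (Sum.inr (Fin.last m))
        (fun i => Sum.map id Fin.castSucc (σ (Sum.inr i)))))
    refine ⟨_, .ball (σ y) h, fun p v => ?_⟩
    have hs : ∀ (x : ZFSet.{u}) (z : β ⊕ Fin m),
        Sum.elim p (Fin.snoc (α := fun _ => ZFSet.{u}) v x) (Sum.map id Fin.castSucc z) =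
          Sum.elim p v z := by
      rintro x (z | z) <;> simp
    rw [realize_ball, realize_ball]
    have hy : Sum.elim (fun a => Sum.elim p v (σ (Sum.inl a)))
        (fun i => Sum.elim p v (σ (Sum.inr i))) y = Sum.elim p v (σ y) := by
      cases y <;> rfl
    rw [hy]
    refine forall₂_congr fun x _ => ?_
    rw [r]
    have e₁ : (fun i => Sum.elim p (Fin.snoc (α := fun _ => ZFSet.{u}) v x)
        (Sum.elim (fun a => Sum.map id Fin.castSucc (σ (Sum.inl a)))
        (Fin.lastCases (Sum.inr (Fin.last m))
        (fun i => Sum.map id Fin.castSucc (σ (Sum.inr i)))) (Sum.inr i : α ⊕ Fin (n + 1)))) =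
        Fin.snoc (α := fun _ => ZFSet.{u}) (fun i => Sum.elim p v (σ (Sum.inr i))) x := by
      funext i
      refine Fin.lastCases ?_ (fun i => ?_) i
      · simp
      · simp [hs]
    rw [e₁]
    simp only [Sum.elim_inl, hs]

/-! ### Predicates with a `Δ₀` definition -/

/-- The predicate `P` on `n`-tuples of sets is defined by a `Δ₀` formula with parameters in `Z`. -/
def Delta0Def (Z : Set ZFSet.{u}) {n : ℕ} (P : (Fin n → ZFSet.{u}) → Prop) : Prop :=
  ∃ (m : ℕ) (p : Fin m → ZFSet.{u}), (∀ i, p i ∈ Z) ∧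
    ∃ φ : LSet.BoundedFormula (Fin m) n, IsDelta0 φ ∧ ∀ v, φ.Realize p v ↔ P v

namespace Delta0Def

variable {Z : Set ZFSet.{u}} {n : ℕ}

theorem congr {P Q : (Fin n → ZFSet.{u}) → Prop} (h : Delta0Def Z P) (hPQ : ∀ v, Q v ↔ P v) :
    Delta0Def Z Q := by
  obtain rfl : Q = P := funext fun v => propext (hPQ v)
  exact h

theorem falsum : Delta0Def Z (fun _ : Fin n → ZFSet.{u} => False) :=
  ⟨0, Fin.elim0, fun i => i.elim0, _, .falsum, fun _ => Iff.rfl⟩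

theorem eq (i j : Fin n) : Delta0Def Z (fun v => v i = v j) :=
  ⟨0, Fin.elim0, fun i => i.elim0, _, .equal (Term.var (Sum.inr i)) (Term.var (Sum.inr j)),
    fun _ => Iff.rfl⟩

theorem mem (i j : Fin n) : Delta0Def Z (fun v => v i ∈ v j) :=
  ⟨0, Fin.elim0, fun i => i.elim0, _, .mem (Sum.inr i) (Sum.inr j), fun _ => Iff.rfl⟩

theorem imp {P Q : (Fin n → ZFSet.{u}) → Prop} (hP : Delta0Def Z P) (hQ : Delta0Def Z Q) :
    Delta0Def Z (fun v => P v → Q v) := by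
  obtain ⟨m, p, hp, φ, hφ, rφ⟩ := hP
  obtain ⟨k, q, hq, ψ, hψ, rψ⟩ := hQ
  obtain ⟨φ', hφ', rφ'⟩ := hφ.exists_rename.{u} (β := Fin (m + k)) (m := n)
    (Sum.map (Fin.castAdd k) id)
  obtain ⟨ψ', hψ', rψ'⟩ := hψ.exists_rename.{u} (β := Fin (m + k)) (m := n)
    (Sum.map (Fin.natAdd m) id)
  refine ⟨m + k, Fin.append p q, ?_, _, hφ'.imp hψ', fun v => ?_⟩
  · intro i
    refine Fin.addCases (fun i => ?_) (fun i => ?_) i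
    · simpa using hp i
    · simpa using hq i
  · beta_reduce
    rw [BoundedFormula.realize_imp, rφ', rψ', ← rφ, ← rψ]
    simp

theorem ball (i : Fin n) {P : (Fin n → ZFSet.{u}) → ZFSet.{u} → Prop}
    (h : Delta0Def Z (fun w : Fin (n + 1) → ZFSet.{u} => P (Fin.init w) (w (Fin.last n)))) :
    Delta0Def Z (fun v => ∀ x ∈ v i, P v x) := by
  obtain ⟨m, p, hp, φ, hφ, rφ⟩ := h
  refine ⟨m, p, hp, _, .ball (Sum.inr i) hφ, fun v => ?_⟩
  rw [realize_ball]
  refine forall₂_congr fun x _ => ?_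
  rw [rφ]
  simp

theorem rename {P : (Fin n → ZFSet.{u}) → Prop} (h : Delta0Def Z P) {m : ℕ} (σ : Fin n → Fin m) :
    Delta0Def Z (fun v => P (fun i => v (σ i))) := by
  obtain ⟨k, p, hp, φ, hφ, rφ⟩ := h
  obtain ⟨ψ, hψ, rψ⟩ := hφ.exists_rename.{u} (β := Fin k) (m := m) (Sum.map id σ)
  refine ⟨k, p, hp, ψ, hψ, fun v => ?_⟩
  beta_reduce
  rw [rψ, ← rφ]
  rfl

theorem const {z : ZFSet.{u}} (hz : z ∈ Z) {P : (Fin n → ZFSet.{u}) → ZFSet.{u} → Prop}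
    (h : Delta0Def Z (fun w : Fin (n + 1) → ZFSet.{u} => P (Fin.init w) (w (Fin.last n)))) :
    Delta0Def Z (fun v => P v z) := by
  obtain ⟨m, p, hp, φ, hφ, rφ⟩ := h
  obtain ⟨ψ, hψ, rψ⟩ := hφ.exists_rename.{u} (β := Fin (m + 1)) (m := n)
    (Sum.elim (fun a => Sum.inl (Fin.castSucc a))
      (Fin.lastCases (Sum.inl (Fin.last m)) (fun i => Sum.inr i)))
  refine ⟨m + 1, Fin.snoc p z, ?_, ψ, hψ, fun v => ?_⟩
  · intro i
    refine Fin.lastCases ?_ (fun i => ?_) i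
    · simpa using hz
    · simpa using hp i
  · have : ∀ v, P v z ↔ φ.Realize p (Fin.snoc v z) := by
      intro v
      rw [rφ]
      simp
    beta_reduce
    rw [rψ, this]
    have e : (fun i => Sum.elim (Fin.snoc (α := fun _ => ZFSet.{u}) p z) v
        (Sum.elim (fun a => Sum.inl (Fin.castSucc a))
      (Fin.lastCases (Sum.inl (Fin.last m)) (fun i => Sum.inr i))
      (Sum.inr i : Fin m ⊕ Fin (n + 1)) : Fin (m + 1) ⊕ Fin n)) =
        Fin.snoc (α := fun _ => ZFSet.{u}) v z := by
      funext i
      refine Fin.lastCases ?_ (fun i => ?_) i <;> simp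
    rw [e]
    simp

theorem not {P : (Fin n → ZFSet.{u}) → Prop} (hP : Delta0Def Z P) :
    Delta0Def Z (fun v => ¬ P v) := hP.imp falsum

theorem and {P Q : (Fin n → ZFSet.{u}) → Prop} (hP : Delta0Def Z P) (hQ : Delta0Def Z Q) :
    Delta0Def Z (fun v => P v ∧ Q v) :=
  (hP.imp hQ.not).not.congr fun v => by tauto

theorem or {P Q : (Fin n → ZFSet.{u}) → Prop} (hP : Delta0Def Z P) (hQ : Delta0Def Z Q) :
    Delta0Def Z (fun v => P v ∨ Q v) :=
  (hP.not.imp hQ).congr fun v => by tauto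

theorem iff {P Q : (Fin n → ZFSet.{u}) → Prop} (hP : Delta0Def Z P) (hQ : Delta0Def Z Q) :
    Delta0Def Z (fun v => P v ↔ Q v) :=
  ((hP.imp hQ).and (hQ.imp hP)).congr fun v => by tauto

theorem bex (i : Fin n) {P : (Fin n → ZFSet.{u}) → ZFSet.{u} → Prop}
    (h : Delta0Def Z (fun w : Fin (n + 1) → ZFSet.{u} => P (Fin.init w) (w (Fin.last n)))) :
    Delta0Def Z (fun v => ∃ x ∈ v i, P v x) :=
  (ball i (P := fun v x => ¬ P v x) h.not).not.congr fun v => by push Not; rfl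

theorem subset (i j : Fin n) : Delta0Def Z (fun v => v i ⊆ v j) :=
  (ball i (P := fun v x => x ∈ v j) (mem _ _)).congr fun _ => Iff.rfl

theorem eq_singleton (i j : Fin n) : Delta0Def Z (fun v => v i = {v j}) :=
  ((mem j i).and (ball i (P := fun v x => x = v j) (eq _ _))).congr fun v => by
    constructor
    · intro h; rw [h]; simp
    · rintro ⟨h₁, h₂⟩
      ext z
      rw [ZFSet.mem_singleton]
      exact ⟨h₂ z, fun h => h ▸ h₁⟩

theorem eq_upair (i j k : Fin n) : Delta0Def Z (fun v => v i = {v j, v k}) :=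
  (((mem j i).and (mem k i)).and
    (ball i (P := fun v x => x = v j ∨ x = v k) ((eq _ _).or (eq _ _)))).congr fun v => by
    constructor
    · intro h; rw [h]; simp
    · rintro ⟨⟨h₁, h₂⟩, h₃⟩
      ext z
      rw [ZFSet.mem_pair]
      refine ⟨h₃ z, ?_⟩
      rintro (rfl | rfl) <;> assumption

/-- The elements `{a}` and `{a, b}` of a Kuratowski pair are found inside the pair itself, so both
quantifiers are bounded. -/
theorem eq_pair (i j k : Fin n) : Delta0Def Z (fun v => v i = ZFSet.pair (v j) (v k)) :=
  (bex i (P := fun v x => x = {v j} ∧ ∃ y ∈ v i, y = {v j, v k} ∧ v i = {x, y})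
    ((eq_singleton _ _).and (bex (Fin.castSucc i)
      (P := fun w y => y = {w (Fin.castSucc j), w (Fin.castSucc k)} ∧
        w (Fin.castSucc i) = {w (Fin.last n), y})
      ((eq_upair _ _ _).and (eq_upair _ _ _))))).congr fun v => by
    constructor
    · intro h
      refine ⟨_, ?_, rfl, _, ?_, rfl, ?_⟩ <;> simp [h, ZFSet.pair]
    · rintro ⟨x, -, rfl, y, -, rfl, h⟩
      exact h

/-- An elementary embedding of the universe into a transitive class preserves `Δ₀` predicates
whose parameters it fixes. -/
theorem map_iff {M : Set ZFSet.{u}} (hM : ∀ x ∈ M, ∀ y ∈ x, y ∈ M) (j : ZFSet.{u} ↪ₑ[LSet] M)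
    (hZ : ∀ z ∈ Z, (j z : ZFSet.{u}) = z) {P : (Fin n → ZFSet.{u}) → Prop} (h : Delta0Def Z P)
    (v : Fin n → ZFSet.{u}) : P (fun i => (j (v i) : ZFSet.{u})) ↔ P v := by
  obtain ⟨m, p, hp, φ, hφ, rφ⟩ := h
  rw [← rφ, ← rφ v, ← j.map_boundedFormula φ p v, hφ.realize_class_iff hM]
  have : (fun a => ((j ∘ p) a : ZFSet.{u})) = p := funext fun a => hZ _ (hp a)
  rw [this]
  rfl

end Delta0Def

end PSR

/-! ### Counting colours up to a threshold, and the Feferman–Vaught theorem -/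

namespace PSR

open FirstOrder.Language

/-! ### Colourings that agree up to a threshold -/

/-- Two colourings use every colour equally often, where numbers above `N` are not told apart. -/
def SimilarColouring (N : ℕ) {X Y K : Type*} (p : X → K) (q : Y → K) : Prop :=
  ∀ k, min (N : ℕ∞) (p ⁻¹' {k}).encard = min (N : ℕ∞) (q ⁻¹' {k}).encard

theorem min_eq_min_iff_enat {N a b : ℕ∞} :
    min N a = min N b ↔ a = b ∨ (N ≤ a ∧ N ≤ b) := by
  grind

theorem min_add_eq_min_add_enat {N a b a' b' : ℕ∞} (h : min N a = min N a')
    (h' : min N b = min N b') : min N (a + b) = min N (a' + b') := by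
  rw [min_eq_min_iff_enat] at *
  rcases h with rfl | ⟨h, h₁⟩
  · rcases h' with rfl | ⟨h', h₂⟩
    · exact Or.inl rfl
    · exact Or.inr ⟨h'.trans le_add_self, h₂.trans le_add_self⟩
  · exact Or.inr ⟨h.trans le_self_add, h₁.trans le_self_add⟩

namespace SimilarColouring

variable {X Y K : Type*} {N : ℕ} {p : X → K} {q : Y → K}

theorem symm (h : SimilarColouring N p q) : SimilarColouring N q p := fun k => (h k).symm

theorem mono {N' : ℕ} (hN : N' ≤ N) (h : SimilarColouring N p q) : SimilarColouring N' p q := by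
  intro k
  have := h k
  rw [min_eq_min_iff_enat] at this ⊢
  have hN : (N' : ℕ∞) ≤ N := by exact_mod_cast hN
  rcases this with h | ⟨h₁, h₂⟩
  · exact Or.inl h
  · exact Or.inr ⟨hN.trans h₁, hN.trans h₂⟩

/-- A fibre of `e ∘ p` is a finite disjoint union of fibres of `p`, and truncated cardinalities can
be added. -/
theorem comp [Finite K] {K' : Type*} (h : SimilarColouring N p q) (e : K → K') :
    SimilarColouring N (e ∘ p) (e ∘ q) := by
  classical
  have key : ∀ s : Finset K, min (N : ℕ∞) (p ⁻¹' s).encard = min (N : ℕ∞) (q ⁻¹' s).encard := by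
    intro s
    induction s using Finset.induction_on with
    | empty => simp
    | insert k s hk ih =>
      rw [Finset.coe_insert, Set.insert_eq, Set.preimage_union, Set.preimage_union,
        Set.encard_union_eq, Set.encard_union_eq]
      · exact min_add_eq_min_add_enat (h k) ih
      · exact Disjoint.preimage _ (by simpa using hk)
      · exact Disjoint.preimage _ (by simpa using hk)
  intro k'
  have := key (Set.toFinite (e ⁻¹' {k'})).toFinset
  rwa [Set.Finite.coe_toFinset] at this

theorem exists_eq (hN : 1 ≤ N) (h : SimilarColouring N p q) (y : Y) : ∃ x, p x = q y := by
  by_contra! hx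
  have h₁ : p ⁻¹' {q y} = ∅ := Set.eq_empty_of_forall_notMem fun x => hx x
  have := h (q y)
  rw [h₁, Set.encard_empty, min_eq_min_iff_enat] at this
  rcases this with h | ⟨h, -⟩
  · have := Set.encard_eq_zero.1 h.symm
    exact (this ▸ (rfl : q y = q y) : y ∈ (∅ : Set Y))
  · have : N ≤ 0 := by exact_mod_cast h
    omega

end SimilarColouring

/-- By pigeonhole some colour `k₀` occurs at least `N` times in `X`. A sample of at most `N` points
of each colour fits injectively into `Y`, and `k₀` absorbs all remaining points. -/
theorem exists_similarColouring_of_encard_le {X Y K : Type*} [Finite K] [Nonempty K] {N : ℕ}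
    (hX : ((N * Nat.card K : ℕ) : ℕ∞) ≤ (Set.univ : Set X).encard)
    (hY : ((N * Nat.card K : ℕ) : ℕ∞) ≤ (Set.univ : Set Y).encard) (p : X → K) :
    ∃ q : Y → K, SimilarColouring N p q := by
  classical
  have := Fintype.ofFinite K
  rcases Nat.eq_zero_or_pos N with rfl | hN
  · exact ⟨fun _ => Classical.arbitrary K, fun k => by simp⟩
  obtain ⟨k₀, hk₀⟩ : ∃ k, (N : ℕ∞) ≤ (p ⁻¹' {k}).encard := by
    by_contra! hlt
    have h1 : (Set.univ : Set X).encard ≤ ∑ k : K, (p ⁻¹' {k}).encard := by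
      have : (Set.univ : Set X) = ⋃ k ∈ (Finset.univ : Finset K), p ⁻¹' {k} := by ext; simp
      rw [this]
      have : ∀ s : Finset K, (⋃ k ∈ s, p ⁻¹' {k}).encard ≤ ∑ k ∈ s, (p ⁻¹' {k}).encard := by
        intro s
        induction s using Finset.induction_on with
        | empty => simp
        | insert k s hk ih =>
          rw [Finset.set_biUnion_insert, Finset.sum_insert hk]
          exact (Set.encard_union_le _ _).trans (by gcongr)
      exact this _
    have h2 : ∀ k : K, (p ⁻¹' {k}).encard ≤ ((N - 1 : ℕ) : ℕ∞) := by
      intro k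
      have := hlt k
      apply Order.le_of_lt_add_one
      have h : ((N - 1 : ℕ) : ℕ∞) + 1 = N := by
        norm_cast
        omega
      rwa [h]
    have h3 := hX.trans (h1.trans (Finset.sum_le_sum fun k _ => h2 k))
    rw [Finset.sum_const, nsmul_eq_mul, Finset.card_univ, ← Nat.card_eq_fintype_card] at h3
    have h4 : N * Nat.card K ≤ Nat.card K * (N - 1) := by exact_mod_cast h3
    have h5 : 0 < Nat.card K := Nat.card_pos
    rw [mul_comm] at h4
    have := Nat.le_of_mul_le_mul_left h4 h5
    omega
  have hF : ∀ k, ∃ F ⊆ p ⁻¹' {k}, F.encard = min (N : ℕ∞) (p ⁻¹' {k}).encard :=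
    fun k => Set.exists_subset_encard_eq (min_le_right _ _)
  choose F hFs hFc using hF
  have hFfin : ∀ k, (F k).Finite := fun k => Set.finite_of_encard_le_coe (k := N)
    ((hFc k).le.trans (min_le_left _ _))
  set X₀ : Set X := ⋃ k, F k with hX₀
  have hX₀fin : X₀.Finite := Set.finite_iUnion hFfin
  have hX₀card : X₀.encard ≤ (Set.univ : Set Y).encard := by
    refine le_trans ?_ hY
    have : ∀ s : Finset K, (⋃ k ∈ s, F k).encard ≤ (N * s.card : ℕ) := by
      intro s
      induction s using Finset.induction_on with
      | empty => simp
      | insert k s hk ih =>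
        rw [Finset.set_biUnion_insert, Finset.card_insert_of_notMem hk, mul_add, mul_one, add_comm,
          Nat.cast_add]
        refine (Set.encard_union_le _ _).trans ?_
        gcongr
        exact (hFc k).le.trans (min_le_left _ _)
    have := this Finset.univ
    rw [Finset.card_univ, ← Nat.card_eq_fintype_card] at this
    simpa [hX₀] using this
  obtain ⟨Y₀, -, hY₀⟩ := Set.exists_subset_encard_eq hX₀card
  have hXne : (Set.univ : Set X).Nonempty := by
    rw [← Set.encard_pos]
    refine lt_of_lt_of_le ?_ hX
    have : 0 < N * Nat.card K := Nat.mul_pos hN Nat.card_pos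
    exact_mod_cast this
  have hYne : Nonempty Y := by
    have : (Set.univ : Set Y).Nonempty := by
      rw [← Set.encard_pos]
      refine lt_of_lt_of_le ?_ hY
      have : 0 < N * Nat.card K := Nat.mul_pos hN Nat.card_pos
      exact_mod_cast this
    exact ⟨this.some⟩
  obtain ⟨f, hf⟩ := hX₀fin.exists_bijOn_of_encard_eq hY₀.symm
  -- The excess colour `k₀` is already at the threshold on both sides, so giving it to more points
  -- changes no truncated count.
  let q : Y → K := fun y => if h : ∃ x ∈ X₀, f x = y then p h.choose else k₀
  have hq : ∀ x ∈ X₀, q (f x) = p x := by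
    intro x hx
    have h : ∃ x' ∈ X₀, f x' = f x := ⟨x, hx, rfl⟩
    have : q (f x) = p h.choose := dif_pos h
    rw [this, hf.injOn h.choose_spec.1 hx h.choose_spec.2]
  have hsub : ∀ k, f '' F k ⊆ q ⁻¹' {k} := by
    rintro k _ ⟨x, hx, rfl⟩
    have : q (f x) = p x := hq x (Set.mem_iUnion.2 ⟨k, hx⟩)
    rw [Set.mem_preimage, this]
    exact hFs k hx
  have hcard : ∀ k, (f '' F k).encard = min (N : ℕ∞) (p ⁻¹' {k}).encard := by
    intro k
    rw [← hFc k]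
    exact (hf.injOn.mono (Set.subset_iUnion _ k)).encard_image
  refine ⟨q, fun k => ?_⟩
  by_cases hk : k = k₀
  · subst hk
    have h1 : (N : ℕ∞) ≤ (q ⁻¹' {k}).encard := by
      refine le_trans ?_ (Set.encard_le_encard (hsub k))
      rw [hcard, min_eq_left hk₀]
    rw [min_eq_left hk₀, min_eq_left h1]
  · have : q ⁻¹' {k} = f '' F k := by
      refine Set.Subset.antisymm ?_ (hsub k)
      intro y hy
      by_cases h : ∃ x ∈ X₀, f x = y
      · obtain ⟨x, hx, rfl⟩ := h
        have h1 : p x = k := by rw [← hq x hx]; exact hy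
        obtain ⟨k', hk'⟩ := Set.mem_iUnion.1 hx
        have : p x = k' := hFs k' hk'
        rw [← this, h1] at hk'
        exact ⟨x, hk', rfl⟩
      · have : q y = k₀ := dif_neg h
        exact absurd (hy.symm.trans this) hk
    rw [this, hcard]
    simp

/-- One round of an Ehrenfeucht–Fraïssé game. Two fibres over the same colour either both have at
least `N * Nat.card K'` points, and the previous result applies, or they have the same finite size,
and a bijection copies the colours. -/
theorem SimilarColouring.exists_prod {X Y K K' : Type*} [Finite K'] [Nonempty K'] {N : ℕ}
    {p : X → K} {q : Y → K} (h : SimilarColouring (N * Nat.card K') p q) (p' : X → K') :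
    ∃ q' : Y → K', SimilarColouring N (fun x => (p x, p' x)) (fun y => (q y, q' y)) := by
  have key : ∀ k : K, ∃ r : (q ⁻¹' {k}) → K',
      SimilarColouring N (fun x : p ⁻¹' {k} => p' x) r := by
    intro k
    have hk := h k
    rw [min_eq_min_iff_enat] at hk
    by_cases hle : ((N * Nat.card K' : ℕ) : ℕ∞) ≤ (p ⁻¹' {k}).encard ∧
        ((N * Nat.card K' : ℕ) : ℕ∞) ≤ (q ⁻¹' {k}).encard
    · refine exists_similarColouring_of_encard_le (K := K') ?_ ?_ _
      · rw [Set.encard_univ, ENat.card_coe_set_eq]; exact hle.1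
      · rw [Set.encard_univ, ENat.card_coe_set_eq]; exact hle.2
    · have heq : (p ⁻¹' {k}).encard = (q ⁻¹' {k}).encard := by tauto
      have hfin : (p ⁻¹' {k}).Finite := by
        by_contra hinf
        have h1 := Set.Infinite.encard_eq hinf
        rw [h1] at heq
        rw [h1, ← heq] at hle
        exact hle ⟨le_top, le_top⟩
      have hfin' : (q ⁻¹' {k}).Finite := by
        rw [← Set.encard_lt_top_iff, ← heq, Set.encard_lt_top_iff]
        exact hfin
      have := hfin.to_subtype
      have := hfin'.to_subtype
      have hc : Nat.card (p ⁻¹' {k}) = Nat.card (q ⁻¹' {k}) := by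
        simp only [Nat.card_coe_set_eq, Set.ncard, heq]
      obtain ⟨e⟩ := Finite.card_eq.1 hc
      refine ⟨fun y => p' (e.symm y), fun k' => ?_⟩
      congr 1
      have : (fun y => p' (e.symm y)) ⁻¹' {k'} = e '' ((fun x : p ⁻¹' {k} => p' x) ⁻¹' {k'}) := by
        ext y
        simp [Set.mem_image_equiv]
      rw [this, e.injective.encard_image]
  choose r hr using key
  refine ⟨fun y => r (q y) ⟨y, rfl⟩, ?_⟩
  rintro ⟨k, k'⟩
  have h1 : (fun x => (p x, p' x)) ⁻¹' {(k, k')} =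
      Subtype.val '' ((fun x : p ⁻¹' {k} => p' x) ⁻¹' {k'}) := by
    ext x
    simp [and_comm]
  have h2 : (fun y => (q y, r (q y) ⟨y, rfl⟩)) ⁻¹' {(k, k')} =
      Subtype.val '' ((r k) ⁻¹' {k'}) := by
    ext y
    simp only [Set.mem_preimage, Set.mem_singleton_iff, Prod.mk.injEq, Set.mem_image,
      Subtype.exists, exists_and_right, exists_eq_right]
    constructor
    · rintro ⟨rfl, h⟩
      exact ⟨rfl, h⟩
    · rintro ⟨rfl, h⟩
      exact ⟨rfl, h⟩
  rw [h1, h2, Subtype.val_injective.encard_image, Subtype.val_injective.encard_image]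
  exact hr k _

/-! ### First-order truth in products -/

/-- A structure of type `τ`, as a first-order structure. -/
instance {τ : RelType.{u}} (A : RelStruct τ) : τ.lang.Structure A.carrier where
  funMap := fun f => Empty.elim f
  RelMap := fun r v => v ∈ A.rel _ r

theorem RelType.term_eq_var {τ : RelType.{u}} {β : Type*} (t : τ.lang.Term β) :
    ∃ x, t = Term.var x := by
  cases t with
  | var x => exact ⟨x, rfl⟩
  | func f _ => exact Empty.elim f

section

variable {τ : RelType.{u}} {α : Type} {n : ℕ}

/-- The set of those formulas of the family `Θ` that hold in the factor `A` at the coordinates of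
the given elements of the product. -/
def coordType {ι : Type} (Θ : ι → τ.lang.BoundedFormula α n) {S : Set (RelStruct τ)}
    (f : α → Product S) (g : Fin n → Product S) (A : S) : Set ι :=
  {i | (Θ i).Realize (fun a => f a A) (fun k => g k A)}

theorem exists_realize_iff_setOf_eq {ι : Type} [Finite ι] (Θ : ι → τ.lang.BoundedFormula α n)
    (t : Set ι) : ∃ ψ : τ.lang.BoundedFormula α n, ∀ (A : RelStruct τ) (v : α → A.carrier)
      (xs : Fin n → A.carrier), ψ.Realize v xs ↔ {i | (Θ i).Realize v xs} = t := by
  classical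
  refine ⟨BoundedFormula.iInf fun i => if i ∈ t then Θ i else (Θ i).not, fun A v xs => ?_⟩
  rw [BoundedFormula.realize_iInf, Set.ext_iff]
  refine forall_congr' fun i => ?_
  by_cases hi : i ∈ t <;> simp [hi]

theorem snoc_apply_coord {S : Set (RelStruct τ)} (g : Fin n → Product S) (a : Product S) (A : S) :
    (fun k => (Fin.snoc (α := fun _ => Product S) g a k) A) =
      Fin.snoc (α := fun _ => (A : RelStruct τ).carrier) (fun k => g k A) (a A) := by
  funext k
  refine Fin.lastCases ?_ (fun k => ?_) k <;> simp

theorem realize_equal_product {S : Set (RelStruct τ)} (f : α → Product S) (g : Fin n → Product S)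
    (t s : τ.lang.Term (α ⊕ Fin n)) :
    (BoundedFormula.equal t s).Realize f g ↔
      ∀ A : S, (BoundedFormula.equal t s).Realize (fun a => f a A) (fun k => g k A) := by
  obtain ⟨x, rfl⟩ := RelType.term_eq_var t
  obtain ⟨y, rfl⟩ := RelType.term_eq_var s
  simp only [BoundedFormula.Realize, Term.realize_var]
  cases x <;> cases y <;> exact funext_iff

theorem realize_rel_product {S : Set (RelStruct τ)} (f : α → Product S) (g : Fin n → Product S)
    {l : ℕ} (R : τ.lang.Relations l) (ts : Fin l → τ.lang.Term (α ⊕ Fin n)) :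
    (BoundedFormula.rel R ts).Realize f g ↔
      ∀ A : S, (BoundedFormula.rel R ts).Realize (fun a => f a A) (fun k => g k A) := by
  have : ∀ i, ∃ x, ts i = Term.var x := fun i => RelType.term_eq_var _
  choose x hx using this
  obtain rfl : ts = fun i => Term.var (x i) := funext hx
  simp only [BoundedFormula.Realize, Term.realize_var]
  refine forall_congr' fun A => ?_
  have : (fun k => (Sum.elim f g (x k) : Product S) A) =
      fun k => Sum.elim (fun a => f a A) (fun k => g k A) (x k) := by
    funext k
    cases x k <;> rfl
  exact iff_of_eq (congrArg (· ∈ (A : RelStruct τ).rel l R) this)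

theorem realize_iff_of_similarColouring_atom {φ : τ.lang.BoundedFormula α n}
    (hφ : ∀ (S : Set (RelStruct τ)) (f : α → Product S) (g : Fin n → Product S),
      φ.Realize f g ↔ ∀ A : S, φ.Realize (fun a => f a A) (fun k => g k A))
    {S T : Set (RelStruct τ)} {f : α → Product S} {g : Fin n → Product S}
    {f' : α → Product T} {g' : Fin n → Product T}
    (h : SimilarColouring 1 (coordType (fun _ : Unit => φ) f g)
      (coordType (fun _ : Unit => φ) f' g')) : φ.Realize f g → φ.Realize f' g' := by
  rw [hφ, hφ]
  intro hS B
  obtain ⟨A, hA⟩ := h.exists_eq le_rfl B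
  have h1 : () ∈ coordType (fun _ : Unit => φ) f g A := hS A
  rw [hA] at h1
  exact h1

/-- **Feferman–Vaught**: the truth of a formula in a product depends only on the numbers, up to
some threshold, of factors in which the coordinates have a given type with respect to a certain
finite family of formulas. -/
theorem exists_realize_iff_of_similarColouring (φ : τ.lang.BoundedFormula α n) :
    ∃ (ι : Type) (_ : Finite ι) (Θ : ι → τ.lang.BoundedFormula α n) (N : ℕ),
      ∀ (S T : Set (RelStruct τ)) (f : α → Product S) (g : Fin n → Product S)
        (f' : α → Product T) (g' : Fin n → Product T),
        SimilarColouring N (coordType Θ f g) (coordType Θ f' g') →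
        (φ.Realize f g ↔ φ.Realize f' g') := by
  induction φ with
  | falsum => exact ⟨Empty, inferInstance, fun i => i.elim, 0, fun _ _ _ _ _ _ _ => Iff.rfl⟩
  | equal t s =>
    exact ⟨Unit, inferInstance, fun _ => .equal t s, 1, fun S T f g f' g' h =>
      ⟨realize_iff_of_similarColouring_atom (fun _ _ _ => realize_equal_product _ _ t s) h,
        realize_iff_of_similarColouring_atom (fun _ _ _ => realize_equal_product _ _ t s) h.symm⟩⟩
  | rel R ts =>
    exact ⟨Unit, inferInstance, fun _ => .rel R ts, 1, fun S T f g f' g' h =>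
      ⟨realize_iff_of_similarColouring_atom (fun _ _ _ => realize_rel_product _ _ R ts) h,
        realize_iff_of_similarColouring_atom (fun _ _ _ => realize_rel_product _ _ R ts) h.symm⟩⟩
  | imp φ ψ ih₁ ih₂ =>
    obtain ⟨ι, _, Θ, N, hΘ⟩ := ih₁
    obtain ⟨ι', _, Θ', N', hΘ'⟩ := ih₂
    refine ⟨ι ⊕ ι', inferInstance, Sum.elim Θ Θ', max N N', fun S T f g f' g' h => ?_⟩
    have h₁ := (h.comp (fun t : Set (ι ⊕ ι') => Sum.inl ⁻¹' t)).mono (le_max_left N N')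
    have h₂ := (h.comp (fun t : Set (ι ⊕ ι') => Sum.inr ⁻¹' t)).mono (le_max_right N N')
    rw [BoundedFormula.realize_imp, BoundedFormula.realize_imp, hΘ S T f g f' g' h₁,
      hΘ' S T f g f' g' h₂]
  | @all n φ ih =>
    obtain ⟨ι, _, Θ, N, hΘ⟩ := ih
    choose Ψ hΨ using exists_realize_iff_setOf_eq Θ
    -- The new formulas ask which `Θ`-types an additional element can attain. Using `N + 1` instead
    -- of `N` ensures, even for `N = 0`, that a colour occurring on one side occurs on the other.
    refine ⟨Set ι, inferInstance, fun t => (Ψ t).ex, (N + 1) * Nat.card (Set ι),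
      fun S T f g f' g' h => ?_⟩
    have main : ∀ (S T : Set (RelStruct τ)) (f : α → Product S) (g : Fin n → Product S)
        (f' : α → Product T) (g' : Fin n → Product T),
        SimilarColouring ((N + 1) * Nat.card (Set ι)) (coordType (fun t => (Ψ t).ex) f g)
          (coordType (fun t => (Ψ t).ex) f' g') → φ.all.Realize f' g' → φ.all.Realize f g := by
      intro S T f g f' g' h hT
      rw [BoundedFormula.realize_all] at hT ⊢
      intro a
      -- Colour the factors by the `Θ`-type obtained after adding `a`, and imitate this on `T`. The
      -- type demanded at `B` is attained at a factor `A` where the same types are attainable, so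
      -- some `b` in `B` attains it.
      obtain ⟨q', hq'⟩ := h.exists_prod (coordType Θ f (Fin.snoc g a))
      have hb : ∀ B : T, ∃ b : (B : RelStruct τ).carrier,
          {i | (Θ i).Realize (fun a => f' a B) (Fin.snoc (fun k => g' k B) b)} = q' B := by
        intro B
        obtain ⟨A, hA⟩ := hq'.exists_eq (Nat.le_add_left _ _) B
        simp only [Prod.mk.injEq] at hA
        have h1 : q' B ∈ coordType (fun t => (Ψ t).ex) f g A := by
          rw [← hA.2]
          refine BoundedFormula.realize_ex.2 ⟨a A, (hΨ _ _ _ _).2 ?_⟩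
          rw [← snoc_apply_coord]
          rfl
        rw [hA.1] at h1
        obtain ⟨b, hb⟩ := BoundedFormula.realize_ex.1 h1
        exact ⟨b, (hΨ _ _ _ _).1 hb⟩
      choose b hb using hb
      have hb' : coordType Θ f' (Fin.snoc g' (b : Product T)) = q' := by
        funext B
        rw [← hb B]
        exact congrArg (fun w => {i | (Θ i).Realize (fun a => f' a B) w}) (snoc_apply_coord g' b B)
      have h2 := (hq'.comp Prod.snd).mono (Nat.le_succ N)
      refine (hΘ S T f (Fin.snoc g a) f' (Fin.snoc g' (b : Product T)) ?_).2 (hT b)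
      rw [hb']
      exact h2
    exact ⟨main T S f' g' f g h.symm, main S T f g f' g' h⟩

end

end PSR

/-! ### Ranks under an elementary embedding `j : V → M` -/

namespace PSR

open FirstOrder.Language

/-! ### Elementary embeddings of the universe -/

/-- Elementarity carries the universal statement to `M`, and each instance with entries in `M`
returns to `V` by absoluteness of its `Δ₀` matrix. -/
theorem Delta0Def.map_forall {M : Set ZFSet.{u}} (hM : ∀ x ∈ M, ∀ y ∈ x, y ∈ M)
    (j : ZFSet.{u} ↪ₑ[LSet] M) {n k : ℕ} {P : (Fin (n + k) → ZFSet.{u}) → Prop}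
    (h : Delta0Def ∅ P) (v : Fin n → ZFSet.{u}) (hv : ∀ w, P (Fin.append v w))
    (w : Fin k → ZFSet.{u}) (hw : ∀ i, w i ∈ M) :
    P (Fin.append (fun i => (j (v i) : ZFSet.{u})) w) := by
  obtain ⟨m, p, hp, φ, hφ, rφ⟩ := h
  obtain ⟨ψ, hψ, rψ⟩ := hφ.exists_rename.{u} (β := Fin n) (m := k)
    (Sum.elim (fun a => (hp a).elim)
      (Fin.addCases (fun i => Sum.inl i) (fun i => Sum.inr i)))
  have key : ∀ (v : Fin n → ZFSet.{u}) (w : Fin k → ZFSet.{u}),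
      ψ.Realize v w ↔ P (Fin.append v w) := by
    intro v w
    rw [rψ, ← rφ]
    have e₁ : (fun a => Sum.elim v w (Sum.elim (fun a => (hp a).elim)
      (Fin.addCases (fun i => Sum.inl i) (fun i => Sum.inr i))
        (Sum.inl a : Fin m ⊕ Fin (n + k)) : Fin n ⊕ Fin k)) = p := funext fun a => (hp a).elim
    have e₂ : (fun i => Sum.elim v w (Sum.elim (fun a => (hp a).elim)
      (Fin.addCases (fun i => Sum.inl i) (fun i => Sum.inr i))
        (Sum.inr i : Fin m ⊕ Fin (n + k)) : Fin n ⊕ Fin k)) = Fin.append v w := by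
      funext i
      refine Fin.addCases (fun i => ?_) (fun i => ?_) i <;> simp
    rw [e₁, e₂]
  have h1 : ψ.alls.Realize v := BoundedFormula.realize_alls.2 fun w => (key v w).2 (hv w)
  have h2 := BoundedFormula.realize_alls.1 ((j.map_formula ψ.alls v).2 h1) (fun i => ⟨w i, hw i⟩)
  rw [hψ.realize_class_iff hM] at h2
  exact (key _ _).1 h2

theorem map_mem_map_iff {M : Set ZFSet.{u}} (hM : ∀ x ∈ M, ∀ y ∈ x, y ∈ M)
    (j : ZFSet.{u} ↪ₑ[LSet] M) (x y : ZFSet.{u}) : (j x : ZFSet.{u}) ∈ (j y : ZFSet.{u}) ↔ x ∈ y :=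
  (Delta0Def.mem (Z := ∅) (0 : Fin 2) 1).map_iff hM j (by simp) ![x, y]

theorem map_pair {M : Set ZFSet.{u}} (hM : ∀ x ∈ M, ∀ y ∈ x, y ∈ M)
    (j : ZFSet.{u} ↪ₑ[LSet] M) (x y : ZFSet.{u}) :
    (j (ZFSet.pair x y) : ZFSet.{u}) = ZFSet.pair (j x) (j y) :=
  ((Delta0Def.eq_pair (Z := ∅) (0 : Fin 3) 1 2).map_iff hM j (by simp)
    ![ZFSet.pair x y, x, y]).2 rfl

/-- `f` is an `∈`-preserving relation from the transitive superset `t` of `x` to `a`; it bounds the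
rank of `x` by that of `a`. -/
def RankCertificate (f t a x : ZFSet.{u}) : Prop :=
  x ⊆ t ∧ (∀ y ∈ t, ∀ z ∈ y, z ∈ t) ∧ (∀ y ∈ t, ∃ b ∈ a, ∃ p ∈ f, p = ZFSet.pair y b) ∧
    ∀ y ∈ t, ∀ z ∈ y, ∀ b ∈ a, ∀ c ∈ a, ∀ p ∈ f, ∀ q ∈ f,
      p = ZFSet.pair y b → q = ZFSet.pair z c → c ∈ b

theorem delta0Def_rankCertificate {Z : Set ZFSet.{u}} {n : ℕ} (f t a x : Fin n) :
    Delta0Def Z (fun v => RankCertificate (v f) (v t) (v a) (v x)) := by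
  unfold RankCertificate
  exact .and (.subset _ _) (.and (.ball _ (.ball _ (.mem _ _)))
    (.and (.ball _ (.bex _ (.bex _ (.eq_pair _ _ _))))
      (.ball _ (.ball _ (.ball _ (.ball _ (.ball _ (.ball _
        (.imp (.eq_pair _ _ _) (.imp (.eq_pair _ _ _) (.mem _ _)))))))))))

theorem RankCertificate.rank_le {f t a x : ZFSet.{u}} (h : RankCertificate f t a x) :
    x.rank ≤ a.rank := by
  obtain ⟨hxt, ht, hf, hmono⟩ := h
  have key : ∀ y ∈ t, ∀ b ∈ a, ZFSet.pair y b ∈ f → y.rank ≤ b.rank := by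
    intro y
    induction y using ZFSet.inductionOn with
    | h y ih =>
      intro hy b hb hp
      rw [ZFSet.rank_le_iff]
      intro z hz
      obtain ⟨c, hc, q, hq, rfl⟩ := hf z (ht y hy z hz)
      have hcb : c ∈ b := hmono y hy z hz b hb c hc _ hp _ hq rfl rfl
      exact (ih z hz (ht y hy z hz) c hc hq).trans_lt (ZFSet.rank_lt_of_mem hcb)
  rw [ZFSet.rank_le_iff]
  intro y hy
  obtain ⟨b, hb, q, hq, rfl⟩ := hf y (hxt hy)
  exact (key y (hxt hy) b hb hq).trans_lt (ZFSet.rank_lt_of_mem hb)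

/-- The function that assigns their ranks to the sets of rank below `o`. -/
noncomputable def rankGraph (o : Ordinal.{u}) : ZFSet.{u} :=
  ZFSet.range (fun y : V_ o => ZFSet.pair y (y : ZFSet.{u}).rank.toZFSet)

theorem rankCertificate_rankGraph {x : ZFSet.{u}} {o : Ordinal.{u}} (h : x.rank ≤ o) :
    RankCertificate (rankGraph o) (V_ o) o.toZFSet x := by
  refine ⟨ZFSet.subset_vonNeumann.2 h, fun y hy z hz => ZFSet.isTransitive_vonNeumann o y hy hz,
    ?_, ?_⟩
  · intro y hy
    refine ⟨y.rank.toZFSet, ?_, _, ZFSet.mem_range.2 ⟨⟨y, hy⟩, rfl⟩, rfl⟩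
    rw [Ordinal.toZFSet_mem_toZFSet_iff]
    exact ZFSet.mem_vonNeumann.1 hy
  · rintro y hy z hz b hb c hc p hp q hq rfl rfl
    obtain ⟨y', h⟩ := ZFSet.mem_range.1 hp
    obtain ⟨z', h'⟩ := ZFSet.mem_range.1 hq
    rw [ZFSet.pair_inj] at h h'
    rw [← h.2, ← h'.2, h.1, h'.1, Ordinal.toZFSet_mem_toZFSet_iff]
    exact ZFSet.rank_lt_of_mem hz

theorem rank_pair_lt {x y : ZFSet.{u}} {o : Ordinal.{u}} (ho : Order.IsSuccLimit o)
    (hx : x.rank < o) (hy : y.rank < o) : (ZFSet.pair x y).rank < o := by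
  simp only [ZFSet.pair, ZFSet.rank_pair, ZFSet.rank_singleton, max_lt_iff]
  exact ⟨ho.succ_lt (ho.succ_lt hx), ho.succ_lt (max_lt (ho.succ_lt hx) (ho.succ_lt hy))⟩

theorem rank_rankGraph_lt {o l : Ordinal.{u}} (hl : Order.IsSuccLimit l) (h : o < l) :
    (rankGraph o).rank < l := by
  have h1 : (rankGraph o).rank ≤ Order.succ (Order.succ (Order.succ o)) := by
    rw [ZFSet.rank_le_iff]
    intro p hp
    obtain ⟨y, rfl⟩ := ZFSet.mem_range.1 hp
    have hy : (y : ZFSet.{u}).rank < o := ZFSet.mem_vonNeumann.1 y.2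
    simp only [ZFSet.pair, ZFSet.rank_pair, ZFSet.rank_singleton, Ordinal.rank_toZFSet, max_self]
    rw [Order.lt_succ_iff, Order.succ_le_succ_iff, Order.succ_le_succ_iff]
    exact hy.le
  exact h1.trans_lt (hl.succ_lt (hl.succ_lt (hl.succ_lt h)))

/-- The embedding maps rank certificates to rank certificates, and these are correct in `V`. The
detour avoids any analysis of the rank function as computed in `M`. -/
theorem rank_map_le {M : Set ZFSet.{u}} (hM : ∀ x ∈ M, ∀ y ∈ x, y ∈ M)
    (j : ZFSet.{u} ↪ₑ[LSet] M) {x : ZFSet.{u}} {o : Ordinal.{u}}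
    (ho : (j o.toZFSet : ZFSet.{u}) = o.toZFSet)
    (hx : x.rank ≤ o) : (j x : ZFSet.{u}).rank ≤ o := by
  have h1 := ((delta0Def_rankCertificate (Z := ∅) (0 : Fin 4) 1 2 3).map_iff hM j (by simp)
    ![rankGraph o, V_ o, o.toZFSet, x]).2 (rankCertificate_rankGraph hx)
  have h2 := RankCertificate.rank_le h1
  have h3 : (j o.toZFSet : ZFSet.{u}).rank = o := by rw [ho, Ordinal.rank_toZFSet]
  exact h2.trans h3.le

/-- Sets of rank below the critical point are fixed. -/
theorem map_eq_self {M : Set ZFSet.{u}} (hM : ∀ x ∈ M, ∀ y ∈ x, y ∈ M)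
    (j : ZFSet.{u} ↪ₑ[LSet] M) {κ : Ordinal.{u}}
    (hκ : ∀ o < κ, (j o.toZFSet : ZFSet.{u}) = o.toZFSet)
    (x : ZFSet.{u}) (hx : x.rank < κ) : (j x : ZFSet.{u}) = x := by
  generalize hr : x.rank = o at hx
  induction o using WellFoundedLT.induction generalizing x with
  | ind o ih =>
    -- Elements of `j x` need not be images. The rank bound makes the induction hypothesis available
    -- for them, so that each is its own image.
    have hle := rank_map_le hM j (hκ o hx) hr.le
    ext y
    constructor
    · intro hy
      have hyo : y.rank < o := (ZFSet.rank_lt_of_mem hy).trans_le hle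
      have := ih _ hyo y rfl (hyo.trans hx)
      rw [← this] at hy
      exact (map_mem_map_iff hM j y x).1 hy
    · intro hy
      have hyo : y.rank < o := hr ▸ ZFSet.rank_lt_of_mem hy
      have := ih _ hyo y rfl (hyo.trans hx)
      rw [← this]
      exact (map_mem_map_iff hM j y x).2 hy

/-- That a set with rank certified by an element of `κ` lies in `V_κ` is a universal `Δ₀` statement,
hence true in `M` of `j(κ)` and `j(V_κ)`. For `x ∈ V_l` a certificate exists in `V_l ⊆ M` because
`l` is a limit, and its ordinal belongs to `j(κ)` because `l` does. -/
theorem vonNeumann_subset_map {M : Set ZFSet.{u}} (hM : ∀ x ∈ M, ∀ y ∈ x, y ∈ M)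
    (j : ZFSet.{u} ↪ₑ[LSet] M) {κ l : Ordinal.{u}} (hl : Order.IsSuccLimit l)
    (hlκ : l.toZFSet ∈ (j κ.toZFSet : ZFSet.{u})) (hlM : ∀ x ∈ V_ l, x ∈ M) :
    V_ l ⊆ (j (V_ κ) : ZFSet.{u}) := by
  intro x hx
  have hD : Delta0Def (n := 2 + 4) ∅ (fun v : Fin 6 → ZFSet.{u} => v 4 ∈ v 0 →
      RankCertificate (v 2) (v 3) (v 4) (v 5) → v 5 ∈ v 1) :=
    .imp (.mem _ _) (.imp (delta0Def_rankCertificate _ _ _ _) (.mem _ _))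
  have hxr := ZFSet.mem_vonNeumann.1 hx
  have h := hD.map_forall hM j ![κ.toZFSet, V_ κ] (by
    intro w h1 h2
    change w 2 ∈ κ.toZFSet at h1
    change RankCertificate (w 0) (w 1) (w 2) (w 3) at h2
    change w 3 ∈ V_ κ
    obtain ⟨a, ha, h3⟩ := Ordinal.mem_toZFSet_iff.1 h1
    rw [ZFSet.mem_vonNeumann]
    refine h2.rank_le.trans_lt ?_
    rw [← h3, Ordinal.rank_toZFSet]
    exact ha) ![rankGraph x.rank, V_ x.rank, x.rank.toZFSet, x] (by
    intro i
    apply hlM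
    rw [ZFSet.mem_vonNeumann]
    fin_cases i
    · exact rank_rankGraph_lt hl hxr
    · simpa using hxr
    · simpa using hxr
    · exact hxr)
  refine h ?_ (rankCertificate_rankGraph le_rfl)
  change x.rank.toZFSet ∈ (j κ.toZFSet : ZFSet.{u})
  have htrans := ((Delta0Def.ball (Z := ∅) (n := 1) 0 (P := fun v y => ∀ z ∈ y, z ∈ v 0)
    (.ball _ (.mem _ _))).map_iff hM j (by simp) ![κ.toZFSet]).2 (by
      intro y hy z hz
      exact (ZFSet.isOrdinal_toZFSet κ).mem_trans hz hy)
  exact htrans _ hlκ _ (Ordinal.toZFSet_mem_toZFSet_iff.2 hxr)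

end PSR

/-! ### Structures as sets, with `Δ₀` satisfaction -/

namespace PSR

open FirstOrder.Language

/-! ### Codes of structures -/

theorem tuple_injective : ∀ n : ℕ, Function.Injective (tuple.{u} n)
  | 0 => fun v w _ => funext fun i => i.elim0
  | 1 => fun v w h => funext fun i => by
      rw [Subsingleton.elim i 0]
      exact h
  | n + 2 => fun v w h => by
      obtain ⟨h₁, h₂⟩ := ZFSet.pair_inj.1 h
      have h₃ := tuple_injective (n + 1) h₁
      funext i
      refine Fin.lastCases h₂ (fun i => ?_) i
      exact congrFun h₃ i

/-- The argument at which the code of a structure has the interpretation of `r`. -/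
noncomputable def symbolKey {τ : RelType.{u}} (n : ℕ) (r : τ.symbols n) : ZFSet.{u} :=
  ZFSet.pair (n : Ordinal.{u}).toZFSet r

/-- The family of the relations of a structure, as a set. -/
noncomputable def RelStruct.relFamily {τ : RelType.{u}} (A : RelStruct τ) : ZFSet.{u} :=
  ZFSet.range (fun p : Σ n : ℕ, τ.symbols n =>
    ZFSet.pair (symbolKey p.1 p.2) (A.relSet p.1 p.2))

section

variable {τ : RelType.{u}}

theorem RelStruct.code_eq (A : RelStruct τ) : A.code = ZFSet.pair A.carrier A.relFamily := rfl

theorem symbolKey_inj {n m : ℕ} {r : τ.symbols n} {s : τ.symbols m} :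
    symbolKey n r = symbolKey m s ↔ (⟨n, r⟩ : Σ n : ℕ, τ.symbols n) = ⟨m, s⟩ := by
  constructor
  · intro h
    obtain ⟨h₁, h₂⟩ := ZFSet.pair_inj.1 h
    have h₃ : n = m := by exact_mod_cast Ordinal.toZFSet_injective h₁
    subst h₃
    rw [Subtype.ext h₂]
  · intro h
    cases h
    rfl

theorem RelStruct.tuple_mem_relSet (A : RelStruct τ) {n : ℕ} (r : τ.symbols n)
    (v : Fin n → A.carrier) :
    tuple n (fun k => (v k : ZFSet.{u})) ∈ A.relSet n r ↔ v ∈ A.rel n r := by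
  rw [RelStruct.relSet, ZFSet.mem_range]
  constructor
  · rintro ⟨w, hw⟩
    have := tuple_injective n hw
    have : (w : Fin n → A.carrier) = v := funext fun k => Subtype.ext (congrFun this k)
    exact this ▸ w.2
  · intro h
    exact ⟨⟨v, h⟩, rfl⟩

theorem RelStruct.pair_symbolKey_mem_relFamily (A : RelStruct τ) {n : ℕ} (r : τ.symbols n)
    (R : ZFSet.{u}) :
    ZFSet.pair (symbolKey n r) R ∈ A.relFamily ↔ R = A.relSet n r := by
  rw [RelStruct.relFamily, ZFSet.mem_range]
  constructor
  · rintro ⟨p, hp⟩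
    obtain ⟨h₁, h₂⟩ := ZFSet.pair_inj.1 hp
    have h₃ := symbolKey_inj.1 h₁
    cases h₃
    exact h₂.symm
  · rintro rfl
    exact ⟨⟨n, r⟩, rfl⟩

theorem RelStruct.code_injective : Function.Injective (RelStruct.code (τ := τ)) := by
  intro A B h
  rw [RelStruct.code_eq, RelStruct.code_eq, ZFSet.pair_inj] at h
  obtain ⟨h₁, h₂⟩ := h
  have h₃ : ∀ n (r : τ.symbols n), A.relSet n r = B.relSet n r := by
    intro n r
    rw [← RelStruct.pair_symbolKey_mem_relFamily, ← h₂, RelStruct.pair_symbolKey_mem_relFamily]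
  obtain ⟨a, ha, R⟩ := A
  obtain ⟨b, hb, R'⟩ := B
  change a = b at h₁
  subst h₁
  congr 1
  funext n r
  ext v
  rw [← RelStruct.tuple_mem_relSet ⟨a, ha, R⟩ r v, h₃ n r,
    RelStruct.tuple_mem_relSet ⟨a, ha, R'⟩ r v]

end

/-! ### Further closure properties of `Δ₀` predicates -/

namespace Delta0Def

variable {Z : Set ZFSet.{u}} {n : ℕ}

/-- Both components of a pair are elements of its element `{a, r}`, which bounds the quantifiers. -/
theorem exists_pair (i : Fin n) {P : (Fin n → ZFSet.{u}) → ZFSet.{u} → ZFSet.{u} → Prop}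
    (h : Delta0Def Z (fun w : Fin (n + 2) → ZFSet.{u} =>
      P (Fin.init (Fin.init w)) (w (Fin.last n).castSucc) (w (Fin.last (n + 1))))) :
    Delta0Def Z (fun v => ∃ a r, v i = ZFSet.pair a r ∧ P v a r) := by
  have h' := h.rename (m := n + 3) (Fin.lastCases (Fin.last (n + 2)) (Fin.lastCases
    (Fin.last (n + 1)).castSucc (fun i => i.castSucc.castSucc.castSucc)))
  refine (bex i (P := fun v s => ∃ a ∈ s, ∃ r ∈ s, v i = ZFSet.pair a r ∧ P v a r)
    (bex _ (bex _ (and (eq_pair _ _ _) (h'.congr fun w => ?_))))).congr fun v => ?_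
  · have : Fin.init (Fin.init (fun k : Fin (n + 2) => w (Fin.lastCases (Fin.last (n + 2))
        (Fin.lastCases (Fin.last (n + 1)).castSucc (fun i => i.castSucc.castSucc.castSucc)) k))) =
        Fin.init (Fin.init (Fin.init w)) := by
      funext k
      simp [Fin.init]
    rw [this]
    simp [Fin.init]
  · constructor
    · rintro ⟨a, r, h₁, h₂⟩
      refine ⟨{a, r}, ?_, a, by simp, r, by simp, h₁, h₂⟩
      rw [h₁, ZFSet.pair]
      simp
    · rintro ⟨s, -, a, -, r, -, h⟩
      exact ⟨a, r, h⟩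

theorem pair_mem (i j k : Fin n) : Delta0Def Z (fun v => ZFSet.pair (v i) (v j) ∈ v k) :=
  (bex k (P := fun v p => p = ZFSet.pair (v i) (v j)) (eq_pair _ _ _)).congr fun v => by simp

theorem eq_empty (i : Fin n) : Delta0Def Z (fun v => v i = ∅) :=
  (ball i (P := fun _ _ => False) falsum).congr fun v => by
    rw [ZFSet.eq_empty]

theorem mem_finite {s : Set ZFSet.{u}} (hs : s.Finite) (hsZ : s ⊆ Z) (i : Fin n) :
    Delta0Def Z (fun v => v i ∈ s) := by
  induction s, hs using Set.Finite.induction_on with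
  | empty => exact falsum
  | @insert a s _ _ ih =>
    exact (or (const (P := fun v z => v i = z) (hsZ (Set.mem_insert a s)) (eq _ _))
      (ih ((Set.subset_insert a s).trans hsZ))).congr fun v => Iff.rfl

theorem eq_tuple (i : Fin n) (k : ℕ) (ρ : Fin k → Fin n) :
    Delta0Def Z (fun v => v i = tuple k (fun l => v (ρ l))) := by
  induction k using Nat.twoStepInduction generalizing n with
  | zero => exact eq_empty i
  | one => exact eq i (ρ 0)
  | more k _ ih =>
    refine (exists_pair i (P := fun v s y => s = tuple (k + 1) (fun l => v (ρ l.castSucc)) ∧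
      y = v (ρ (Fin.last _))) (and (ih _ (fun l => (ρ l.castSucc).castSucc.castSucc))
        (eq _ _))).congr fun v => ?_
    constructor
    · intro h
      exact ⟨_, _, h, rfl, rfl⟩
    · rintro ⟨_, _, h, rfl, rfl⟩
      exact h

theorem exists_fin (i : Fin n) (k : ℕ)
    {P : (Fin n → ZFSet.{u}) → (Fin k → ZFSet.{u}) → Prop}
    (h : Delta0Def Z (fun w : Fin (n + k) → ZFSet.{u} =>
      P (fun l => w (Fin.castAdd k l)) (fun l => w (Fin.natAdd n l)))) :
    Delta0Def Z (fun v => ∃ y : Fin k → ZFSet.{u}, (∀ l, y l ∈ v i) ∧ P v y) := by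
  induction k with
  | zero =>
    refine h.congr fun v => ?_
    constructor
    · rintro ⟨y, -, hy⟩
      rwa [Subsingleton.elim y (fun l : Fin 0 => v (Fin.natAdd n l))] at hy
    · intro hy
      exact ⟨_, fun l => l.elim0, hy⟩
  | succ k ih =>
    refine (ih (P := fun v y => ∃ z ∈ v i, P v (Fin.snoc y z)) (bex (Fin.castAdd k i)
      (P := fun w z => P (fun l => w (Fin.castAdd k l))
        (Fin.snoc (fun l => w (Fin.natAdd n l)) z)) (h.congr fun w => ?_))).congr fun v => ?_
    · have : (Fin.snoc (α := fun _ => ZFSet.{u}) (fun l => Fin.init w (Fin.natAdd n l))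
          (w (Fin.last (n + k))) : Fin (k + 1) → ZFSet.{u}) = fun l => w (Fin.natAdd n l) := by
        funext l
        refine Fin.lastCases ?_ (fun l => ?_) l
        · simp
        · simp [Fin.init]
      rw [this]
      rfl
    · constructor
      · rintro ⟨y, hy, h⟩
        refine ⟨Fin.init y, fun l => hy _, y (Fin.last k), hy _, ?_⟩
        rwa [Fin.snoc_init_self]
      · rintro ⟨y, hy, z, hz, h⟩
        refine ⟨Fin.snoc y z, fun l => ?_, h⟩
        refine Fin.lastCases ?_ (fun l => ?_) l
        · simpa using hz
        · simpa using hy l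

end Delta0Def

/-! ### Satisfaction in a coded structure -/

section

variable {τ : RelType.{u}}

/-- The variable that a term of a relational language is. -/
def RelType.termVar {β : Type} : τ.lang.Term β → β
  | .var x => x
  | .func f _ => Empty.elim f

/-- Satisfaction in the structure with universe `a` and family of relations `r`. -/
def CodeSat (a r : ZFSet.{u}) {α : Type} : ∀ {n : ℕ}, τ.lang.BoundedFormula α n →
    (α → ZFSet.{u}) → (Fin n → ZFSet.{u}) → Prop
  | _, .falsum, _, _ => False
  | _, .equal t s, f, g =>
      Sum.elim f g (RelType.termVar t) = Sum.elim f g (RelType.termVar s)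
  | _, .rel (l := l) R ts, f, g => ∃ p ∈ r, ∃ q S, p = ZFSet.pair q S ∧
      q = symbolKey (τ := τ) l R ∧
      ∃ t ∈ S, t = tuple l (fun k => Sum.elim f g (RelType.termVar (ts k)))
  | _, .imp φ ψ, f, g => CodeSat a r φ f g → CodeSat a r ψ f g
  | _, .all φ, f, g => ∀ x ∈ a, CodeSat a r φ f (Fin.snoc g x)

theorem RelStruct.realize_iff_codeSat (A : RelStruct τ) {α : Type} {n : ℕ}
    (φ : τ.lang.BoundedFormula α n) (f : α → A.carrier) (g : Fin n → A.carrier) :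
    φ.Realize f g ↔ CodeSat A.carrier A.relFamily φ (fun a => (f a : ZFSet.{u}))
      (fun k => (g k : ZFSet.{u})) := by
  have hval : ∀ {n : ℕ} (g : Fin n → A.carrier) (x : α ⊕ Fin n),
      Sum.elim (fun a => (f a : ZFSet.{u})) (fun k => (g k : ZFSet.{u})) x =
        ((Sum.elim f g x : A.carrier) : ZFSet.{u}) := by
    rintro n g (x | x) <;> rfl
  induction φ with
  | falsum => exact Iff.rfl
  | equal t s =>
    obtain ⟨x, rfl⟩ := RelType.term_eq_var t
    obtain ⟨y, rfl⟩ := RelType.term_eq_var s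
    rw [CodeSat, hval, hval, ← Subtype.ext_iff]
    exact Iff.rfl
  | @rel n l R ts =>
    have : ∀ i, ∃ x, ts i = Term.var x := fun i => RelType.term_eq_var _
    choose x hx using this
    obtain rfl : ts = fun i => Term.var (x i) := funext hx
    rw [CodeSat]
    simp only [hval]
    have h1 : (BoundedFormula.rel R fun i => Term.var (x i)).Realize f g ↔
        (fun k => Sum.elim f g (x k)) ∈ A.rel l R := Iff.rfl
    refine h1.trans ((A.tuple_mem_relSet (n := l) R _).symm.trans ?_)
    constructor
    · intro h
      exact ⟨_, (A.pair_symbolKey_mem_relFamily R _).2 rfl, _, _, rfl, rfl, _, h, rfl⟩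
    · rintro ⟨_, hp, _, S, rfl, rfl, t, ht, rfl⟩
      have hS := (A.pair_symbolKey_mem_relFamily (n := l) R S).1 hp
      subst hS
      exact ht
  | imp φ ψ ih₁ ih₂ => exact imp_congr (ih₁ g) (ih₂ g)
  | all φ ih =>
    rw [BoundedFormula.realize_all, CodeSat]
    have hs : ∀ x : A.carrier, (fun k => ((Fin.snoc (α := fun _ => A.carrier) g x k : A.carrier) :
        ZFSet.{u})) = Fin.snoc (α := fun _ => ZFSet.{u}) (fun k => (g k : ZFSet.{u})) x := by
      intro x
      funext k
      refine Fin.lastCases ?_ (fun k => ?_) k <;> simp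
    constructor
    · intro h x hx
      have := (ih _).1 (h ⟨x, hx⟩)
      rwa [hs] at this
    · intro h x
      refine (ih _).2 ?_
      rw [hs]
      exact h x x.2

/-- Quantifiers range over the universe `a`, and looking up a relation symbol is a bounded search in
`r`. The only parameters are the keys of the symbols. -/
theorem delta0Def_codeSat {Z : Set ZFSet.{u}} (hZ : ∀ (l : ℕ) (R : τ.symbols l), symbolKey l R ∈ Z)
    {α : Type} {n : ℕ} (φ : τ.lang.BoundedFormula α n) {m : ℕ} (ia ir : Fin m) (σ : α → Fin m)
    (ρ : Fin n → Fin m) :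
    Delta0Def Z (fun w => CodeSat (w ia) (w ir) φ (fun a => w (σ a)) (fun k => w (ρ k))) := by
  have hval : ∀ {n m : ℕ} (σ : α → Fin m) (ρ : Fin n → Fin m) (w : Fin m → ZFSet.{u})
      (x : α ⊕ Fin n), Sum.elim (fun a => w (σ a)) (fun k => w (ρ k)) x = w (Sum.elim σ ρ x) := by
    rintro n m σ ρ w (x | x) <;> rfl
  induction φ generalizing m with
  | falsum => exact .falsum
  | equal t s =>
    simp only [CodeSat, hval]
    exact .eq _ _
  | rel R ts =>
    simp only [CodeSat, hval]
    refine .bex _ (.exists_pair _ (.and (.const (P := fun w z => w (Fin.last _).castSucc = z)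
      (hZ _ R) (.eq _ _)) (.bex _ ?_)))
    exact .eq_tuple _ _ (fun k => (Sum.elim σ ρ (RelType.termVar
      (ts k))).castSucc.castSucc.castSucc.castSucc)
  | imp φ ψ ih₁ ih₂ => exact .imp (ih₁ _ _ _ _) (ih₂ _ _ _ _)
  | @all n φ ih =>
    simp only [CodeSat]
    refine .ball _ ((ih (m := m + 1) ia.castSucc ir.castSucc (fun a => (σ a).castSucc)
      (Fin.snoc (fun k => (ρ k).castSucc) (Fin.last m))).congr fun w => ?_)
    have : (Fin.snoc (α := fun _ => ZFSet.{u}) (fun k => Fin.init w (ρ k)) (w (Fin.last m)) :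
        Fin (n + 1) → ZFSet.{u}) = fun k =>
          w (Fin.snoc (α := fun _ => Fin (m + 1)) (fun k => (ρ k).castSucc) (Fin.last m) k) := by
      funext k
      refine Fin.lastCases ?_ (fun k => ?_) k
      · simp
      · simp [Fin.init]
    rw [this]
    rfl

end

end PSR

/-! ### From strength to product reflection -/

namespace PSR

open FirstOrder.Language

/-! ### Strong cardinals reflect products -/

theorem rank_lt_rank_pair_left (x y : ZFSet.{u}) : x.rank < (ZFSet.pair x y).rank :=
  (ZFSet.rank_lt_of_mem (by simp : x ∈ ({x} : ZFSet.{u}))).trans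
    (ZFSet.rank_lt_of_mem (by simp [ZFSet.pair]))

theorem rank_lt_rank_pair_right (x y : ZFSet.{u}) : y.rank < (ZFSet.pair x y).rank :=
  (ZFSet.rank_lt_of_mem (by simp : y ∈ ({x, y} : ZFSet.{u}))).trans
    (ZFSet.rank_lt_of_mem (by simp [ZFSet.pair]))

/-- One structure with code in `V_κ` suffices for `j` to fix the keys of all symbols of the type. -/
theorem RelStruct.rank_symbolKey_lt {τ : RelType.{u}} (A : RelStruct τ) (n : ℕ)
    (s : τ.symbols n) : (symbolKey n s).rank < A.code.rank :=
  calc (symbolKey n s).rank < (ZFSet.pair (symbolKey n s) (A.relSet n s)).rank :=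
        rank_lt_rank_pair_left _ _
    _ < A.relFamily.rank := ZFSet.rank_lt_of_mem ((A.pair_symbolKey_mem_relFamily s _).2 rfl)
    _ < A.code.rank := rank_lt_rank_pair_right _ _

theorem Delta0Def.forall_fin {Z : Set ZFSet.{u}} {n k : ℕ}
    {P : Fin k → (Fin n → ZFSet.{u}) → Prop} (h : ∀ l, Delta0Def Z (P l)) :
    Delta0Def Z (fun v => ∀ l, P l v) := by
  induction k with
  | zero => exact (Delta0Def.falsum.imp Delta0Def.falsum).congr fun v => by simp
  | succ k ih =>
    exact ((h 0).and (ih fun l => h l.succ)).congr fun v => Fin.forall_fin_succ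

section

variable {τ : RelType.{u}}

/-- The structures of type `τ` with code in `K`. -/
def structuresIn (τ : RelType.{u}) (K : ZFSet.{u}) : Set (RelStruct τ) := {A | A.code ∈ K}

instance small_structuresIn (K : ZFSet.{u}) : Small.{u} (structuresIn τ K) :=
  small_of_injective (β := K) (f := fun A => ⟨(A : RelStruct τ).code, A.2⟩) fun _ _ h =>
    Subtype.ext (RelStruct.code_injective (congrArg Subtype.val h))

/-- An element of a product, as a set of ordered pairs. -/
noncomputable def productGraph {K : ZFSet.{u}} (f : Product (structuresIn τ K)) : ZFSet.{u} :=
  ZFSet.range (fun A : structuresIn τ K =>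
    ZFSet.pair (A : RelStruct τ).code (f A : ZFSet.{u}))

theorem pair_mem_productGraph {K : ZFSet.{u}} (f : Product (structuresIn τ K))
    (A : structuresIn τ K) (y : ZFSet.{u}) :
    ZFSet.pair (A : RelStruct τ).code y ∈ productGraph f ↔ y = f A := by
  rw [productGraph, ZFSet.mem_range]
  constructor
  · rintro ⟨B, hB⟩
    obtain ⟨h₁, rfl⟩ := ZFSet.pair_inj.1 hB
    rw [Subtype.ext (RelStruct.code_injective h₁)]
  · rintro rfl
    exact ⟨A, rfl⟩

section

variable {M : Set ZFSet.{u}} {j : ZFSet.{u} ↪ₑ[LSet] M} {K : ZFSet.{u}}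

/-- That the graph of `f` is defined on all of `K`, with values in the universes, is a `Δ₀`
statement, so it holds of the images under `j`. -/
theorem exists_pair_mem_map_productGraph (hM : ∀ x ∈ M, ∀ y ∈ x, y ∈ M)
    (hKτ : ∀ c ∈ K, ∃ A : RelStruct τ, A.code = c) (f : Product (structuresIn τ K))
    (A : structuresIn τ (j K : ZFSet.{u})) :
    ∃ y : (A : RelStruct τ).carrier,
      ZFSet.pair (A : RelStruct τ).code y ∈ (j (productGraph f) : ZFSet.{u}) := by
  have hD : Delta0Def ∅ (fun v : Fin 2 → ZFSet.{u} => ∀ c ∈ v 0, ∃ a r, c = ZFSet.pair a r ∧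
      ∃ y ∈ a, ZFSet.pair c y ∈ v 1) :=
    .ball _ (.exists_pair _ (.bex _ (.pair_mem _ _ _)))
  obtain ⟨a, r, h, y, hy, hp⟩ := (hD.map_iff hM j (by simp) ![K, productGraph f]).2 (by
    intro c hc
    obtain ⟨A, rfl⟩ := hKτ c hc
    exact ⟨_, _, rfl, f ⟨A, hc⟩, (f ⟨A, hc⟩).2, (pair_mem_productGraph f ⟨A, hc⟩ _).2 rfl⟩) _ A.2
  refine ⟨⟨y, ?_⟩, hp⟩
  rw [RelStruct.code_eq, ZFSet.pair_inj] at h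
  rwa [h.1]

/-- The map of products that an elementary embedding of the universe induces. -/
noncomputable def productMap (hM : ∀ x ∈ M, ∀ y ∈ x, y ∈ M)
    (hKτ : ∀ c ∈ K, ∃ A : RelStruct τ, A.code = c) (f : Product (structuresIn τ K)) :
    Product (structuresIn τ (j K : ZFSet.{u})) :=
  fun A => (exists_pair_mem_map_productGraph hM hKτ f A).choose

theorem pair_mem_map_productGraph_iff (hM : ∀ x ∈ M, ∀ y ∈ x, y ∈ M)
    (hKτ : ∀ c ∈ K, ∃ A : RelStruct τ, A.code = c) (f : Product (structuresIn τ K))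
    (A : structuresIn τ (j K : ZFSet.{u})) (y : ZFSet.{u}) :
    ZFSet.pair (A : RelStruct τ).code y ∈ (j (productGraph f) : ZFSet.{u}) ↔
      y = productMap (j := j) hM hKτ f A := by
  have hmem : ZFSet.pair (A : RelStruct τ).code (productMap (j := j) hM hKτ f A) ∈
      (j (productGraph f) : ZFSet.{u}) :=
    (exists_pair_mem_map_productGraph hM hKτ f A).choose_spec
  refine ⟨fun h => ?_, fun h => h ▸ hmem⟩
  have hD : Delta0Def ∅ (fun v : Fin 1 → ZFSet.{u} => ∀ p ∈ v 0, ∀ p' ∈ v 0,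
      ∃ c y, p = ZFSet.pair c y ∧ ∃ c' y', p' = ZFSet.pair c' y' ∧ (c = c' → y = y')) :=
    .ball _ (.ball _ (.exists_pair _ (.exists_pair _ (.imp (.eq _ _) (.eq _ _)))))
  obtain ⟨c, z, h₁, c', z', h₂, h₃⟩ := (hD.map_iff hM j (by simp) ![productGraph f]).2 (by
    intro p hp p' hp'
    obtain ⟨A, rfl⟩ := ZFSet.mem_range.1 hp
    obtain ⟨A', rfl⟩ := ZFSet.mem_range.1 hp'
    refine ⟨_, _, rfl, _, _, rfl, fun h => ?_⟩
    rw [Subtype.ext (RelStruct.code_injective h)]) _ h _ hmem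
  obtain ⟨rfl, rfl⟩ := ZFSet.pair_inj.1 h₁
  obtain ⟨rfl, rfl⟩ := ZFSet.pair_inj.1 h₂
  exact h₃ rfl

/-- The chain condition is `Δ₀` in `K` and the graph of `f`: the values to be compared are found in
the universes. -/
theorem productMap_chainPreserving (hM : ∀ x ∈ M, ∀ y ∈ x, y ∈ M)
    (hKτ : ∀ c ∈ K, ∃ A : RelStruct τ, A.code = c) :
    ChainPreserving (productMap (j := j) hM hKτ) := by
  intro f hf A B hAB
  have hD : Delta0Def ∅ (fun v : Fin 2 → ZFSet.{u} => ∀ c ∈ v 0, ∀ c' ∈ v 0,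
      ∃ a r, c = ZFSet.pair a r ∧ ∃ a' r', c' = ZFSet.pair a' r' ∧ (a ⊆ a' →
        ∃ y ∈ a, ∃ y' ∈ a', ZFSet.pair c y ∈ v 1 ∧ ZFSet.pair c' y' ∈ v 1 ∧ y ⊆ y')) :=
    .ball _ (.ball _ (.exists_pair _ (.exists_pair _ (.imp (.subset _ _) (.bex _ (.bex _
      (.and (.pair_mem _ _ _) (.and (.pair_mem _ _ _) (.subset _ _)))))))))
  obtain ⟨a, r, h₁, a', r', h₂, h₃⟩ := (hD.map_iff hM j (by simp) ![K, productGraph f]).2 (by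
    intro c hc c' hc'
    obtain ⟨A, rfl⟩ := hKτ c hc
    obtain ⟨B, rfl⟩ := hKτ c' hc'
    refine ⟨_, _, rfl, _, _, rfl, fun h => ?_⟩
    exact ⟨_, (f ⟨A, hc⟩).2, _, (f ⟨B, hc'⟩).2, (pair_mem_productGraph f ⟨A, hc⟩ _).2 rfl,
      (pair_mem_productGraph f ⟨B, hc'⟩ _).2 rfl, hf ⟨A, hc⟩ ⟨B, hc'⟩ h⟩) _ A.2 _ B.2
  rw [RelStruct.code_eq, ZFSet.pair_inj] at h₁ h₂
  rw [← h₁.1, ← h₂.1] at h₃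
  obtain ⟨y, -, y', -, hy, hy', hyy'⟩ := h₃ hAB
  rw [← (pair_mem_map_productGraph_iff hM hKτ f A y).1 hy,
    ← (pair_mem_map_productGraph_iff hM hKτ f B y').1 hy']
  exact hyy'

variable {κ : Ordinal.{u}}

theorem mem_structuresIn_map (hM : ∀ x ∈ M, ∀ y ∈ x, y ∈ M)
    (hj : ∀ x : ZFSet.{u}, x.rank < κ → (j x : ZFSet.{u}) = x)
    (hKκ : ∀ c ∈ K, c.rank < κ) {A : RelStruct τ} (hA : A ∈ structuresIn τ K) :
    A ∈ structuresIn τ (j K : ZFSet.{u}) := by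
  have := (map_mem_map_iff hM j A.code K).2 hA
  rwa [hj _ (hKκ _ hA)] at this

/-- Both the code of `A` and the value `f(A)` have rank below `κ`, so `j` fixes their pair. -/
theorem productMap_apply (hM : ∀ x ∈ M, ∀ y ∈ x, y ∈ M)
    (hj : ∀ x : ZFSet.{u}, x.rank < κ → (j x : ZFSet.{u}) = x)
    (hKκ : ∀ c ∈ K, c.rank < κ) (hKτ : ∀ c ∈ K, ∃ A : RelStruct τ, A.code = c)
    (f : Product (structuresIn τ K)) (A : RelStruct τ) (hA : A ∈ structuresIn τ K)
    (hA' : A ∈ structuresIn τ (j K : ZFSet.{u})) :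
    productMap (j := j) hM hKτ f ⟨A, hA'⟩ = f ⟨A, hA⟩ := by
  have h₁ := (map_mem_map_iff hM j _ _).2 ((pair_mem_productGraph f ⟨A, hA⟩ _).2 rfl)
  have h₂ : (f ⟨A, hA⟩ : ZFSet.{u}).rank < κ :=
    ((ZFSet.rank_lt_of_mem (f ⟨A, hA⟩).2).trans (rank_lt_rank_pair_left _ A.relFamily)).trans
      (hKκ _ hA)
  rw [map_pair hM, hj _ (hKκ _ hA), hj _ h₂] at h₁
  exact Subtype.ext ((pair_mem_map_productGraph_iff hM hKτ f ⟨A, hA'⟩ _).1 h₁).symm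

/-- This is the count that Feferman–Vaught asks for. Inclusion maps the factors counted on the left
injectively into those on the right; only a finite count could grow, and the next step excludes
that. -/
theorem min_encard_realize_productMap (hM : ∀ x ∈ M, ∀ y ∈ x, y ∈ M)
    (hj : ∀ x : ZFSet.{u}, x.rank < κ → (j x : ZFSet.{u}) = x)
    (hKκ : ∀ c ∈ K, c.rank < κ) (hKτ : ∀ c ∈ K, ∃ A : RelStruct τ, A.code = c)
    {k : ℕ} (ψ : τ.lang.BoundedFormula (Fin k) 0) (f : Fin k → Product (structuresIn τ K))
    (N : ℕ∞) :
    min N {A : structuresIn τ K | ψ.Realize (fun i => f i A) default}.encard =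
      min N {A : structuresIn τ (j K : ZFSet.{u}) |
        ψ.Realize (fun i => productMap (j := j) hM hKτ (f i) A) default}.encard := by
  set X := {A : structuresIn τ K | ψ.Realize (fun i => f i A) default} with hX
  set Y := {A : structuresIn τ (j K : ZFSet.{u}) |
        ψ.Realize (fun i => productMap (j := j) hM hKτ (f i) A) default} with hY
  let inc : structuresIn τ K → structuresIn τ (j K : ZFSet.{u}) := fun A =>
    ⟨A, mem_structuresIn_map hM hj hKκ A.2⟩
  have hinc : Function.Injective inc := fun A B h => Subtype.ext (congrArg
    (fun B : structuresIn τ (j K : ZFSet.{u}) => (B : RelStruct τ)) h)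
  have hsub : inc '' X ⊆ Y := by
    rintro _ ⟨A, hA, rfl⟩
    have : (fun i => productMap (j := j) hM hKτ (f i) (inc A)) = fun i => f i A := funext fun i =>
      productMap_apply hM hj hKκ hKτ (f i) A A.2 _
    change ψ.Realize (fun i => productMap (j := j) hM hKτ (f i) (inc A)) default
    rw [this]
    exact hA
  rcases X.finite_or_infinite with hfin | hinf
  -- The finitely many codes in question are fixed by `j` and may serve as parameters. That no other
  -- code in `K` satisfies `ψ` is then a `Δ₀` statement, which passes to `j(K)`.
  · suffices Y ⊆ inc '' X by
      rw [← Set.Subset.antisymm hsub this, hinc.encard_image]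
    intro B hB
    -- A structure in `K` is needed to bound the keys of the symbols. If `K` were empty, `j(K)`
    -- would be empty too, contrary to the presence of `B`.
    have hKne : K.Nonempty := by
      rcases ZFSet.eq_empty_or_nonempty K with h | h
      · exfalso
        have hD : Delta0Def ∅ (fun v : Fin 1 → ZFSet.{u} => v 0 = ∅) := .eq_empty _
        have := (hD.map_iff hM j (by simp) ![K]).2 h
        have hB' := B.2
        change (B : RelStruct τ).code ∈ (j K : ZFSet.{u}) at hB'
        change (j K : ZFSet.{u}) = ∅ at this
        exact ZFSet.notMem_empty _ (this.subset hB')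
      · exact h
    obtain ⟨c₀, hc₀⟩ := hKne
    obtain ⟨A₀, hA₀⟩ := hKτ c₀ hc₀
    have hkey : ∀ (n : ℕ) (s : τ.symbols n), symbolKey n s ∈ {z : ZFSet.{u} | z.rank < κ} :=
      fun n s => (A₀.rank_symbolKey_lt n s).trans (hA₀ ▸ hKκ c₀ hc₀)
    have hs : ((fun A : structuresIn τ K => (A : RelStruct τ).code) '' X).Finite := hfin.image _
    have hD : Delta0Def {z | z.rank < κ} (fun v : Fin (k + 1) → ZFSet.{u} => ∀ c ∈ v 0,
        (∃ a r, c = ZFSet.pair a r ∧ ∃ y : Fin k → ZFSet.{u}, (∀ l, y l ∈ a) ∧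
          ((∀ l, ZFSet.pair c (y l) ∈ v l.succ) ∧ CodeSat a r ψ y default)) →
        c ∈ (fun A : structuresIn τ K => (A : RelStruct τ).code) '' X) := by
      refine .ball _ (.imp (.exists_pair _ (.exists_fin _ k (.and
        (.forall_fin fun l => .pair_mem _ _ _) ?_))) (.mem_finite hs ?_ _))
      · refine (delta0Def_codeSat hkey ψ (Fin.castAdd k (Fin.last _).castSucc)
          (Fin.castAdd k (Fin.last _)) (fun l => Fin.natAdd _ l) Fin.elim0).congr fun w => ?_
        rw [Subsingleton.elim (default : Fin 0 → ZFSet.{u}) (fun k => w (Fin.elim0 k))]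
      · rintro _ ⟨A, -, rfl⟩
        exact hKκ _ A.2
    have h := (hD.map_iff hM j hj (Fin.cons K fun i => productGraph (f i))).2 (by
      rintro c hc ⟨a, r, h₁, y, hy, hyf, hsat⟩
      simp only [Fin.cons_zero] at hc
      obtain ⟨A, rfl⟩ := hKτ c hc
      obtain ⟨rfl, rfl⟩ := ZFSet.pair_inj.1 h₁
      refine ⟨⟨A, hc⟩, ?_, rfl⟩
      simp only [Fin.cons_succ] at hyf
      have : y = fun i => (f i ⟨A, hc⟩ : ZFSet.{u}) := funext fun i =>
        (pair_mem_productGraph (f i) ⟨A, hc⟩ _).1 (hyf i)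
      refine (RelStruct.realize_iff_codeSat A ψ _ _).2 ?_
      rw [this] at hsat
      exact (iff_of_eq (congrArg (CodeSat _ _ ψ _) (Subsingleton.elim _ _))).1 hsat)
      (B : RelStruct τ).code B.2
      ⟨_, _, rfl, fun i => productMap (j := j) hM hKτ (f i) B, fun l => Subtype.coe_prop _, by
        intro l
        simp only [Fin.cons_succ]
        exact (pair_mem_map_productGraph_iff hM hKτ (f l) B _).2 rfl, by
        have := (RelStruct.realize_iff_codeSat (B : RelStruct τ) ψ _ _).1 hB
        exact (iff_of_eq (congrArg (CodeSat _ _ ψ _) (Subsingleton.elim _ _))).1 this⟩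
    obtain ⟨A, hA, hAB⟩ := h
    exact ⟨A, hA, Subtype.ext (RelStruct.code_injective hAB)⟩
  · have h₁ := hinf.encard_eq
    have h₂ : Y.encard = ⊤ :=
      ((hinf.image hinc.injOn).mono hsub).encard_eq
    rw [h₁, h₂]

theorem realize_productMap_iff (hM : ∀ x ∈ M, ∀ y ∈ x, y ∈ M)
    (hj : ∀ x : ZFSet.{u}, x.rank < κ → (j x : ZFSet.{u}) = x)
    (hKκ : ∀ c ∈ K, c.rank < κ) (hKτ : ∀ c ∈ K, ∃ A : RelStruct τ, A.code = c)
    {k : ℕ} (φ : τ.lang.Formula (Fin k)) (f : Fin k → Product (structuresIn τ K)) :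
    φ.Realize (productMap (j := j) hM hKτ ∘ f) ↔ φ.Realize f := by
  obtain ⟨ι, _, Θ, N, hΘ⟩ := exists_realize_iff_of_similarColouring φ
  refine (hΘ _ _ _ default _ default fun t => ?_).symm
  obtain ⟨ψ, hψ⟩ := exists_realize_iff_setOf_eq Θ t
  have h := min_encard_realize_productMap (j := j) hM hj hKκ hKτ ψ f N
  have h₁ : coordType Θ f default ⁻¹' {t} =
      {A : structuresIn τ K | ψ.Realize (fun i => f i A) default} := by
    ext A
    rw [Set.mem_ofPred_eq, hψ]
    refine iff_of_eq (congrArg (fun w => {i | (Θ i).Realize (fun i => f i A) w} = t) ?_)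
    exact Subsingleton.elim _ _
  have h₂ : coordType Θ (productMap (j := j) hM hKτ ∘ f) default ⁻¹' {t} =
      {A : structuresIn τ (j K : ZFSet.{u}) |
        ψ.Realize (fun i => productMap (j := j) hM hKτ (f i) A) default} := by
    ext A
    rw [Set.mem_ofPred_eq, hψ]
    refine iff_of_eq (congrArg (fun w => {i | (Θ i).Realize
      (fun i => productMap (j := j) hM hKτ (f i) A) w} = t) ?_)
    exact Subsingleton.elim _ _
  rw [h₁, h₂]
  exact h

end

end

/-- Strong cardinals witness `Π₁` product reflection. -/
theorem IsStrong.witnessesPi1PSR {κ : Cardinal.{u}} (hκ : IsStrong κ) : WitnessesPi1PSR κ := by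
  intro φ τ hφ hproper hτ β hβ
  set C := definedClass.{u} φ with hC
  obtain ⟨c₁, hc₁⟩ : ∃ c, c ∈ C := by
    by_contra! h
    exact hproper ⟨∅, fun x hx => (h x hx).elim⟩
  -- A cardinal above `κ`, `ℵ₀` and the cardinalities of `β` and `c₁.rank`, so that `l.ord` is a
  -- limit above both ordinals.
  set l : Cardinal.{u} := Order.succ (max (max κ Cardinal.aleph0) (max β.card c₁.rank.card)) with hl
  have hκl : κ < l := ((le_max_left _ _).trans (le_max_left _ _)).trans_lt (Order.lt_succ _)
  have hωl : Cardinal.aleph0 ≤ l :=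
    (((le_max_right _ _).trans (le_max_left _ _)).trans_lt (Order.lt_succ _)).le
  have hβl : β < l.ord := Cardinal.lt_ord.2
    (((le_max_left _ _).trans (le_max_right _ _)).trans_lt (Order.lt_succ _))
  have hcl : c₁.rank < l.ord := Cardinal.lt_ord.2
    (((le_max_right _ _).trans (le_max_right _ _)).trans_lt (Order.lt_succ _))
  have hlim : Order.IsSuccLimit l.ord := Cardinal.isSuccLimit_ord hωl
  obtain ⟨M, j, hM, hfix, -, hlκ, hlM⟩ := hκ l hκl
  have hj : ∀ x : ZFSet.{u}, x.rank < κ.ord → (j x : ZFSet.{u}) = x :=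
    fun x hx => map_eq_self hM j hfix x hx
  have hsub := vonNeumann_subset_map hM j hlim hlκ hlM
  set K : ZFSet.{u} := ZFSet.sep (· ∈ C) (V_ κ.ord) with hK
  have hKmem : ∀ c ∈ C, c.rank < l.ord → c ∈ (j K : ZFSet.{u}) := by
    intro c hc hcr
    -- Every member of the class in `V_κ` lies in `K`. Full elementarity transfers this to `M`,
    -- where downward absoluteness of `φ` provides the premise for `c`.
    let χ : LSet.BoundedFormula (Fin 2) 1 := (memAtom (Sum.inr 0) (Sum.inl 0)).imp
      ((BoundedFormula.relabel (n := 1) (fun _ : Unit => Sum.inr 0) φ).imp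
        (memAtom (Sum.inr 0) (Sum.inl 1)))
    have hχ : χ.all.Realize ![V_ κ.ord, K] default := by
      rw [BoundedFormula.realize_all]
      intro x
      rw [BoundedFormula.realize_imp, BoundedFormula.realize_imp]
      intro h₁ h₂
      rw [BoundedFormula.realize_relabel] at h₂
      rw [realize_memAtom] at h₁ ⊢
      refine ZFSet.mem_sep.2 ⟨h₁, ?_⟩
      change BoundedFormula.Realize φ _ _
      exact (iff_of_eq (congrArg (BoundedFormula.Realize φ _) (Subsingleton.elim _ _))).1 h₂
    have hχ' := (j.map_formula χ.all _).2 hχ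
    have hcM : c ∈ M := hlM c (ZFSet.mem_vonNeumann.2 hcr)
    have h₃ := BoundedFormula.realize_all.1 hχ' ⟨c, hcM⟩
    rw [BoundedFormula.realize_imp, BoundedFormula.realize_imp] at h₃
    refine h₃ ?_ ?_
    · exact hsub (ZFSet.mem_vonNeumann.2 hcr)
    · rw [BoundedFormula.realize_relabel]
      apply hφ.realize_class hM
      change BoundedFormula.Realize φ _ _ at hc
      exact (iff_of_eq (congrArg (BoundedFormula.Realize φ _) (Subsingleton.elim _ _))).1 hc
  have hKκ : ∀ c ∈ K, c.rank < κ.ord := fun c hc =>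
    ZFSet.mem_vonNeumann.1 (ZFSet.mem_sep.1 hc).1
  have hKτ : ∀ c ∈ K, ∃ A : RelStruct τ, A.code = c := fun c hc => hτ c (ZFSet.mem_sep.1 hc).2
  have hbelow : below τ C κ.ord = structuresIn τ K := by
    ext A
    exact and_comm.trans ZFSet.mem_sep.symm
  rw [hbelow]
  refine ⟨structuresIn τ (j K : ZFSet.{u}), inferInstance, ?_,
    ⟨productMap (j := j) hM hKτ, fun n φ x => realize_productMap_iff hM hj hKκ hKτ φ x⟩, ?_,
    productMap_chainPreserving hM hKτ⟩
  · rintro A ⟨hA, hAβ⟩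
    exact hKmem _ hA ((ZFSet.mem_vonNeumann.1 hAβ).trans hβl)
  · intro f A hA
    exact ⟨mem_structuresIn_map hM hj hKκ hA, productMap_apply hM hj hKκ hKτ f A hA _⟩

end PSR

/-! ### Extenders with infinite seeds and their ultrapowers -/

namespace PSR

open FirstOrder.Language

/-! ### Systems of ultrafilters indexed by sequences of sets -/

/-- The sequence `y, x 0, x 1, …`. -/
def seqCons (y : ZFSet.{u}) (x : ℕ → ZFSet.{u}) : ℕ → ZFSet.{u}
  | 0 => y
  | n + 1 => x n

/-- Sequences of sets of rank below `l`. -/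
def Seed (l : Ordinal.{u}) : Type (u + 1) :=
  {c : ℕ → ZFSet.{u} // ∀ n, (c n).rank < l}

namespace Seed

variable {l : Ordinal.{u}}

instance : CoeFun (Seed l) (fun _ => ℕ → ZFSet.{u}) := ⟨Subtype.val⟩

@[ext] theorem ext {c d : Seed l} (h : ∀ n, c n = d n) : c = d := Subtype.ext (funext h)

/-- Reindexing of a sequence. -/
def comp (c : Seed l) (σ : ℕ → ℕ) : Seed l := ⟨fun n => c (σ n), fun n => c.2 (σ n)⟩

@[simp] theorem comp_apply (c : Seed l) (σ : ℕ → ℕ) (n : ℕ) : c.comp σ n = c (σ n) := rfl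

/-- The sequence `b, c 0, c 1, …`. -/
def cons (b : ZFSet.{u}) (hb : b.rank < l) (c : Seed l) : Seed l :=
  ⟨seqCons b c, fun n => by cases n <;> [exact hb; exact c.2 _]⟩

/-- A sequence of sequences as a sequence. -/
def join (c : ℕ → Seed l) : Seed l :=
  ⟨fun k => c k.unpair.1 k.unpair.2, fun _ => (c _).2 _⟩

theorem join_comp (c : ℕ → Seed l) (n : ℕ) : (join c).comp (Nat.pair n) = c n := by
  refine ext fun m => ?_
  change c (Nat.pair n m).unpair.1 (Nat.pair n m).unpair.2 = c n m
  rw [Nat.unpair_pair]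

/-- The sequence that is constantly `b`. -/
def const (b : ZFSet.{u}) (hb : b.rank < l) : Seed l := ⟨fun _ => b, fun _ => hb⟩

instance : Small.{u} (Seed l) :=
  small_of_injective (β := ℕ → V_ l)
    (f := fun c n => ⟨c n, ZFSet.mem_vonNeumann.2 (c.2 n)⟩) fun _ _ h =>
      Subtype.ext (funext fun n => congrArg Subtype.val (congrFun h n))

end Seed

/-- A coherent system of ultrafilters on the sequences of sets of rank below `κ`, indexed by the
sequences of sets of rank below `l`. -/
structure SeedSystem (κ l : Ordinal.{u}) where
  /-- the ultrafilter of a sequence -/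
  U : Seed l → Ultrafilter (ℕ → ZFSet.{u})
  comp : ∀ (c : Seed l) (σ : ℕ → ℕ) (P : (ℕ → ZFSet.{u}) → Prop),
    (∀ᶠ x : ℕ → ZFSet.{u} in U (c.comp σ), P x) ↔ ∀ᶠ x : ℕ → ZFSet.{u} in U c, P (fun n => x (σ n))
  -- A choice of an element of the first entry amounts to an actual element `b` of `c 0`; this is
  -- what identifies coordinate functions with the entries of seeds.
  bounded : ∀ (c : Seed l) (P : (ℕ → ZFSet.{u}) → Prop),
    (∀ᶠ x : ℕ → ZFSet.{u} in U c, ∃ y ∈ x 0, P (seqCons y x)) ↔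
      ∃ (b : ZFSet.{u}) (hb : b ∈ c 0),
        ∀ᶠ x : ℕ → ZFSet.{u} in U (c.cons b ((ZFSet.rank_lt_of_mem hb).trans (c.2 0))), P x
  principal : ∀ (c : Seed l) (o : Ordinal.{u}), o < κ → (∀ n, (c n).rank ≤ o) →
    ∀ P : (ℕ → ZFSet.{u}) → Prop, P c → ∀ᶠ x : ℕ → ZFSet.{u} in U c, P x
  rank_lt : ∀ c : Seed l, ∀ᶠ x : ℕ → ZFSet.{u} in U c, ∀ n, (x n).rank < κ

namespace SeedSystem

variable {κ l : Ordinal.{u}} (E : SeedSystem κ l)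

theorem eventually_eq_const (c : Seed l) {i : ℕ} (h : (c i).rank < κ) :
    ∀ᶠ x : ℕ → ZFSet.{u} in E.U c, x i = c i := by
  have := E.principal (c.comp fun _ => i) _ h (fun _ => le_rfl) (fun x => x 0 = c i) rfl
  exact (E.comp c _ _).1 this

theorem eventually_comp_succ (b : ZFSet.{u}) (hb : b.rank < l) (c : Seed l)
    {P : (ℕ → ZFSet.{u}) → Prop} :
    (∀ᶠ x : ℕ → ZFSet.{u} in E.U (c.cons b hb), P (fun n => x (n + 1))) ↔
      ∀ᶠ x : ℕ → ZFSet.{u} in E.U c, P x := by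
  have : (c.cons b hb).comp (fun n => n + 1) = c := by
    refine Seed.ext fun n => ?_
    rfl
  have h := E.comp (c.cons b hb) (fun n => n + 1) P
  rw [this] at h
  exact h.symm

/-- Put a copy of entry `i` in front, apply `bounded`, and remove the copy by the reindexing `0, 2,
3, …`. -/
theorem bounded_at (c : Seed l) (i : ℕ) (P : (ℕ → ZFSet.{u}) → Prop) :
    (∀ᶠ x : ℕ → ZFSet.{u} in E.U c, ∃ y ∈ x i, P (seqCons y x)) ↔
      ∃ (b : ZFSet.{u}) (hb : b ∈ c i),
        ∀ᶠ x : ℕ → ZFSet.{u} in E.U (c.cons b ((ZFSet.rank_lt_of_mem hb).trans (c.2 i))), P x := by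
  have h₁ : c.comp (fun n => Nat.casesOn n i id) = c.cons (c i) (c.2 i) := by
    refine Seed.ext fun n => ?_
    cases n <;> rfl
  have h₂ := E.bounded (c.cons (c i) (c.2 i))
    (fun v => P (fun n => v (Nat.casesOn n 0 (fun m => m + 2))))
  rw [← h₁, E.comp] at h₂
  have h₃ : ∀ (x : ℕ → ZFSet.{u}) (y : ZFSet.{u}),
      (fun n => seqCons y (fun n => x (Nat.casesOn n i id)) (Nat.casesOn n 0 (fun m => m + 2))) =
        seqCons y x := by
    intro x y
    funext n
    cases n <;> rfl
  simp only [h₃] at h₂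
  refine Iff.trans h₂ ?_
  refine exists_congr fun b => ?_
  have h₄ : ∀ hb : b.rank < l, (((c.comp (fun n => Nat.casesOn n i id)).cons b hb).comp
      (fun n => Nat.casesOn n 0 (fun m => m + 2))) = c.cons b hb := by
    intro hb
    refine Seed.ext fun n => ?_
    cases n <;> rfl
  constructor
  · rintro ⟨hb, h⟩
    refine ⟨hb, ?_⟩
    rw [← h₄, E.comp]
    exact h
  · rintro ⟨hb, h⟩
    refine ⟨hb, ?_⟩
    rw [← h₄, E.comp] at h
    exact h

theorem eventually_mem_cons (c : Seed l) {i : ℕ} {b : ZFSet.{u}} (hb : b ∈ c i) (hb' : b.rank < l) :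
    ∀ᶠ x : ℕ → ZFSet.{u} in E.U (c.cons b hb'), x 0 ∈ x (i + 1) := by
  by_contra h
  rw [← Ultrafilter.eventually_not] at h
  have := (E.bounded_at c i (fun x => x 0 ∉ x (i + 1))).2 ⟨b, hb, h⟩
  obtain ⟨x, y, hy, hy'⟩ := this.exists
  exact hy' hy

/-- The ultrafilters are countably complete. -/
theorem eventually_forall_nat (hω : Ordinal.omega0 < κ) (hκl : κ ≤ l) (c : Seed l)
    {P : ℕ → (ℕ → ZFSet.{u}) → Prop} (h : ∀ n, ∀ᶠ x : ℕ → ZFSet.{u} in E.U c, P n x) :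
    ∀ᶠ x : ℕ → ZFSet.{u} in E.U c, ∀ n, P n x := by
  by_contra hn
  rw [← Ultrafilter.eventually_not] at hn
  have hωr : (Ordinal.omega0.{u}).toZFSet.rank < κ := by rwa [Ordinal.rank_toZFSet]
  set d := c.cons (Ordinal.omega0.{u}).toZFSet (hωr.trans_le hκl) with hd
  have h₁ : ∀ᶠ x : ℕ → ZFSet.{u} in E.U d, x 0 = (Ordinal.omega0.{u}).toZFSet :=
    E.eventually_eq_const d hωr
  have h₂ := (E.eventually_comp_succ _ (hωr.trans_le hκl) c).2 hn
  -- The index of a failing condition is a choice of an element of `ω`. By `bounded` it is almost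
  -- everywhere a fixed `m`, against the hypothesis for `m`.
  have h₃ : ∀ᶠ x : ℕ → ZFSet.{u} in E.U d, ∃ y ∈ x 0, (fun v : ℕ → ZFSet.{u} => ∃ n : ℕ,
      v 0 = (n : Ordinal.{u}).toZFSet ∧ ¬ P n (fun n => v (n + 2))) (seqCons y x) := by
    filter_upwards [h₁, h₂] with x hx₁ hx₂
    push Not at hx₂
    obtain ⟨n, hn⟩ := hx₂
    refine ⟨(n : Ordinal.{u}).toZFSet, ?_, n, rfl, hn⟩
    rw [hx₁, Ordinal.toZFSet_mem_toZFSet_iff]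
    exact Ordinal.natCast_lt_omega0 n
  obtain ⟨b, hb, h₄⟩ := (E.bounded d (fun v : ℕ → ZFSet.{u} => ∃ n : ℕ,
      v 0 = (n : Ordinal.{u}).toZFSet ∧ ¬ P n (fun n => v (n + 2)))).1 h₃
  obtain ⟨a, ha, rfl⟩ := Ordinal.mem_toZFSet_iff.1
    (show b ∈ (Ordinal.omega0.{u}).toZFSet from hb)
  obtain ⟨m, rfl⟩ := Ordinal.lt_omega0.1 ha
  have hmr : ((m : Ordinal.{u}).toZFSet).rank < κ := by
    rw [Ordinal.rank_toZFSet]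
    exact ha.trans hω
  have h₅ := E.eventually_eq_const (d.cons (m : Ordinal.{u}).toZFSet (hmr.trans_le hκl))
    (i := 0) hmr
  have h₆ := (E.eventually_comp_succ _ (hmr.trans_le hκl) d).2
    ((E.eventually_comp_succ _ (hωr.trans_le hκl) c).2 (h m))
  obtain ⟨x, ⟨n, hx₁, hx₂⟩, hx₃, hx₄⟩ := (h₄.and (h₅.and h₆)).exists
  have : (n : Ordinal.{u}) = m := Ordinal.toZFSet_injective (hx₁.symm.trans hx₃)
  have : n = m := by exact_mod_cast this
  subst this
  exact hx₂ hx₄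

/-! ### The ultrapower -/

/-- A representative of an element of the ultrapower: a sequence and a function on sequences. -/
structure Point (l : Ordinal.{u}) : Type (u + 1) where
  seed : Seed l
  fn : (ℕ → ZFSet.{u}) → ZFSet.{u}

/-- The relation between representatives that a relation between sets induces. -/
def Rel (R : ZFSet.{u} → ZFSet.{u} → Prop) (p q : Point l) : Prop :=
  ∀ᶠ x : ℕ → ZFSet.{u} in E.U (Seed.join fun n => Nat.casesOn n p.seed fun _ => q.seed),
    R (p.fn fun n => x (Nat.pair 0 n)) (q.fn fun n => x (Nat.pair 1 n))

/-- By coherence, the relation can be computed over any seed from which both given ones arise by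
reindexing. -/
theorem rel_iff {R : ZFSet.{u} → ZFSet.{u} → Prop} {p q : Point l} (e : Seed l) {σ τ : ℕ → ℕ}
    (hp : p.seed = e.comp σ) (hq : q.seed = e.comp τ) :
    E.Rel R p q ↔ ∀ᶠ x : ℕ → ZFSet.{u} in E.U e,
      R (p.fn fun n => x (σ n)) (q.fn fun n => x (τ n)) := by
  have : (Seed.join fun n => Nat.casesOn n p.seed fun _ => q.seed) =
      e.comp (fun k => (Nat.casesOn k.unpair.1 σ fun _ => τ : ℕ → ℕ) k.unpair.2) := by
    ext k
    simp only [Seed.join, Seed.comp_apply]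
    cases k.unpair.1 <;> simp [hp, hq]
  rw [Rel, this, E.comp]
  simp

theorem exists_common_seed (p q r : Point l) : ∃ (e : Seed l) (σ τ ρ : ℕ → ℕ),
    p.seed = e.comp σ ∧ q.seed = e.comp τ ∧ r.seed = e.comp ρ :=
  let c : ℕ → Seed l := fun n => Nat.casesOn n p.seed fun m => Nat.casesOn m q.seed fun _ => r.seed
  ⟨Seed.join c, Nat.pair 0, Nat.pair 1, Nat.pair 2, (Seed.join_comp c 0).symm,
    (Seed.join_comp c 1).symm, (Seed.join_comp c 2).symm⟩

theorem rel_trans {R R' R'' : ZFSet.{u} → ZFSet.{u} → Prop} (hR : ∀ x y z, R x y → R' y z → R'' x z)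
    {p q r : Point l} (h : E.Rel R p q) (h' : E.Rel R' q r) : E.Rel R'' p r := by
  obtain ⟨e, σ, τ, ρ, hp, hq, hr⟩ := exists_common_seed p q r
  rw [E.rel_iff e hp hq] at h
  rw [E.rel_iff e hq hr] at h'
  rw [E.rel_iff e hp hr]
  filter_upwards [h, h'] with x hx hx'
  exact hR _ _ _ hx hx'

theorem rel_symm {R R' : ZFSet.{u} → ZFSet.{u} → Prop} (hR : ∀ x y, R x y → R' y x)
    {p q : Point l} (h : E.Rel R p q) : E.Rel R' q p := by
  obtain ⟨e, σ, τ, -, hp, hq, -⟩ := exists_common_seed p q q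
  rw [E.rel_iff e hp hq] at h
  rw [E.rel_iff e hq hp]
  exact h.mono fun x => hR _ _

theorem rel_comp (e : Seed l) (σ : ℕ → ℕ) (F : (ℕ → ZFSet.{u}) → ZFSet.{u}) :
    E.Rel (· = ·) ⟨e.comp σ, F⟩ ⟨e, fun x => F fun n => x (σ n)⟩ :=
  (E.rel_iff e (τ := id) rfl rfl).2 (Filter.Eventually.of_forall fun _ => rfl)

/-- All seeds of a descending chain are joined into one. Countable completeness then yields a single
sequence at which the values descend with respect to true membership. -/
theorem wellFounded_rel_mem (hω : Ordinal.omega0 < κ) (hκl : κ ≤ l) :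
    WellFounded (E.Rel (· ∈ ·)) := by
  rw [wellFounded_iff_isEmpty_descending_chain]
  refine ⟨fun ⟨p, hp⟩ => ?_⟩
  have h₁ : ∀ n, ∀ᶠ x : ℕ → ZFSet.{u} in E.U (Seed.join fun n => (p n).seed),
      (p (n + 1)).fn (fun m => x (Nat.pair (n + 1) m)) ∈ (p n).fn (fun m => x (Nat.pair n m)) :=
    fun n => (E.rel_iff (R := (· ∈ ·)) (Seed.join fun n => (p n).seed)
      (Seed.join_comp (fun n => (p n).seed) (n + 1)).symm
      (Seed.join_comp (fun n => (p n).seed) n).symm).1 (hp n)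
  obtain ⟨x, hx⟩ := (E.eventually_forall_nat hω hκl _ h₁).exists
  exact (wellFounded_iff_isEmpty_descending_chain.1 ZFSet.mem_wf).false
    ⟨fun n => (p n).fn (fun m => x (Nat.pair n m)), hx⟩

/-- The union of the values of a representative at sequences of sets of rank below `κ`. -/
noncomputable def valueUnion (κ : Ordinal.{u}) (p : Point l) : ZFSet.{u} :=
  ZFSet.iUnion fun x : ℕ → V_ κ => p.fn fun n => x n

/-- The representatives whose values at sequences of sets of rank below `κ` are empty or in
`valueUnion κ p`, and which are empty elsewhere. -/
def SmallPoint (κ : Ordinal.{u}) (p : Point l) : Type (u + 1) :=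
  Seed l × ((ℕ → V_ κ) → (insert ∅ (valueUnion κ p) : ZFSet.{u}))

instance (p : Point l) : Small.{u} (SmallPoint κ p) :=
  inferInstanceAs (Small.{u} (Seed l × ((ℕ → V_ κ) → (insert ∅ (valueUnion κ p) : ZFSet.{u}))))

open Classical in
/-- The representative that a member of `SmallPoint κ p` is. -/
noncomputable def SmallPoint.toPoint {p : Point l} (i : SmallPoint κ p) : Point l :=
  ⟨i.1, fun x => if h : ∀ n, x n ∈ V_ κ then i.2 fun n => ⟨x n, h n⟩ else ∅⟩

/-- The ultrapower is set-like: almost all sequences have entries of rank below `κ`, so a member of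
`p` matters only at sequences in `V_κ`, where its values may be taken from one fixed set. The
collapse can therefore be defined by recursion with sets as values. -/
theorem exists_smallPoint_rel {p q : Point l} (h : E.Rel (· ∈ ·) q p) :
    ∃ i : SmallPoint κ p, E.Rel (· = ·) i.toPoint q := by
  classical
  let i : SmallPoint κ p := ⟨q.seed, fun x => if h : q.fn (fun n => x n) ∈ valueUnion κ p then
    ⟨_, ZFSet.mem_insert_of_mem _ h⟩ else ⟨∅, ZFSet.mem_insert _ _⟩⟩
  refine ⟨i, ?_⟩
  obtain ⟨e, σ, τ, -, hq, hp, -⟩ := exists_common_seed q p p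
  rw [E.rel_iff e hq hp] at h
  rw [E.rel_iff e (p := i.toPoint) hq hq]
  filter_upwards [h, E.rank_lt e] with x hx hx'
  have h₁ : ∀ n, x n ∈ V_ κ := fun n => ZFSet.mem_vonNeumann.2 (hx' n)
  have h₂ : q.fn (fun n => x (σ n)) ∈ valueUnion κ p :=
    ZFSet.mem_iUnion.2 ⟨fun n => ⟨x (τ n), h₁ _⟩, hx⟩
  have h₃ : i.toPoint.fn (fun n => x (σ n)) = (i.2 fun n => ⟨x (σ n), h₁ (σ n)⟩).1 :=
    dif_pos fun n => h₁ (σ n)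
  exact h₃.trans (congrArg Subtype.val (dif_pos h₂))

section Collapse

variable (hwf : WellFounded (E.Rel (· ∈ ·)))

/-- The transitive collapse of the ultrapower. -/
noncomputable def collapse : Point l → ZFSet.{u} :=
  hwf.fix fun p ih => ZFSet.range
    fun i : {i : SmallPoint κ p // E.Rel (· ∈ ·) i.toPoint p} => ih i.1.toPoint i.2

theorem mem_collapse_iff_smallPoint (p : Point l) (y : ZFSet.{u}) :
    y ∈ E.collapse hwf p ↔
      ∃ i : SmallPoint κ p, E.Rel (· ∈ ·) i.toPoint p ∧ E.collapse hwf i.toPoint = y := by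
  rw [collapse, WellFounded.fix_eq, ZFSet.mem_range]
  simp only [Subtype.exists, exists_prop]

theorem collapse_eq_of_rel {p q : Point l} (h : E.Rel (· = ·) p q) :
    E.collapse hwf p = E.collapse hwf q := by
  induction p using hwf.induction generalizing q with
  | h p ih =>
    ext y
    rw [mem_collapse_iff_smallPoint, mem_collapse_iff_smallPoint]
    constructor
    · rintro ⟨i, hi, rfl⟩
      have h₁ : E.Rel (· ∈ ·) i.toPoint q := E.rel_trans (fun x y z hxy hyz => hyz ▸ hxy) hi h
      obtain ⟨i', hi'⟩ := E.exists_smallPoint_rel h₁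
      exact ⟨i', E.rel_trans (fun x y z hxy hyz => hxy ▸ hyz) hi' h₁,
        (ih _ hi (E.rel_symm (fun _ _ => Eq.symm) hi')).symm⟩
    · rintro ⟨i, hi, rfl⟩
      have h₁ : E.Rel (· ∈ ·) i.toPoint p :=
        E.rel_trans (fun x y z hxy hyz => hyz ▸ hxy) hi (E.rel_symm (fun _ _ => Eq.symm) h)
      obtain ⟨i', hi'⟩ := E.exists_smallPoint_rel h₁
      have h₂ := E.rel_trans (fun x y z hxy hyz => hxy ▸ hyz) hi' h₁
      exact ⟨i', h₂, ih _ h₂ hi'⟩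

theorem mem_collapse (p : Point l) (y : ZFSet.{u}) :
    y ∈ E.collapse hwf p ↔ ∃ q, E.Rel (· ∈ ·) q p ∧ E.collapse hwf q = y := by
  rw [mem_collapse_iff_smallPoint]
  constructor
  · rintro ⟨i, hi, h⟩
    exact ⟨_, hi, h⟩
  · rintro ⟨q, hq, rfl⟩
    obtain ⟨i, hi⟩ := E.exists_smallPoint_rel hq
    exact ⟨i, E.rel_trans (fun x y z hxy hyz => hxy ▸ hyz) hi hq, E.collapse_eq_of_rel hwf hi⟩

/-- Extensionality of the ultrapower. If `p` and `q` differ almost everywhere, the ultrafilter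
decides on which side there is a surplus element; a choice of surplus elements represents a member
of one of them only, which contradicts the induction hypothesis. -/
theorem rel_of_collapse_eq {p q : Point l} (h : E.collapse hwf p = E.collapse hwf q) :
    E.Rel (· = ·) p q := by
  induction p using hwf.induction generalizing q with
  | h p ih =>
    by_contra hn
    obtain ⟨e, σ, τ, -, hp, hq, -⟩ := exists_common_seed p q q
    rw [E.rel_iff e hp hq, ← Ultrafilter.eventually_not] at hn
    have hn' : ∀ᶠ x : ℕ → ZFSet.{u} in E.U e,
        (∃ z, z ∈ p.fn (fun n => x (σ n)) ∧ z ∉ q.fn (fun n => x (τ n))) ∨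
        (∃ z, z ∈ q.fn (fun n => x (τ n)) ∧ z ∉ p.fn (fun n => x (σ n))) := by
      refine hn.mono fun x hx => ?_
      by_contra! hx'
      exact hx (ZFSet.ext fun z => ⟨hx'.1 z, hx'.2 z⟩)
    classical
    rcases Ultrafilter.eventually_or.1 hn' with h₁ | h₁
    · let r : Point l := ⟨e, fun x => if h : ∃ z, z ∈ p.fn (fun n => x (σ n)) ∧
        z ∉ q.fn (fun n => x (τ n)) then h.choose else ∅⟩
      have hr : ∀ᶠ x : ℕ → ZFSet.{u} in E.U e, r.fn x ∈ p.fn (fun n => x (σ n)) ∧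
          r.fn x ∉ q.fn (fun n => x (τ n)) := by
        refine h₁.mono fun x hx => ?_
        simp only [r, dif_pos hx]
        exact hx.choose_spec
      have hrp : E.Rel (· ∈ ·) r p :=
        (E.rel_iff e (σ := id) rfl hp).2 (hr.mono fun x hx => hx.1)
      have h₂ : E.collapse hwf r ∈ E.collapse hwf q := h ▸ (E.mem_collapse hwf p _).2 ⟨r, hrp, rfl⟩
      obtain ⟨q', hq', h₃⟩ := (E.mem_collapse hwf q _).1 h₂
      have h₄ := ih r hrp h₃.symm
      have h₅ : E.Rel (· ∈ ·) r q := E.rel_trans (fun x y z hxy hyz => hxy ▸ hyz) h₄ hq'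
      rw [E.rel_iff e (σ := id) rfl hq] at h₅
      obtain ⟨x, hx, hx'⟩ := (hr.and h₅).exists
      exact hx.2 hx'
    · let r : Point l := ⟨e, fun x => if h : ∃ z, z ∈ q.fn (fun n => x (τ n)) ∧
        z ∉ p.fn (fun n => x (σ n)) then h.choose else ∅⟩
      have hr : ∀ᶠ x : ℕ → ZFSet.{u} in E.U e, r.fn x ∈ q.fn (fun n => x (τ n)) ∧
          r.fn x ∉ p.fn (fun n => x (σ n)) := by
        refine h₁.mono fun x hx => ?_
        simp only [r, dif_pos hx]
        exact hx.choose_spec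
      have hrq : E.Rel (· ∈ ·) r q :=
        (E.rel_iff e (σ := id) rfl hq).2 (hr.mono fun x hx => hx.1)
      have h₂ : E.collapse hwf r ∈ E.collapse hwf p := h ▸ (E.mem_collapse hwf q _).2 ⟨r, hrq, rfl⟩
      obtain ⟨p', hp', h₃⟩ := (E.mem_collapse hwf p _).1 h₂
      have h₄ := ih p' hp' h₃
      have h₅ : E.Rel (· ∈ ·) r p :=
        E.rel_trans (fun x y z hxy hyz => hxy ▸ hyz) (E.rel_symm (fun _ _ => Eq.symm) h₄) hp'
      rw [E.rel_iff e (σ := id) rfl hp] at h₅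
      obtain ⟨x, hx, hx'⟩ := (hr.and h₅).exists
      exact hx.2 hx'

theorem collapse_mem_collapse_iff (p q : Point l) :
    E.collapse hwf p ∈ E.collapse hwf q ↔ E.Rel (· ∈ ·) p q := by
  rw [mem_collapse]
  constructor
  · rintro ⟨r, hr, h⟩
    exact E.rel_trans (fun x y z hxy hyz => hxy ▸ hyz)
      (E.rel_of_collapse_eq hwf h.symm) hr
  · intro h
    exact ⟨p, h, rfl⟩

/-- The transitive class that the ultrapower is isomorphic to. -/
def model : Set ZFSet.{u} := Set.range (E.collapse hwf)

theorem model_transitive : ∀ x ∈ E.model hwf, ∀ y ∈ x, y ∈ E.model hwf := by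
  rintro _ ⟨p, rfl⟩ y hy
  obtain ⟨q, -, rfl⟩ := (E.mem_collapse hwf p y).1 hy
  exact ⟨q, rfl⟩

/-- The element of the model with the given representative. -/
noncomputable def toModel (p : Point l) : E.model hwf := ⟨E.collapse hwf p, p, rfl⟩

/-- **Łoś's theorem**. -/
theorem realize_iff_eventually {α : Type} {n : ℕ} (φ : LSet.BoundedFormula α n) (e : Seed l)
    (F : α → (ℕ → ZFSet.{u}) → ZFSet.{u}) (G : Fin n → (ℕ → ZFSet.{u}) → ZFSet.{u}) :
    φ.Realize (fun a => E.toModel hwf ⟨e, F a⟩) (fun k => E.toModel hwf ⟨e, G k⟩) ↔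
      ∀ᶠ x : ℕ → ZFSet.{u} in E.U e, φ.Realize (fun a => F a x) (fun k => G k x) := by
  have hval : ∀ {n : ℕ} (e : Seed l) (F : α → (ℕ → ZFSet.{u}) → ZFSet.{u})
      (G : Fin n → (ℕ → ZFSet.{u}) → ZFSet.{u}) (x : α ⊕ Fin n),
      Sum.elim (fun a => E.toModel hwf ⟨e, F a⟩) (fun k => E.toModel hwf ⟨e, G k⟩) x =
        E.toModel hwf ⟨e, Sum.elim F G x⟩ := by
    rintro n e F G (x | x) <;> rfl
  have hval' : ∀ {n : ℕ} (F : α → (ℕ → ZFSet.{u}) → ZFSet.{u})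
      (G : Fin n → (ℕ → ZFSet.{u}) → ZFSet.{u}) (x : α ⊕ Fin n) (w : ℕ → ZFSet.{u}),
      Sum.elim (fun a => F a w) (fun k => G k w) x = Sum.elim F G x w := by
    rintro n F G (x | x) w <;> rfl
  induction φ generalizing e F with
  | falsum => exact ⟨False.elim, fun h => h.exists.elim fun _ hx => hx⟩
  | equal t s =>
    obtain ⟨x, rfl⟩ := LSet_term_eq_var t
    obtain ⟨y, rfl⟩ := LSet_term_eq_var s
    simp only [BoundedFormula.Realize, Term.realize_var, hval, hval']
    exact Subtype.ext_iff.trans <| Iff.trans ⟨E.rel_of_collapse_eq hwf, E.collapse_eq_of_rel hwf⟩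
      (E.rel_iff (R := (· = ·)) (p := ⟨e, Sum.elim F G x⟩) (q := ⟨e, Sum.elim F G y⟩) e (σ := id)
        (τ := id) rfl rfl)
  | @rel n m R ts =>
    cases R
    have : ∀ i, ∃ x, ts i = Term.var x := fun i => LSet_term_eq_var _
    choose x hx using this
    obtain rfl : ts = fun i => Term.var (x i) := funext hx
    have h₁ : ∀ (p : α → ZFSet.{u}) (v : Fin n → ZFSet.{u}), (BoundedFormula.rel (L := LSet)
        MemSymbol.mem fun i => Term.var (x i)).Realize p v ↔
        Sum.elim p v (x 0) ∈ Sum.elim p v (x 1) := fun _ _ => Iff.rfl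
    have h₂ : ∀ (p : α → E.model hwf) (v : Fin n → E.model hwf), (BoundedFormula.rel (L := LSet)
        MemSymbol.mem fun i => Term.var (x i)).Realize p v ↔
        ((Sum.elim p v (x 0) : E.model hwf) : ZFSet.{u}) ∈
          ((Sum.elim p v (x 1) : E.model hwf) : ZFSet.{u}) := fun _ _ => Iff.rfl
    rw [h₂]
    simp only [h₁, hval, hval']
    exact (E.collapse_mem_collapse_iff hwf _ _).trans
      (E.rel_iff (R := (· ∈ ·)) (p := ⟨e, Sum.elim F G (x 0)⟩) (q := ⟨e, Sum.elim F G (x 1)⟩) e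
        (σ := id) (τ := id) rfl rfl)
  | imp φ ψ ih₁ ih₂ =>
    exact (imp_congr (ih₁ e F G) (ih₂ e F G)).trans Ultrafilter.eventually_imp.symm
  | @all n φ ih =>
    have hs : ∀ (e : Seed l) (G : Fin n → (ℕ → ZFSet.{u}) → ZFSet.{u})
        (H : (ℕ → ZFSet.{u}) → ZFSet.{u}),
        (Fin.snoc (α := fun _ => E.model hwf) (fun k => E.toModel hwf ⟨e, G k⟩)
          (E.toModel hwf ⟨e, H⟩) : Fin (n + 1) → E.model hwf) =
        fun k => E.toModel hwf ⟨e, (Fin.snoc (α := fun _ => (ℕ → ZFSet.{u}) → ZFSet.{u}) G H :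
          Fin (n + 1) → (ℕ → ZFSet.{u}) → ZFSet.{u}) k⟩ := by
      intro e G H
      funext k
      refine Fin.lastCases ?_ (fun k => ?_) k <;> simp
    have hs' : ∀ (G : Fin n → (ℕ → ZFSet.{u}) → ZFSet.{u}) (H : (ℕ → ZFSet.{u}) → ZFSet.{u})
        (x : ℕ → ZFSet.{u}), (fun k => (Fin.snoc (α := fun _ => (ℕ → ZFSet.{u}) → ZFSet.{u}) G H :
          Fin (n + 1) → (ℕ → ZFSet.{u}) → ZFSet.{u}) k x) =
        Fin.snoc (α := fun _ => ZFSet.{u}) (fun k => G k x) (H x) := by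
      intro G H x
      funext k
      refine Fin.lastCases ?_ (fun k => ?_) k <;> simp
    rw [BoundedFormula.realize_all]
    constructor
    · intro h
      by_contra hn
      rw [← Ultrafilter.eventually_not] at hn
      simp only [BoundedFormula.realize_all, not_forall] at hn
      classical
      let H : (ℕ → ZFSet.{u}) → ZFSet.{u} := fun x =>
        if h : ∃ y, ¬ φ.Realize (fun a => F a x) (Fin.snoc (fun k => G k x) y) then h.choose else ∅
      have hH : ∀ᶠ x : ℕ → ZFSet.{u} in E.U e,
          ¬ φ.Realize (fun a => F a x) (Fin.snoc (fun k => G k x) (H x)) := by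
        refine hn.mono fun x hx => ?_
        simp only [H, dif_pos hx]
        exact hx.choose_spec
      have h₁ := h (E.toModel hwf ⟨e, H⟩)
      rw [hs] at h₁
      obtain ⟨x, hx, hx'⟩ := (hH.and ((ih e F _).1 h₁)).exists
      rw [hs'] at hx'
      exact hx hx'
    -- An arbitrary element of the model comes with its own seed, so all representatives are moved
    -- to a common seed.
    · rintro h ⟨_, ⟨d, H⟩, rfl⟩
      obtain ⟨e', σ, τ, -, he, hd, -⟩ :=
        exists_common_seed (⟨e, fun _ => ∅⟩ : Point l) ⟨d, H⟩ ⟨d, H⟩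
      change e = e'.comp σ at he
      change d = e'.comp τ at hd
      subst he hd
      have h₁ : ∀ F : (ℕ → ZFSet.{u}) → ZFSet.{u}, ∀ σ : ℕ → ℕ,
          E.toModel hwf ⟨e'.comp σ, F⟩ = E.toModel hwf ⟨e', fun x => F fun n => x (σ n)⟩ :=
        fun F σ => Subtype.ext (E.collapse_eq_of_rel hwf (E.rel_comp e' σ F))
      have h₂ : (⟨E.collapse hwf ⟨e'.comp τ, H⟩, ⟨_, rfl⟩⟩ : E.model hwf) =
          E.toModel hwf ⟨e', fun x => H fun n => x (τ n)⟩ := h₁ H τ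
      simp only [h₁, h₂]
      rw [hs]
      rw [E.comp] at h
      refine (ih e' _ _).2 (h.mono fun x hx => ?_)
      rw [hs']
      exact BoundedFormula.realize_all.1 hx _

/-- The embedding of the universe into the ultrapower. -/
noncomputable def embedding (c : Seed l) : ZFSet.{u} ↪ₑ[LSet] E.model hwf where
  toFun x := E.toModel hwf ⟨c, fun _ => x⟩
  map_formula' n φ x := by
    have h := E.realize_iff_eventually hwf φ c (fun a _ => x a) Fin.elim0
    have h₂ : ∀ w : ℕ → ZFSet.{u}, (fun k => (Fin.elim0 k : (ℕ → ZFSet.{u}) → ZFSet.{u}) w) =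
      Fin.elim0 := fun _ => Subsingleton.elim _ _
    simp only [h₂, Filter.eventually_const] at h
    unfold Formula.Realize
    convert h using 2
    rfl

/-- By `bounded_at`, a member of the `i`-th coordinate function is again a coordinate function, at
the seed prolonged by some `b ∈ c i`. Conversely each `y ∈ c i` arises in this way, and induction on
membership identifies the values. -/
theorem collapse_eval (c : Seed l) (i : ℕ) : E.collapse hwf ⟨c, fun x => x i⟩ = c i := by
  generalize ha : c i = a
  induction a using ZFSet.inductionOn generalizing c i with
  | h a ih =>
    subst ha
    ext y
    rw [mem_collapse]
    constructor
    · rintro ⟨q, hq, rfl⟩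
      obtain ⟨e, σ, τ, -, hq', hc, -⟩ := exists_common_seed q ⟨c, fun x => x i⟩ q
      change c = e.comp τ at hc
      subst hc
      rw [E.rel_iff e hq' rfl] at hq
      have h₁ : ∀ᶠ x : ℕ → ZFSet.{u} in E.U e, ∃ y ∈ x (τ i), (fun v : ℕ → ZFSet.{u} =>
          q.fn (fun n => v (σ n + 1)) = v 0) (seqCons y x) :=
        hq.mono fun x hx => ⟨_, hx, rfl⟩
      obtain ⟨b, hb, h₂⟩ := (E.bounded_at e (τ i) (fun v : ℕ → ZFSet.{u} =>
          q.fn (fun n => v (σ n + 1)) = v 0)).1 h₁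
      have h₃ : E.Rel (· = ·) q ⟨e.cons b ((ZFSet.rank_lt_of_mem hb).trans (e.2 _)),
          fun x => x 0⟩ := by
        refine (E.rel_iff (e.cons b ((ZFSet.rank_lt_of_mem hb).trans (e.2 _)))
          (σ := fun n => σ n + 1) (τ := id) ?_ rfl).2 h₂
        rw [hq']
        rfl
      rw [E.collapse_eq_of_rel hwf h₃, ih b hb _ 0 rfl]
      exact hb
    · intro hy
      have hy' : y.rank < l := (ZFSet.rank_lt_of_mem hy).trans (c.2 i)
      refine ⟨⟨c.cons y hy', fun x => x 0⟩, ?_, ih y hy _ 0 rfl⟩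
      exact (E.rel_iff (c.cons y hy') (σ := id) (τ := fun n => n + 1) rfl rfl).2
        (E.eventually_mem_cons c hy hy')

end Collapse

end SeedSystem

theorem delta0Def_isOrdinal {Z : Set ZFSet.{u}} {n : ℕ} (i : Fin n) :
    Delta0Def Z (fun v => (v i).IsOrdinal) := by
  refine Delta0Def.congr (P := fun v => (∀ x ∈ v i, ∀ y ∈ x, y ∈ v i) ∧
    ∀ x ∈ v i, ∀ y ∈ x, ∀ z ∈ y, z ∈ x) (.and (.ball _ (.ball _ (.mem _ _)))
      (.ball _ (.ball _ (.ball _ (.mem _ _))))) fun v => ?_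
  rw [ZFSet.isOrdinal_iff_forall_mem_isTransitive]
  exact Iff.rfl

/-- The ultrapower by a system of ultrafilters witnesses strength. -/
theorem SeedSystem.isStrongUpTo {κ lam : Cardinal.{u}} {l : Ordinal.{u}} (E : SeedSystem κ.ord l)
    (hω : Ordinal.omega0 < κ.ord) (hκ : κ < lam) (hl : lam.ord < l) : IsStrongUpTo κ lam := by
  have hκl : κ.ord ≤ l := ((Cardinal.ord_lt_ord.2 hκ).trans hl).le
  have hwf := E.wellFounded_rel_mem hω hκl
  have hlam : (lam.ord.toZFSet).rank < l := by rwa [Ordinal.rank_toZFSet]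
  set c : Seed l := Seed.const lam.ord.toZFSet hlam with hc
  have hcl : E.collapse hwf ⟨c, fun x => x 0⟩ = lam.ord.toZFSet := E.collapse_eval hwf c 0
  have hmem : lam.ord.toZFSet ∈ (E.embedding hwf c κ.ord.toZFSet : ZFSet.{u}) := by
    change _ ∈ E.collapse hwf ⟨c, fun _ => κ.ord.toZFSet⟩
    rw [← hcl, E.collapse_mem_collapse_iff, E.rel_iff c (σ := id) (τ := id) rfl rfl]
    -- By Łoś, since `λ` is an ordinal in the model, almost every `x 0` is an ordinal; its rank is
    -- below `κ`, so it is an element of `κ`.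
    obtain ⟨m, p, hp, φ, hφ, rφ⟩ := delta0Def_isOrdinal.{u} (Z := ∅) (0 : Fin 1)
    have h₁ := (E.realize_iff_eventually hwf φ c (fun i => (hp i).elim) (fun _ x => x 0)).1 (by
      rw [hφ.realize_class_iff (E.model_transitive hwf)]
      have h₂ := (rφ fun _ => lam.ord.toZFSet).2 (ZFSet.isOrdinal_toZFSet _)
      rw [← hcl] at h₂
      convert h₂ using 1
      · exact funext fun i => (hp i).elim
      · rfl)
    filter_upwards [h₁, E.rank_lt c] with x hx hx'
    have h₃ : (x 0).IsOrdinal := (rφ fun _ => x 0).1 (by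
      convert hx using 1
      exact funext fun i => (hp i).elim)
    change x 0 ∈ κ.ord.toZFSet
    rw [← h₃.toZFSet_rank_eq, Ordinal.toZFSet_mem_toZFSet_iff]
    exact hx' 0
  refine ⟨E.model hwf, E.embedding hwf c, E.model_transitive hwf, ?_, ?_, hmem, ?_⟩
  · intro o ho
    have hor : (o.toZFSet).rank < κ.ord := by rwa [Ordinal.rank_toZFSet]
    have h₁ := E.collapse_eval hwf (c.cons o.toZFSet (hor.trans_le hκl)) 0
    refine Eq.trans (E.collapse_eq_of_rel hwf ?_) h₁
    refine (E.rel_iff (c.cons o.toZFSet (hor.trans_le hκl)) (σ := fun n => n + 1) (τ := id)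
      rfl rfl).2 ?_
    exact (E.eventually_eq_const (c.cons o.toZFSet (hor.trans_le hκl)) (i := 0) hor).mono
      fun x hx => hx.symm
  · intro h
    rw [h, Ordinal.toZFSet_mem_toZFSet_iff, Cardinal.ord_lt_ord] at hmem
    exact hκ.not_gt hmem
  · intro x hx
    have hxl : x.rank < l := (ZFSet.mem_vonNeumann.1 hx).trans hl
    exact ⟨_, E.collapse_eval hwf (Seed.const x hxl) 0⟩

end PSR

/-! ### The `Π₁` class of natural structures -/

namespace PSR

open FirstOrder.Language

/-! ### Levels of the cumulative hierarchy -/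

/-- A level is the union of the power sets of the earlier levels; here `h` lists the candidates for
these. -/
theorem eq_vonNeumann_rank {v h : ZFSet.{u}} (hv : ∀ w ∈ h, w ∈ v → ∃ β, w = V_ β)
    (h₁ : ∀ x ∈ v, ∃ w ∈ h, w ∈ v ∧ x ⊆ w) (h₂ : ∀ w ∈ h, w ∈ v → ∀ x, x ⊆ w → x ∈ v) :
    v = V_ v.rank := by
  ext x
  rw [ZFSet.mem_vonNeumann]
  refine ⟨ZFSet.rank_lt_of_mem, fun hx => ?_⟩
  obtain ⟨y, hy, hxy⟩ := ZFSet.lt_rank_iff.1 hx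
  obtain ⟨w, hw, hwv, hyw⟩ := h₁ y hy
  obtain ⟨β, rfl⟩ := hv w hw hwv
  exact h₂ _ hw hwv x (ZFSet.subset_vonNeumann.2 (hxy.trans (ZFSet.subset_vonNeumann.1 hyw)))

/-- A `Δ₀` condition which says, if `c` is the power set of `t`, that `t` is a level of the
cumulative hierarchy at a limit greater than `ω` and `h` is the set of the levels in `t`. -/
def LevelHistory (c t h : ZFSet.{u}) : Prop :=
  (∀ x ∈ c, x ⊆ t) ∧ h ⊆ t ∧ (∀ w ∈ h, w ⊆ t) ∧
  (∀ v ∈ h, (∀ x ∈ v, ∃ w ∈ h, w ∈ v ∧ x ⊆ w) ∧ ∀ w ∈ h, w ∈ v → ∀ x ∈ c, x ⊆ w → x ∈ v) ∧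
  (∀ x ∈ t, ∃ w ∈ h, x ⊆ w) ∧ (∀ w ∈ h, ∀ x ∈ c, x ⊆ w → x ∈ t) ∧
  (∀ w ∈ h, ∃ w' ∈ h, w ∈ w') ∧ ∃ o ∈ t, ¬ o = ∅ ∧ ∀ n ∈ o, ∃ m ∈ o, n ∈ m

theorem delta0Def_levelHistory {Z : Set ZFSet.{u}} {n : ℕ} (c t h : Fin n) :
    Delta0Def Z (fun v => LevelHistory (v c) (v t) (v h)) := by
  refine .and (.ball _ (.subset _ _)) (.and (.subset _ _) (.and (.ball _ (.subset _ _))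
    (.and (.ball _ (.and
    (.ball _ (.bex _ (.and (.mem _ _) (.subset _ _))))
    (.ball _ (.imp (.mem _ _) (.ball _ (.imp (.subset _ _) (.mem _ _)))))))
    (.and (.ball _ (.bex _ (.subset _ _))) (.and
      (.ball _ (.ball _ (.imp (.subset _ _) (.mem _ _))))
      (.and (.ball _ (.bex _ (.mem _ _))) (.bex _ (.and (.not (.eq_empty _))
        (.ball _ (.bex _ (.mem _ _)))))))))))

theorem omega0_le_rank {o : ZFSet.{u}} (ho : o ≠ ∅) (h : ∀ n ∈ o, ∃ m ∈ o, n ∈ m) :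
    Ordinal.omega0 ≤ o.rank := by
  rw [Ordinal.omega0_le]
  have : ∀ n : ℕ, ∃ x ∈ o, (n : Ordinal.{u}) ≤ x.rank := by
    intro n
    induction n with
    | zero =>
      obtain ⟨x, hx⟩ := (ZFSet.eq_empty_or_nonempty o).resolve_left ho
      exact ⟨x, hx, by simp⟩
    | succ n ih =>
      obtain ⟨x, hx, hn⟩ := ih
      obtain ⟨m, hm, hxm⟩ := h x hx
      refine ⟨m, hm, ?_⟩
      push_cast
      exact Order.add_one_le_of_lt (hn.trans_lt (ZFSet.rank_lt_of_mem hxm))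
  intro n
  obtain ⟨x, hx, hn⟩ := this n
  exact hn.trans (ZFSet.rank_lt_of_mem hx).le

/-- Under `hc` the bounded quantifiers over `c` range over all subsets of `t`. Induction on
membership then shows that every element of `h` is a level, and the same closure argument applies to
`t`. -/
theorem LevelHistory.exists_eq_vonNeumann {c t h : ZFSet.{u}} (H : LevelHistory c t h)
    (hc : ∀ y, y ⊆ t → y ∈ c) :
    ∃ α : Ordinal.{u}, Order.IsSuccLimit α ∧ Ordinal.omega0 < α ∧ t = V_ α ∧ c = V_ (α + 1) := by
  obtain ⟨hct, hht, hht', hh, ht₁, ht₂, hlim, o, ho, ho', hoω⟩ := H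
  have key : ∀ v ∈ h, ∃ β, v = V_ β := by
    intro v
    induction v using ZFSet.inductionOn with
    | h v ih =>
      intro hv
      exact ⟨_, eq_vonNeumann_rank (fun w hw hwv => ih w hwv hw) (hh v hv).1
        fun w hw hwv x hx => (hh v hv).2 w hw hwv x (hc x (hx.trans (hht' w hw))) hx⟩
  have ht : t = V_ t.rank := eq_vonNeumann_rank (fun w hw _ => key w hw)
    (fun x hx => (ht₁ x hx).imp fun w hw => ⟨hw.1, hht hw.1, hw.2⟩)
    fun w hw _ x hx => ht₂ w hw x (hc x (hx.trans (hht' w hw))) hx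
  have hω : Ordinal.omega0 < t.rank := (omega0_le_rank ho' hoω).trans_lt (ZFSet.rank_lt_of_mem ho)
  refine ⟨t.rank, ?_, hω, ht, ?_⟩
  · refine ⟨fun hmin => ?_, ?_⟩
    · rw [isMin_iff_eq_bot, Ordinal.bot_eq_zero] at hmin
      rw [hmin] at hω
      exact (not_lt_bot hω).elim
    · rw [Order.isSuccPrelimit_iff_succ_lt]
      intro a ha
      obtain ⟨x, hx, hax⟩ := ZFSet.lt_rank_iff.1 ha
      obtain ⟨w, hw, hxw⟩ := ht₁ x hx
      obtain ⟨w', hw', hww'⟩ := hlim w hw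
      exact (Order.succ_le_of_lt ((hax.trans (ZFSet.rank_mono hxw)).trans_lt
        (ZFSet.rank_lt_of_mem hww'))).trans_lt (ZFSet.rank_lt_of_mem (hht hw'))
  · rw [ZFSet.vonNeumann_add_one, ← ht]
    ext x
    rw [ZFSet.mem_powerset]
    exact ⟨hct x, hc x⟩

theorem levelHistory_vonNeumann {α : Ordinal.{u}} (hα : Order.IsSuccLimit α)
    (hω : Ordinal.omega0 < α) : ∃ h ∈ V_ (α + 1), LevelHistory (V_ (α + 1)) (V_ α) h := by
  have hmem : ∀ {x : ZFSet.{u}} {β : Ordinal.{u}}, x ∈ V_ (β + 1) ↔ x ⊆ V_ β := by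
    intro x β
    rw [ZFSet.vonNeumann_add_one, ZFSet.mem_powerset]
  let h : ZFSet.{u} := ZFSet.range fun β : Set.Iio α => V_ (β : Ordinal.{u})
  have hh : ∀ {x}, x ∈ h ↔ ∃ β < α, V_ β = x := by
    intro x
    simp [h, ZFSet.mem_range]
  have hht : h ⊆ V_ α := by
    intro x hx
    obtain ⟨β, hβ, rfl⟩ := hh.1 hx
    exact ZFSet.vonNeumann_mem_of_lt hβ
  refine ⟨h, hmem.2 hht, fun x => hmem.1, hht, ?_, ?_, ?_, ?_, ?_, ?_⟩
  · intro w hw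
    exact (ZFSet.isTransitive_vonNeumann α).subset_of_mem (hht hw)
  · intro v hv
    obtain ⟨β, hβ, rfl⟩ := hh.1 hv
    constructor
    · intro x hx
      have hx' := ZFSet.mem_vonNeumann.1 hx
      exact ⟨V_ x.rank, hh.2 ⟨_, hx'.trans hβ, rfl⟩, ZFSet.vonNeumann_mem_of_lt hx',
        ZFSet.subset_vonNeumann_self x⟩
    · intro w _ hwv x _ hx
      exact ZFSet.mem_vonNeumann_of_subset hx hwv
  · intro x hx
    exact ⟨V_ x.rank, hh.2 ⟨_, ZFSet.mem_vonNeumann.1 hx, rfl⟩, ZFSet.subset_vonNeumann_self x⟩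
  · intro w hw x _ hx
    exact ZFSet.mem_vonNeumann_of_subset hx (hht hw)
  · intro w hw
    obtain ⟨β, hβ, rfl⟩ := hh.1 hw
    exact ⟨_, hh.2 ⟨_, hα.succ_lt hβ, rfl⟩, ZFSet.vonNeumann_mem_of_lt (Order.lt_succ β)⟩
  · refine ⟨(Ordinal.omega0.{u}).toZFSet, ?_, ?_, ?_⟩
    · rwa [ZFSet.mem_vonNeumann, Ordinal.rank_toZFSet]
    · intro h0
      have : ((0 : Ordinal.{u})).toZFSet ∈ (Ordinal.omega0.{u}).toZFSet :=
        Ordinal.toZFSet_mem_toZFSet_iff.2 Ordinal.omega0_pos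
      rw [h0] at this
      exact ZFSet.notMem_empty _ this
    · intro x hx
      obtain ⟨a, ha, rfl⟩ := Ordinal.mem_toZFSet_iff.1 hx
      exact ⟨(Order.succ a).toZFSet, Ordinal.toZFSet_mem_toZFSet_iff.2
        (Ordinal.isSuccLimit_omega0.succ_lt ha),
        Ordinal.toZFSet_mem_toZFSet_iff.2 (Order.lt_succ a)⟩

/-! ### A class of natural structures -/

/-- The sets `s` and `z`, seen as the sequences with the values `{u | (n, u) ∈ s}` and
`{u | (n, u) ∈ z}`, are both empty, or both are nonempty, have equal values at the pairs of indices
in `e₁`, and the values at the pairs of indices in `e₂` are related by membership; all sets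
mentioned are in `t`. -/
def Linked (t e₁ e₂ s z : ZFSet.{u}) : Prop :=
  (s = ∅ ∧ z = ∅) ∨ (¬ s = ∅ ∧ ¬ z = ∅ ∧ ∀ n ∈ t, ∀ m ∈ t,
    (ZFSet.pair n m ∈ e₁ → ∀ u ∈ t, (ZFSet.pair n u ∈ s ↔ ZFSet.pair m u ∈ z)) ∧
    (ZFSet.pair n m ∈ e₂ → ∃ w ∈ t, ZFSet.pair m w ∈ z ∧ ∀ u ∈ t, (u ∈ w ↔ ZFSet.pair n u ∈ s)))

theorem delta0Def_linked {Z : Set ZFSet.{u}} {n : ℕ} (t e₁ e₂ s z : Fin n) :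
    Delta0Def Z (fun v => Linked (v t) (v e₁) (v e₂) (v s) (v z)) := by
  refine .or (.and (.eq_empty _) (.eq_empty _)) (.and (.not (.eq_empty _)) (.and
    (.not (.eq_empty _)) (.ball _ (.ball _ (.and
      (.imp (.pair_mem _ _ _) (.ball _ (.iff (.pair_mem _ _ _) (.pair_mem _ _ _))))
      (.imp (.pair_mem _ _ _) (.bex _ (.and (.pair_mem _ _ _)
        (.ball _ (.iff (.mem _ _) (.pair_mem _ _ _)))))))))))

/-- The quadruple `p = (e₁, (e₂, (s, z)))` satisfies `Linked t e₁ e₂ s z`. -/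
def IsLink (t p : ZFSet.{u}) : Prop :=
  ∃ e₁ q, p = ZFSet.pair e₁ q ∧ ∃ e₂ r, q = ZFSet.pair e₂ r ∧ ∃ s z, r = ZFSet.pair s z ∧
    Linked t e₁ e₂ s z

theorem delta0Def_isLink {Z : Set ZFSet.{u}} {n : ℕ} (t p : Fin n) :
    Delta0Def Z (fun v => IsLink (v t) (v p)) :=
  .exists_pair _ (.exists_pair _ (.exists_pair _ (delta0Def_linked _ _ _ _ _)))

theorem isLink_pair {t e₁ e₂ s z : ZFSet.{u}} :
    IsLink t (ZFSet.pair e₁ (ZFSet.pair e₂ (ZFSet.pair s z))) ↔ Linked t e₁ e₂ s z := by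
  constructor
  · rintro ⟨e₁, q, h, e₂, r, h', s, z, h'', H⟩
    obtain ⟨rfl, rfl⟩ := ZFSet.pair_injective h
    obtain ⟨rfl, rfl⟩ := ZFSet.pair_injective h'
    obtain ⟨rfl, rfl⟩ := ZFSet.pair_injective h''
    exact H
  · intro H
    exact ⟨_, _, rfl, _, _, rfl, _, _, rfl, H⟩

/-- The set of the quadruples in `V_ α` that satisfy `IsLink (V_ α)`. -/
noncomputable def links (α : Ordinal.{u}) : ZFSet.{u} := ZFSet.sep (IsLink (V_ α)) (V_ α)

theorem links_mem (α : Ordinal.{u}) : links α ∈ V_ (α + 1) := by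
  rw [ZFSet.vonNeumann_add_one, ZFSet.mem_powerset]
  exact fun x hx => (ZFSet.mem_sep.1 hx).1

/-- The natural structure `⟨V_{α + 1}, ∈, links α⟩`. -/
noncomputable def linkStruct (α : Ordinal.{u}) : RelStruct natType.{u} :=
  natStruct (α + 1) (links α) (links_mem α)

/-- The membership relation on a set, as a set of pairs. -/
noncomputable def memPairs (c : ZFSet.{u}) : ZFSet.{u} :=
  ZFSet.sep (fun q => ∃ a b, q = ZFSet.pair a b ∧ a ∈ b) (ZFSet.prod c c)

theorem pair_mem_memPairs {c a b : ZFSet.{u}} :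
    ZFSet.pair a b ∈ memPairs c ↔ a ∈ c ∧ b ∈ c ∧ a ∈ b := by
  rw [memPairs, ZFSet.mem_sep, ZFSet.pair_mem_prod]
  constructor
  · rintro ⟨⟨h₁, h₂⟩, a', b', h, h'⟩
    obtain ⟨rfl, rfl⟩ := ZFSet.pair_injective h
    exact ⟨h₁, h₂, h'⟩
  · rintro ⟨h₁, h₂, h₃⟩
    exact ⟨⟨h₁, h₂⟩, a, b, rfl, h₃⟩

theorem relSet_one_natStruct {α : Ordinal.{u}} {a : ZFSet.{u}} (ha : a ∈ V_ α)
    (r : natType.{u}.symbols 1) : (natStruct α a ha).relSet 1 r = a := by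
  ext x
  rw [RelStruct.relSet, ZFSet.mem_range]
  constructor
  · rintro ⟨⟨v, hv⟩, rfl⟩
    exact hv
  · intro hx
    have hx' : x ∈ V_ α := (ZFSet.isTransitive_vonNeumann α).subset_of_mem ha hx
    exact ⟨⟨fun _ => ⟨x, hx'⟩, hx⟩, rfl⟩

theorem relSet_two_natStruct {α : Ordinal.{u}} {a : ZFSet.{u}} (ha : a ∈ V_ α)
    (r : natType.{u}.symbols 2) : (natStruct α a ha).relSet 2 r = memPairs (V_ α) := by
  ext x
  rw [RelStruct.relSet, ZFSet.mem_range]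
  constructor
  · rintro ⟨⟨v, hv⟩, rfl⟩
    exact pair_mem_memPairs.2 ⟨(v 0).2, (v 1).2, hv⟩
  · intro hx
    obtain ⟨-, b, d, rfl, -⟩ := ZFSet.mem_sep.1 hx
    obtain ⟨hb, hd, hbd⟩ := pair_mem_memPairs.1 hx
    exact ⟨⟨![⟨b, hb⟩, ⟨d, hd⟩], hbd⟩, rfl⟩

theorem toZFSet_natCast_one : ((1 : ℕ) : Ordinal.{u}).toZFSet = {∅} := by
  rw [Nat.cast_one, ← zero_add (1 : Ordinal.{u}), Ordinal.toZFSet_add_one, Ordinal.toZFSet_zero]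
  ext x
  simp

theorem toZFSet_natCast_two : ((2 : ℕ) : Ordinal.{u}).toZFSet = {∅, {∅}} := by
  rw [Nat.cast_succ, Ordinal.toZFSet_add_one, toZFSet_natCast_one]
  ext x
  simp [or_comm]

theorem code_natStruct {α : Ordinal.{u}} {a : ZFSet.{u}} (ha : a ∈ V_ α) :
    (natStruct α a ha).code = ZFSet.pair (V_ α) {ZFSet.pair (ZFSet.pair {∅} ∅) a,
      ZFSet.pair (ZFSet.pair {∅, {∅}} ∅) (memPairs (V_ α))} := by
  rw [RelStruct.code]
  refine congrArg (ZFSet.pair (V_ α)) ?_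
  ext x
  rw [ZFSet.mem_range, ZFSet.mem_pair]
  constructor
  · rintro ⟨⟨n, r, hr⟩, rfl⟩
    match n, r, hr with
    | 1, r, hr =>
      obtain rfl : r = ∅ := ZFSet.mem_singleton.1 hr
      left
      simp only [relSet_one_natStruct, toZFSet_natCast_one]
    | 2, r, hr =>
      obtain rfl : r = ∅ := ZFSet.mem_singleton.1 hr
      right
      simp only [relSet_two_natStruct, toZFSet_natCast_two]
    | 0, r, hr => exact (ZFSet.notMem_empty _ hr).elim
    | (n + 3), r, hr => exact (ZFSet.notMem_empty _ hr).elim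
  · rintro (rfl | rfl)
    · refine ⟨⟨1, ∅, ZFSet.mem_singleton.2 rfl⟩, ?_⟩
      simp only [relSet_one_natStruct, toZFSet_natCast_one]
    · refine ⟨⟨2, ∅, ZFSet.mem_singleton.2 rfl⟩, ?_⟩
      simp only [relSet_two_natStruct, toZFSet_natCast_two]

/-- A `Δ₀` condition which says, for `c = V_ (α + 1)` and `t = V_ α`, that `r` is the family of the
relations of `linkStruct α`. -/
def LinkRelations (c t r : ZFSet.{u}) : Prop :=
  ∃ q₁ ∈ r, ∃ q₂ ∈ r, (∀ q ∈ r, q = q₁ ∨ q = q₂) ∧ ∃ k₁ a, q₁ = ZFSet.pair k₁ a ∧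
    ∃ k₂ e, q₂ = ZFSet.pair k₂ e ∧ (∃ i j, k₁ = ZFSet.pair i j ∧ j = ∅ ∧ i = {j}) ∧
    (∃ i j, k₂ = ZFSet.pair i j ∧ j = ∅ ∧ ∃ w ∈ i, w = {j} ∧ i = {j, w}) ∧
    ((∀ p ∈ a, p ∈ t ∧ IsLink t p) ∧ ∀ p ∈ t, IsLink t p → p ∈ a) ∧
    (∀ q ∈ e, ∃ x y, q = ZFSet.pair x y ∧ x ∈ c ∧ y ∈ c ∧ x ∈ y) ∧
    ∀ x ∈ c, ∀ y ∈ c, x ∈ y → ZFSet.pair x y ∈ e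

theorem delta0Def_linkRelations {Z : Set ZFSet.{u}} {n : ℕ} (c t r : Fin n) :
    Delta0Def Z (fun v => LinkRelations (v c) (v t) (v r)) := by
  refine .bex _ (.bex _ (.and (.ball _ (.or (.eq _ _) (.eq _ _))) (.exists_pair _ (.exists_pair _
    (.and (.exists_pair _ (.and (.eq_empty _) (.eq_singleton _ _))) (.and
      (.exists_pair _ (.and (.eq_empty _) (.bex _ (.and (.eq_singleton _ _) (.eq_upair _ _ _)))))
      (.and (.and (.ball _ (.and (.mem _ _) (delta0Def_isLink _ _)))
        (.ball _ (.imp (delta0Def_isLink _ _) (.mem _ _))))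
      (.and (.ball _ (.exists_pair _ (.and (.mem _ _) (.and (.mem _ _) (.mem _ _)))))
        (.ball _ (.ball _ (.imp (.mem _ _) (.pair_mem _ _ _))))))))))))

theorem linkRelations_iff {α : Ordinal.{u}} {r : ZFSet.{u}} :
    LinkRelations (V_ (α + 1)) (V_ α) r ↔
      ZFSet.pair (V_ (α + 1)) r = (linkStruct α).code := by
  rw [linkStruct, code_natStruct]
  constructor
  · rintro ⟨_, h₁, _, h₂, h, _, a, rfl, _, e, rfl, ⟨_, _, rfl, rfl, rfl⟩,
      ⟨_, _, rfl, rfl, _, -, rfl, rfl⟩, ⟨ha₁, ha₂⟩, he₁, he₂⟩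
    have ha : a = links α := by
      ext p
      rw [links, ZFSet.mem_sep]
      exact ⟨ha₁ p, fun hp => ha₂ p hp.1 hp.2⟩
    have he : e = memPairs (V_ (α + 1)) := by
      ext q
      constructor
      · intro hq
        obtain ⟨x, y, rfl, hx⟩ := he₁ q hq
        exact pair_mem_memPairs.2 hx
      · intro hq
        obtain ⟨-, x, y, rfl, -⟩ := ZFSet.mem_sep.1 hq
        obtain ⟨hx, hy, hxy⟩ := pair_mem_memPairs.1 hq
        exact he₂ x hx y hy hxy
    subst ha he
    refine congrArg (ZFSet.pair _) ?_
    ext q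
    rw [ZFSet.mem_pair]
    refine ⟨h q, ?_⟩
    rintro (rfl | rfl)
    · exact h₁
    · exact h₂
  · intro h
    obtain rfl := (ZFSet.pair_injective h).2
    refine ⟨_, ZFSet.mem_pair.2 (Or.inl rfl), _, ZFSet.mem_pair.2 (Or.inr rfl),
      fun q hq => ZFSet.mem_pair.1 hq, _, _, rfl, _, _, rfl, ⟨_, _, rfl, rfl, rfl⟩,
      ⟨_, _, rfl, rfl, {∅}, ZFSet.mem_pair.2 (Or.inr rfl), rfl, rfl⟩,
      ⟨fun p hp => ZFSet.mem_sep.1 hp, fun p hp hp' => ZFSet.mem_sep.2 ⟨hp, hp'⟩⟩, ?_, ?_⟩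
    · intro q hq
      obtain ⟨-, x, y, rfl, -⟩ := ZFSet.mem_sep.1 hq
      exact ⟨x, y, rfl, pair_mem_memPairs.1 hq⟩
    · intro x hx y hy hxy
      exact pair_mem_memPairs.2 ⟨hx, hy, hxy⟩

/-- The matrix of a `Π₁` definition of the class of the structures `linkStruct α`. -/
def LinkMatrix (x y : ZFSet.{u}) : Prop :=
  ∃ c r, x = ZFSet.pair c r ∧ ∃ t ∈ c, ∃ h ∈ c, LevelHistory c t h ∧ LinkRelations c t r ∧
    (y ⊆ t → y ∈ c)

theorem delta0Def_linkMatrix {Z : Set ZFSet.{u}} {n : ℕ} (x y : Fin n) :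
    Delta0Def Z (fun v => LinkMatrix (v x) (v y)) :=
  .exists_pair _ (.bex _ (.bex _ (.and (delta0Def_levelHistory _ _ _)
    (.and (delta0Def_linkRelations _ _ _) (.imp (.subset _ _) (.mem _ _))))))

/-- The class of the structures `linkStruct α` for limits `α` greater than `ω`. -/
def linkClass : Set ZFSet.{u} :=
  {x | ∃ α : Ordinal.{u}, Order.IsSuccLimit α ∧ Ordinal.omega0 < α ∧ x = (linkStruct α).code}

theorem forall_linkMatrix_iff {x : ZFSet.{u}} : (∀ y, LinkMatrix x y) ↔ x ∈ linkClass := by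
  constructor
  · intro H
    obtain ⟨c, r, rfl, t, htc, h, -, hh, hr, -⟩ := H ∅
    have hc : ∀ y, y ⊆ t → y ∈ c := by
      intro y hy
      obtain ⟨c', r', hx, t', htc', h', -, hh', -, hy'⟩ := H y
      obtain ⟨rfl, rfl⟩ := ZFSet.pair_injective hx
      -- The witness `t'` belonging to this `y` might differ from `t`, but all elements of `c`,
      -- among them `t`, are subsets of `t'`.
      exact hy' (hy.trans (hh'.1 t htc))
    obtain ⟨α, hα, hω, rfl, rfl⟩ := hh.exists_eq_vonNeumann hc
    exact ⟨α, hα, hω, linkRelations_iff.1 hr⟩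
  · rintro ⟨α, hα, hω, rfl⟩ y
    obtain ⟨h, hh, hh'⟩ := levelHistory_vonNeumann hα hω
    refine ⟨_, _, rfl, V_ α, ZFSet.vonNeumann_mem_of_lt (lt_add_one α), h, hh, hh',
      linkRelations_iff.2 rfl, fun hy => ?_⟩
    change y ∈ V_ (α + 1)
    rwa [ZFSet.vonNeumann_add_one, ZFSet.mem_powerset]

theorem exists_isPi1_definedClass_eq : ∃ φ : LSet.Formula Unit, IsPi1 φ ∧
    definedClass.{u} φ = linkClass := by
  obtain ⟨m, p, hp, φ, hφ, rφ⟩ := delta0Def_linkMatrix.{u} (Z := ∅) (0 : Fin 2) 1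
  obtain ⟨ψ, hψ, rψ⟩ := hφ.exists_rename.{u} (β := Unit) (m := 1)
    (Sum.elim (fun i => (hp i).elim) ![Sum.inl (), Sum.inr 0])
  refine ⟨ψ.all, .all (.delta0 hψ), Set.ext fun x => ?_⟩
  rw [← forall_linkMatrix_iff]
  change ψ.all.Realize (fun _ => x) default ↔ _
  rw [BoundedFormula.realize_all]
  refine forall_congr' fun y => ?_
  rw [rψ]
  refine Iff.trans (iff_of_eq ?_) (rφ ![x, y])
  refine congrArg₂ (BoundedFormula.Realize φ) (funext fun i => (hp i).elim) (funext fun i => ?_)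
  match i with
  | 0 => rfl
  | 1 => rfl

theorem isProperClass_linkClass : IsProperClass linkClass.{u} := by
  rintro ⟨s, hs⟩
  have hlim : Order.IsSuccLimit ((Order.succ (max s.rank Ordinal.omega0)) + Ordinal.omega0) :=
    Ordinal.isSuccLimit_add _ Ordinal.isSuccLimit_omega0
  have hle : max s.rank Ordinal.omega0 <
      (Order.succ (max s.rank Ordinal.omega0)) + Ordinal.omega0 :=
    (Order.lt_succ _).trans_le le_self_add
  have h₁ := ZFSet.rank_lt_of_mem (hs _ ⟨_, hlim, (le_max_right _ _).trans_lt hle, rfl⟩)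
  have h₂ := rank_lt_rank_pair_left (linkStruct (Order.succ (max s.rank Ordinal.omega0) +
    Ordinal.omega0)).carrier (linkStruct (Order.succ (max s.rank Ordinal.omega0) +
    Ordinal.omega0)).relFamily
  rw [← RelStruct.code_eq] at h₂
  change (V_ _).rank < _ at h₂
  rw [ZFSet.rank_vonNeumann] at h₂
  exact absurd ((le_max_left _ _).trans_lt hle) (((lt_add_one _).trans (h₂.trans h₁)).not_gt)

end PSR

/-! ### What a product of structures computes coordinatewise -/

namespace PSR

open FirstOrder.Language

/-! ### Predicates that can be computed coordinatewise in products -/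

/-- Some formula holds in each product of structures if and only if the predicate `P` holds in
every factor. -/
def CoordDef {τ : RelType.{u}} {n : ℕ} (P : ∀ A : RelStruct τ, (Fin n → A.carrier) → Prop) :
    Prop :=
  ∃ φ : τ.lang.BoundedFormula Empty n, ∀ (S : Set (RelStruct τ)) (p : Empty → Product S)
    (v : Fin n → Product S), φ.Realize p v ↔ ∀ A : S, P A (fun k => v k A)

namespace CoordDef

variable {τ : RelType.{u}} {n : ℕ}

theorem map_iff {P : ∀ A : RelStruct τ, (Fin n → A.carrier) → Prop} (hP : CoordDef P)
    {S T : Set (RelStruct τ)} (h : Product S ↪ₑ[τ.lang] Product T) (v : Fin n → Product S) :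
    (∀ A : T, P A (fun k => h (v k) A)) ↔ ∀ A : S, P A (fun k => v k A) := by
  obtain ⟨φ, hφ⟩ := hP
  exact (hφ T (h ∘ Empty.elim) (h ∘ v)).symm.trans
    ((h.map_boundedFormula φ _ _).trans (hφ S Empty.elim v))

theorem congr {P Q : ∀ A : RelStruct τ, (Fin n → A.carrier) → Prop} (hP : CoordDef P)
    (h : ∀ A v, Q A v ↔ P A v) : CoordDef Q := by
  obtain ⟨φ, hφ⟩ := hP
  exact ⟨φ, fun S p v => (hφ S p v).trans (forall_congr' fun A => (h _ _).symm)⟩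

theorem rel {l : ℕ} (R : τ.symbols l) (ρ : Fin l → Fin n) :
    CoordDef (fun (A : RelStruct τ) (v : Fin n → A.carrier) => (fun k => v (ρ k)) ∈ A.rel l R) :=
  ⟨BoundedFormula.rel (L := τ.lang) (l := l) R fun k => Term.var (Sum.inr (ρ k)),
    fun _ p v => realize_rel_product p v _ _⟩

theorem eq (i j : Fin n) :
    CoordDef (fun (A : RelStruct τ) (v : Fin n → A.carrier) => v i = v j) :=
  ⟨BoundedFormula.equal (Term.var (Sum.inr i)) (Term.var (Sum.inr j)),
    fun _ p v => realize_equal_product p v _ _⟩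

theorem and {P Q : ∀ A : RelStruct τ, (Fin n → A.carrier) → Prop} (hP : CoordDef P)
    (hQ : CoordDef Q) : CoordDef (fun A v => P A v ∧ Q A v) := by
  obtain ⟨φ, hφ⟩ := hP
  obtain ⟨ψ, hψ⟩ := hQ
  refine ⟨φ ⊓ ψ, fun S p v => ?_⟩
  rw [BoundedFormula.realize_inf, hφ, hψ, forall_and]

theorem realize_snoc {P : ∀ A : RelStruct τ, (Fin n → A.carrier) → A.carrier → Prop}
    {φ : τ.lang.BoundedFormula Empty (n + 1)} (hφ : ∀ (S : Set (RelStruct τ))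
      (p : Empty → Product S) (v : Fin (n + 1) → Product S), φ.Realize p v ↔
        ∀ A : S, P A (Fin.init fun k => v k A) (v (Fin.last n) A))
    {S : Set (RelStruct τ)} (p : Empty → Product S) (v : Fin n → Product S) (a : Product S) :
    φ.Realize p (Fin.snoc v a) ↔ ∀ A : S, P A (fun k => v k A) (a A) := by
  rw [hφ]
  refine forall_congr' fun A => ?_
  rw [snoc_apply_coord, Fin.init_snoc, Fin.snoc_last]

/-- Witnesses chosen at all factors together form an element of the product. -/
theorem ex {P : ∀ A : RelStruct τ, (Fin n → A.carrier) → A.carrier → Prop}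
    (hP : CoordDef (fun (A : RelStruct τ) (w : Fin (n + 1) → A.carrier) =>
      P A (Fin.init w) (w (Fin.last n)))) : CoordDef (fun A v => ∃ x, P A v x) := by
  obtain ⟨φ, hφ⟩ := hP
  refine ⟨φ.ex, fun S p v => ?_⟩
  rw [BoundedFormula.realize_ex]
  simp only [realize_snoc hφ]
  constructor
  · rintro ⟨a, ha⟩ A
    exact ⟨a A, ha A⟩
  · intro h
    choose a ha using h
    exact ⟨a, ha⟩

/-- A universal quantifier in a product ranges over whole functions. To test `x` at one factor, it
must be extended to a function satisfying `P` at all the others, which is possible only if `P` is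
satisfiable everywhere. -/
theorem guarded {P Q : ∀ A : RelStruct τ, (Fin n → A.carrier) → A.carrier → Prop}
    (hP : CoordDef (fun (A : RelStruct τ) (w : Fin (n + 1) → A.carrier) =>
      P A (Fin.init w) (w (Fin.last n))))
    (hQ : CoordDef (fun (A : RelStruct τ) (w : Fin (n + 1) → A.carrier) =>
      Q A (Fin.init w) (w (Fin.last n)))) :
    CoordDef (fun A v => (∃ x, P A v x) ∧ ∀ x, P A v x → Q A v x) := by
  obtain ⟨φ, hφ⟩ := hP
  obtain ⟨ψ, hψ⟩ := hQ
  refine ⟨φ.ex ⊓ (φ.imp ψ).all, fun S p v => ?_⟩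
  rw [BoundedFormula.realize_inf, BoundedFormula.realize_ex, BoundedFormula.realize_all]
  simp only [BoundedFormula.realize_imp, realize_snoc hφ, realize_snoc hψ]
  constructor
  · rintro ⟨⟨a, ha⟩, h⟩ A
    refine ⟨⟨a A, ha A⟩, fun x hx => ?_⟩
    classical
    obtain ⟨b, rfl, hb⟩ : ∃ b : Product S, b A = x ∧ ∀ B, B ≠ A → b B = a B :=
      ⟨Function.update a A x, Function.update_self _ _ _, fun B hB => Function.update_of_ne hB _ _⟩
    refine h b (fun B => ?_) A
    by_cases hB : B = A
    · subst hB
      exact hx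
    · exact (hb B hB).symm ▸ ha B
  · intro h
    choose a ha using fun A => (h A).1
    exact ⟨⟨a, ha⟩, fun b hb A => (h A).2 _ (hb A)⟩

end CoordDef

/-- The binary relation of a structure of the type of natural structures. -/
def StructMem (A : RelStruct natType.{u}) (x y : A.carrier) : Prop :=
  ![x, y] ∈ A.rel 2 ⟨∅, ZFSet.mem_singleton.2 rfl⟩

/-- The unary relation of a structure of the type of natural structures. -/
def StructPred (A : RelStruct natType.{u}) (x : A.carrier) : Prop :=
  ![x] ∈ A.rel 1 ⟨∅, ZFSet.mem_singleton.2 rfl⟩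

/-- `x` is nonempty and a subset of `y`, in the sense of the structure. -/
def StructSubset (A : RelStruct natType.{u}) (x y : A.carrier) : Prop :=
  (∃ w, StructMem A w x) ∧ ∀ w, StructMem A w x → StructMem A w y

/-- `z` is the smallest set with the elements `a` and `b`, in the sense of the structure. -/
def StructUpair (A : RelStruct natType.{u}) (z a b : A.carrier) : Prop :=
  (StructMem A a z ∧ StructMem A b z) ∧ (∃ y, StructMem A a y ∧ StructMem A b y) ∧
    ∀ y, StructMem A a y ∧ StructMem A b y → StructSubset A z y

/-- `p` is the ordered pair of `a` and `b`, in the sense of the structure. -/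
def StructPair (A : RelStruct natType.{u}) (p a b : A.carrier) : Prop :=
  ∃ x y, StructUpair A x a a ∧ StructUpair A y a b ∧ StructUpair A p x y

/-- `(e₁, (e₂, (s, z)))` satisfies the unary relation of the structure. -/
def StructLink (A : RelStruct natType.{u}) (e₁ e₂ s z : A.carrier) : Prop :=
  ∃ r, StructPair A r s z ∧ ∃ q, StructPair A q e₂ r ∧ ∃ p, StructPair A p e₁ q ∧ StructPred A p

/-- `x` is the singleton of `a`, in the sense of the structure. -/
def StructSingleton (A : RelStruct natType.{u}) (x a : A.carrier) : Prop :=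
  StructMem A a x ∧ (∃ w, StructMem A w x) ∧ ∀ w, StructMem A w x → w = a

/-- `x` and `y` meet and their intersection is contained in `z`, in the sense of the structure. -/
def StructInter (A : RelStruct natType.{u}) (x y z : A.carrier) : Prop :=
  (∃ w, StructMem A w x ∧ StructMem A w y) ∧
    ∀ w, StructMem A w x ∧ StructMem A w y → StructMem A w z

/-- Every set containing `x` and `y` contains every element of every set, in the sense of the
structure. -/
def StructCover (A : RelStruct natType.{u}) (x y : A.carrier) : Prop :=
  (∃ d, StructSubset A x d ∧ StructSubset A y d) ∧
    ∀ d, StructSubset A x d ∧ StructSubset A y d →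
      (∃ w, ∃ z, StructMem A w z) ∧ ∀ w, (∃ z, StructMem A w z) → StructMem A w d

/-- The image of `x` under the relation given by `(e₁, e₂)` is contained in `y`. -/
def StructImageSubset (A : RelStruct natType.{u}) (e₁ e₂ x y : A.carrier) : Prop :=
  (∃ z, ∃ s, StructMem A s x ∧ StructLink A e₁ e₂ s z) ∧
    ∀ z, (∃ s, StructMem A s x ∧ StructLink A e₁ e₂ s z) → StructMem A z y

/-- The image of `x` under the relation given by `(e₁, e₂)` contains `y`. -/
def StructSubsetImage (A : RelStruct natType.{u}) (e₁ e₂ x y : A.carrier) : Prop :=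
  (∃ z, StructMem A z y) ∧ ∀ z, StructMem A z y → ∃ s, StructMem A s x ∧ StructLink A e₁ e₂ s z

namespace CoordDef

variable {n : ℕ}

theorem structMem (i j : Fin n) : CoordDef (fun A v => StructMem.{u} A (v i) (v j)) := by
  refine (rel (τ := natType.{u}) ⟨∅, ZFSet.mem_singleton.2 rfl⟩ ![i, j]).congr fun A v => ?_
  rw [StructMem]
  refine iff_of_eq (congrArg (· ∈ A.rel 2 _) (funext fun k => ?_))
  match k with
  | 0 => rfl
  | 1 => rfl

theorem structPred (i : Fin n) : CoordDef (fun A v => StructPred.{u} A (v i)) := by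
  refine (rel (τ := natType.{u}) ⟨∅, ZFSet.mem_singleton.2 rfl⟩ ![i]).congr fun A v => ?_
  rw [StructPred]
  refine iff_of_eq (congrArg (· ∈ A.rel 1 _) (funext fun k => ?_))
  match k with
  | 0 => rfl

theorem structSubset (i j : Fin n) : CoordDef (fun A v => StructSubset.{u} A (v i) (v j)) :=
  .guarded (.structMem _ _) (.structMem _ _)

theorem structUpair (i j k : Fin n) :
    CoordDef (fun A v => StructUpair.{u} A (v i) (v j) (v k)) :=
  .and (.and (.structMem _ _) (.structMem _ _))
    (.guarded (.and (.structMem _ _) (.structMem _ _)) (.structSubset _ _))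

theorem structPair (i j k : Fin n) : CoordDef (fun A v => StructPair.{u} A (v i) (v j) (v k)) :=
  .ex (.ex (.and (.structUpair _ _ _) (.and (.structUpair _ _ _) (.structUpair _ _ _))))

theorem structLink (i j k l : Fin n) :
    CoordDef (fun A v => StructLink.{u} A (v i) (v j) (v k) (v l)) :=
  .ex (.and (.structPair _ _ _) (.ex (.and (.structPair _ _ _) (.ex (.and (.structPair _ _ _)
    (.structPred _))))))

theorem structSingleton (i j : Fin n) :
    CoordDef (fun A v => StructSingleton.{u} A (v i) (v j)) :=
  .and (.structMem _ _) (.guarded (.structMem _ _) (.eq _ _))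

theorem structInter (i j k : Fin n) :
    CoordDef (fun A v => StructInter.{u} A (v i) (v j) (v k)) :=
  .guarded (.and (.structMem _ _) (.structMem _ _)) (.structMem _ _)

theorem structCover (i j : Fin n) : CoordDef (fun A v => StructCover.{u} A (v i) (v j)) :=
  .guarded (.and (.structSubset _ _) (.structSubset _ _))
    (.guarded (.ex (.structMem _ _)) (.structMem _ _))

theorem structImageSubset (i j k l : Fin n) :
    CoordDef (fun A v => StructImageSubset.{u} A (v i) (v j) (v k) (v l)) :=
  .guarded (.ex (.and (.structMem _ _) (.structLink _ _ _ _))) (.structMem _ _)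

theorem structSubsetImage (i j k l : Fin n) :
    CoordDef (fun A v => StructSubsetImage.{u} A (v i) (v j) (v k) (v l)) :=
  .guarded (.structMem _ _) (.ex (.and (.structMem _ _) (.structLink _ _ _ _)))

end CoordDef

/-! ### Evaluation in the structures of the class -/

section

variable {α : Ordinal.{u}}

theorem mem_vonNeumann_add_one {x : ZFSet.{u}} : x ∈ V_ (α + 1) ↔ x ⊆ V_ α := by
  rw [ZFSet.vonNeumann_add_one, ZFSet.mem_powerset]

theorem structPred_linkStruct {x : (linkStruct α).carrier} :
    StructPred (linkStruct α) x ↔ x.1 ∈ links α := Iff.rfl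

theorem mem_of_mem_carrier {x y : ZFSet.{u}} (hy : y ∈ (linkStruct α).carrier) (hx : x ∈ y) :
    x ∈ V_ α := mem_vonNeumann_add_one.1 hy hx

theorem mem_carrier_of_mem {x : ZFSet.{u}} (hx : x ∈ V_ α) : x ∈ (linkStruct α).carrier :=
  ZFSet.vonNeumann_subset_of_le (le_of_lt (lt_add_one α)) hx

theorem structSubset_linkStruct {x y : (linkStruct α).carrier} :
    StructSubset (linkStruct α) x y ↔ x.1.Nonempty ∧ x.1 ⊆ y.1 := by
  constructor
  · rintro ⟨⟨w, hw⟩, h⟩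
    exact ⟨⟨w, hw⟩, fun z hz => h ⟨z, mem_carrier_of_mem (mem_of_mem_carrier x.2 hz)⟩ hz⟩
  · rintro ⟨⟨w, hw⟩, h⟩
    exact ⟨⟨⟨w, mem_carrier_of_mem (mem_of_mem_carrier x.2 hw)⟩, hw⟩, fun z hz => h hz⟩

theorem structUpair_linkStruct {z a b : (linkStruct α).carrier} :
    StructUpair (linkStruct α) z a b ↔ z.1 = {a.1, b.1} := by
  constructor
  · rintro ⟨⟨ha, hb⟩, -, h⟩
    have hy : ({a.1, b.1} : ZFSet.{u}) ∈ (linkStruct α).carrier := by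
      refine mem_vonNeumann_add_one.2 fun x hx => ?_
      rcases ZFSet.mem_pair.1 hx with rfl | rfl
      · exact mem_of_mem_carrier z.2 ha
      · exact mem_of_mem_carrier z.2 hb
    have h₁ := (structSubset_linkStruct.1 (h ⟨_, hy⟩
      ⟨ZFSet.mem_pair.2 (Or.inl rfl), ZFSet.mem_pair.2 (Or.inr rfl)⟩)).2
    ext x
    refine ⟨fun hx => h₁ hx, fun hx => ?_⟩
    rcases ZFSet.mem_pair.1 hx with rfl | rfl
    · exact ha
    · exact hb
  · intro h
    have ha : a.1 ∈ z.1 := by rw [h]; exact ZFSet.mem_pair.2 (Or.inl rfl)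
    have hb : b.1 ∈ z.1 := by rw [h]; exact ZFSet.mem_pair.2 (Or.inr rfl)
    refine ⟨⟨ha, hb⟩, ⟨z, ha, hb⟩, fun y hy => structSubset_linkStruct.2 ⟨⟨_, ha⟩, fun x hx => ?_⟩⟩
    rw [h] at hx
    rcases ZFSet.mem_pair.1 hx with rfl | rfl
    · exact hy.1
    · exact hy.2

theorem structPair_linkStruct {p a b : (linkStruct α).carrier} :
    StructPair (linkStruct α) p a b ↔ p.1 = ZFSet.pair a.1 b.1 := by
  simp only [StructPair, structUpair_linkStruct]
  constructor
  · rintro ⟨x, y, hx, hy, hp⟩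
    rw [hp, hx, hy, ZFSet.pair, ZFSet.pair_eq_singleton]
  · intro hp
    have h₁ : ({a.1} : ZFSet.{u}) ∈ p.1 := by
      rw [hp, ZFSet.pair]
      exact ZFSet.mem_pair.2 (Or.inl rfl)
    have h₂ : ({a.1, b.1} : ZFSet.{u}) ∈ p.1 := by
      rw [hp, ZFSet.pair]
      exact ZFSet.mem_pair.2 (Or.inr rfl)
    refine ⟨⟨_, mem_carrier_of_mem (mem_of_mem_carrier p.2 h₁)⟩,
      ⟨_, mem_carrier_of_mem (mem_of_mem_carrier p.2 h₂)⟩, ?_, rfl, hp⟩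
    exact (ZFSet.pair_eq_singleton _).symm

theorem pair_mem_vonNeumann (hα : Order.IsSuccLimit α) {x y : ZFSet.{u}} :
    ZFSet.pair x y ∈ V_ α ↔ x ∈ V_ α ∧ y ∈ V_ α := by
  simp only [ZFSet.mem_vonNeumann]
  exact ⟨fun h => ⟨(rank_lt_rank_pair_left x y).trans h, (rank_lt_rank_pair_right x y).trans h⟩,
    fun h => rank_pair_lt hα h.1 h.2⟩

theorem structLink_linkStruct (hα : Order.IsSuccLimit α) {e₁ e₂ s z : (linkStruct α).carrier} :
    StructLink (linkStruct α) e₁ e₂ s z ↔ (e₁.1 ∈ V_ α ∧ e₂.1 ∈ V_ α ∧ s.1 ∈ V_ α ∧ z.1 ∈ V_ α) ∧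
      Linked (V_ α) e₁ e₂ s z := by
  simp only [StructLink, structPair_linkStruct, structPred_linkStruct]
  have key : ZFSet.pair e₁.1 (ZFSet.pair e₂.1 (ZFSet.pair s.1 z.1)) ∈ links α ↔
      (e₁.1 ∈ V_ α ∧ e₂.1 ∈ V_ α ∧ s.1 ∈ V_ α ∧ z.1 ∈ V_ α) ∧ Linked (V_ α) e₁ e₂ s z := by
    rw [links, ZFSet.mem_sep, isLink_pair, pair_mem_vonNeumann hα, pair_mem_vonNeumann hα,
      pair_mem_vonNeumann hα]
  rw [← key]
  constructor
  · rintro ⟨r, hr, q, hq, p, hp, h⟩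
    rwa [hp, hq, hr] at h
  · intro h
    obtain ⟨h₁, h₂, h₃, h₄⟩ := (key.1 h).1
    have h₅ := (pair_mem_vonNeumann hα).2 ⟨h₃, h₄⟩
    have h₆ := (pair_mem_vonNeumann hα).2 ⟨h₂, h₅⟩
    exact ⟨⟨_, mem_carrier_of_mem h₅⟩, rfl, ⟨_, mem_carrier_of_mem h₆⟩, rfl,
      ⟨_, mem_carrier_of_mem ((pair_mem_vonNeumann hα).2 ⟨h₁, h₆⟩)⟩, rfl, h⟩

theorem structSingleton_linkStruct {x a : (linkStruct α).carrier} :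
    StructSingleton (linkStruct α) x a ↔ x.1 = {a.1} := by
  constructor
  · rintro ⟨ha, -, h⟩
    ext w
    rw [ZFSet.mem_singleton]
    constructor
    · intro hw
      exact congrArg Subtype.val (h ⟨w, mem_carrier_of_mem (mem_of_mem_carrier x.2 hw)⟩ hw)
    · rintro rfl
      exact ha
  · intro h
    have ha : a.1 ∈ x.1 := by rw [h]; exact ZFSet.mem_singleton.2 rfl
    refine ⟨ha, ⟨a, ha⟩, fun w hw => Subtype.ext ?_⟩
    have hw' : w.1 ∈ x.1 := hw
    rw [h] at hw'
    exact ZFSet.mem_singleton.1 hw'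

theorem structInter_linkStruct {x y z : (linkStruct α).carrier} :
    StructInter (linkStruct α) x y z ↔ (∃ w, w ∈ x.1 ∧ w ∈ y.1) ∧
      ∀ w, w ∈ x.1 → w ∈ y.1 → w ∈ z.1 := by
  constructor
  · rintro ⟨⟨w, hw⟩, h⟩
    exact ⟨⟨w, hw⟩, fun z hz hz' => h ⟨z, mem_carrier_of_mem (mem_of_mem_carrier x.2 hz)⟩ ⟨hz, hz'⟩⟩
  · rintro ⟨⟨w, hw⟩, h⟩
    exact ⟨⟨⟨w, mem_carrier_of_mem (mem_of_mem_carrier x.2 hw.1)⟩, hw⟩, fun z hz => h z hz.1 hz.2⟩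

/-- A disjunction is not computed coordinatewise. Membership in `x ∪ y` is therefore expressed by
membership in all common supersets, of which the union is the least; the elements of elements of
`V_{α+1}` are exactly those of `V_α`. -/
theorem structCover_linkStruct {x y : (linkStruct α).carrier} (hx : x.1.Nonempty)
    (hy : y.1.Nonempty) :
    StructCover (linkStruct α) x y ↔ ∀ w ∈ V_ α, w ∈ x.1 ∨ w ∈ y.1 := by
  have hV : V_ α ∈ (linkStruct α).carrier := ZFSet.vonNeumann_mem_of_lt (lt_add_one α)
  simp only [StructCover, structSubset_linkStruct]
  constructor
  · rintro ⟨-, h⟩ w hw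
    have hd : x.1 ∪ y.1 ∈ (linkStruct α).carrier := mem_vonNeumann_add_one.2 fun z hz =>
      (ZFSet.mem_union.1 hz).elim (mem_of_mem_carrier x.2) (mem_of_mem_carrier y.2)
    have h₁ := (h ⟨_, hd⟩ ⟨⟨hx, fun z hz => ZFSet.mem_union.2 (Or.inl hz)⟩,
      ⟨hy, fun z hz => ZFSet.mem_union.2 (Or.inr hz)⟩⟩).2 ⟨w, mem_carrier_of_mem hw⟩ ⟨⟨_, hV⟩, hw⟩
    exact ZFSet.mem_union.1 h₁
  · intro h
    refine ⟨⟨⟨_, hV⟩, ⟨hx, fun z => mem_of_mem_carrier x.2⟩, ⟨hy, fun z => mem_of_mem_carrier y.2⟩⟩,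
      fun d hd => ⟨?_, fun w ⟨z, hz⟩ => ?_⟩⟩
    · obtain ⟨w, hw⟩ := hx
      exact ⟨⟨w, mem_carrier_of_mem (mem_of_mem_carrier x.2 hw)⟩, x, hw⟩
    · exact (h w.1 (mem_of_mem_carrier z.2 hz)).elim (fun h' => hd.1.2 h') fun h' => hd.2.2 h'

end

end PSR

/-! ### Reading an extender off from a product embedding -/

namespace PSR

open FirstOrder.Language

/-! ### Sequences of sets as sets -/

theorem toZFSet_natCast_inj {n m : ℕ} :
    (n : Ordinal.{u}).toZFSet = (m : Ordinal.{u}).toZFSet ↔ n = m :=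
  Ordinal.toZFSet_injective.eq_iff.trans Nat.cast_inj

/-- The sequence coded by a set. -/
noncomputable def decode (z : ZFSet.{u}) (n : ℕ) : ZFSet.{u} :=
  ZFSet.sep (fun w => ZFSet.pair (n : Ordinal.{u}).toZFSet w ∈ z) (⋃₀ ⋃₀ z)

theorem mem_decode {z w : ZFSet.{u}} {n : ℕ} :
    w ∈ decode z n ↔ ZFSet.pair (n : Ordinal.{u}).toZFSet w ∈ z := by
  rw [decode, ZFSet.mem_sep, and_iff_right_iff_imp]
  intro h
  refine ZFSet.mem_sUnion.2 ⟨{(n : Ordinal.{u}).toZFSet, w}, ZFSet.mem_sUnion.2 ⟨_, h, ?_⟩, ?_⟩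
  · rw [ZFSet.pair]
    exact ZFSet.mem_pair.2 (Or.inr rfl)
  · exact ZFSet.mem_pair.2 (Or.inr rfl)

theorem rank_decode_le (z : ZFSet.{u}) (n : ℕ) : (decode z n).rank ≤ z.rank :=
  ZFSet.rank_le_iff.2 fun _ hw =>
    (rank_lt_rank_pair_right _ _).trans (ZFSet.rank_lt_of_mem (mem_decode.1 hw))

/-- A nonempty set that codes the given sequence. -/
noncomputable def encode (c : ℕ → ZFSet.{u}) : ZFSet.{u} :=
  insert ∅ (ZFSet.range fun p : Σ n : ℕ, c n => ZFSet.pair (p.1 : Ordinal.{u}).toZFSet p.2)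

theorem pair_ne_empty (x y : ZFSet.{u}) : ZFSet.pair x y ≠ ∅ := by
  intro h
  have : ({x} : ZFSet.{u}) ∈ ZFSet.pair x y := by
    rw [ZFSet.pair]
    exact ZFSet.mem_pair.2 (Or.inl rfl)
  rw [h] at this
  exact ZFSet.notMem_empty _ this

/-- The element `∅` is not a pair, so `decode` ignores it; it keeps even the code of the constantly
empty sequence apart from the dummy element `∅`. -/
theorem encode_ne_empty (c : ℕ → ZFSet.{u}) : encode c ≠ ∅ := by
  intro h
  have : ∅ ∈ encode c := ZFSet.mem_insert _ _
  rw [h] at this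
  exact ZFSet.notMem_empty _ this

theorem mem_encode {c : ℕ → ZFSet.{u}} {x : ZFSet.{u}} :
    x ∈ encode c ↔ x = ∅ ∨ ∃ n, ∃ w ∈ c n, ZFSet.pair (n : Ordinal.{u}).toZFSet w = x := by
  rw [encode, ZFSet.mem_insert_iff, ZFSet.mem_range]
  refine or_congr_right ⟨?_, ?_⟩
  · rintro ⟨⟨n, w, hw⟩, rfl⟩
    exact ⟨n, w, hw, rfl⟩
  · rintro ⟨n, w, hw, rfl⟩
    exact ⟨⟨n, w, hw⟩, rfl⟩

theorem decode_encode (c : ℕ → ZFSet.{u}) : decode (encode c) = c := by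
  funext n
  ext w
  rw [mem_decode, mem_encode]
  constructor
  · rintro (h | ⟨m, w', hw', h⟩)
    · exact (pair_ne_empty _ _ h).elim
    · obtain ⟨h₁, rfl⟩ := ZFSet.pair_injective h
      rwa [← toZFSet_natCast_inj.1 h₁]
  · intro hw
    exact Or.inr ⟨n, w, hw, rfl⟩

theorem rank_pair_le {x y : ZFSet.{u}} {o : Ordinal.{u}} (hx : x.rank ≤ o) (hy : y.rank ≤ o) :
    (ZFSet.pair x y).rank ≤ Order.succ (Order.succ o) := by
  rw [ZFSet.pair, ZFSet.rank_pair, ZFSet.rank_pair, ZFSet.rank_singleton]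
  simp [hx, hy]

theorem encode_mem_vonNeumann {α o : Ordinal.{u}} (hα : Order.IsSuccLimit α)
    (hω : Ordinal.omega0 < α) (ho : o < α) {c : ℕ → ZFSet.{u}} (hc : ∀ n, (c n).rank ≤ o) :
    encode c ∈ V_ α := by
  have h : (encode c).rank ≤ Order.succ (Order.succ (Order.succ (max o Ordinal.omega0))) := by
    refine ZFSet.rank_le_iff.2 fun x hx => ?_
    rcases mem_encode.1 hx with rfl | ⟨n, w, hw, rfl⟩
    · rw [ZFSet.rank_empty]
      exact Order.bot_lt_succ _
    · refine Order.lt_succ_of_le (rank_pair_le ?_ ?_)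
      · rw [Ordinal.rank_toZFSet]
        exact (Ordinal.natCast_lt_omega0 n).le.trans (le_max_right _ _)
      · exact ((ZFSet.rank_lt_of_mem hw).le.trans (hc n)).trans (le_max_left _ _)
  exact ZFSet.mem_vonNeumann.2
    (h.trans_lt (hα.succ_lt (hα.succ_lt (hα.succ_lt (max_lt ho hω)))))

/-- The set of the pairs `(σ n, n)`. -/
noncomputable def indexGraph (σ : ℕ → ℕ) : ZFSet.{u} :=
  ZFSet.range fun n : ℕ => ZFSet.pair ((σ n : ℕ) : Ordinal.{u}).toZFSet (n : Ordinal.{u}).toZFSet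

theorem rank_natCast_lt (n : ℕ) : ((n : Ordinal.{u}).toZFSet).rank < Ordinal.omega0 := by
  rw [Ordinal.rank_toZFSet]
  exact Ordinal.natCast_lt_omega0 n

theorem rank_indexGraph_le (σ : ℕ → ℕ) : (indexGraph.{u} σ).rank ≤ Ordinal.omega0 := by
  refine ZFSet.rank_le_iff.2 fun x hx => ?_
  obtain ⟨n, rfl⟩ := ZFSet.mem_range.1 hx
  exact rank_pair_lt Ordinal.isSuccLimit_omega0 (rank_natCast_lt _) (rank_natCast_lt _)

section

variable {α : Ordinal.{u}}

/-- `V_α` contains the natural numbers and the components of pairs in its elements, so relativising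
`Linked` to `V_α` loses nothing. -/
theorem linked_vonNeumann_iff (hα : Order.IsSuccLimit α) (hω : Ordinal.omega0 < α) (σ : ℕ → ℕ)
    {e s z : ZFSet.{u}} (hs : s ∈ V_ α) (hz : z ∈ V_ α) :
    Linked (V_ α) (indexGraph σ) e s z ↔ (s = ∅ ∧ z = ∅) ∨ (¬ s = ∅ ∧ ¬ z = ∅ ∧
      (∀ n, decode z n = decode s (σ n)) ∧
      ∀ n ∈ V_ α, ∀ m ∈ V_ α, ZFSet.pair n m ∈ e → ∃ w, ZFSet.pair m w ∈ z ∧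
        ∀ x, (x ∈ w ↔ ZFSet.pair n x ∈ s)) := by
  have hV : ∀ {x y t : ZFSet.{u}}, t ∈ V_ α → ZFSet.pair x y ∈ t → x ∈ V_ α ∧ y ∈ V_ α :=
    fun ht h => (pair_mem_vonNeumann hα).1
      ((ZFSet.isTransitive_vonNeumann α).subset_of_mem ht h)
  have hn : ∀ n : ℕ, (n : Ordinal.{u}).toZFSet ∈ V_ α := fun n =>
    ZFSet.mem_vonNeumann.2 ((rank_natCast_lt n).trans hω)
  refine or_congr Iff.rfl (and_congr Iff.rfl (and_congr Iff.rfl ?_))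
  constructor
  · intro h
    refine ⟨fun n => ?_, fun n hn m hm hnm => ?_⟩
    · ext w
      rw [mem_decode, mem_decode]
      have h₁ := (h _ (hn (σ n)) _ (hn n)).1 (ZFSet.mem_range.2 ⟨n, rfl⟩)
      exact ⟨fun hw => (h₁ w (hV hz hw).2).2 hw, fun hw => (h₁ w (hV hs hw).2).1 hw⟩
    · obtain ⟨w, hw, hwz, h₁⟩ := (h n hn m hm).2 hnm
      exact ⟨w, hwz, fun x => ⟨fun hx => (h₁ x
        ((ZFSet.isTransitive_vonNeumann α).subset_of_mem hw hx)).1 hx,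
        fun hx => (h₁ x (hV hs hx).2).2 hx⟩⟩
  · rintro ⟨h₁, h₂⟩ n hn m hm
    refine ⟨fun hnm w hw => ?_, fun hnm => ?_⟩
    · obtain ⟨k, hk⟩ := ZFSet.mem_range.1 hnm
      obtain ⟨rfl, rfl⟩ := ZFSet.pair_injective hk
      rw [← mem_decode, ← mem_decode, h₁]
    · obtain ⟨w, hw, h₃⟩ := h₂ n hn m hm hnm
      exact ⟨w, (hV hz hw).2, hw, fun x _ => h₃ x⟩

theorem linked_comp_iff (hα : Order.IsSuccLimit α) (hω : Ordinal.omega0 < α) (σ : ℕ → ℕ)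
    {s z : ZFSet.{u}} (hs : s ∈ V_ α) (hz : z ∈ V_ α) :
    Linked (V_ α) (indexGraph σ) ∅ s z ↔ (s = ∅ ∧ z = ∅) ∨ (¬ s = ∅ ∧ ¬ z = ∅ ∧
      decode z = fun n => decode s (σ n)) := by
  rw [linked_vonNeumann_iff hα hω σ hs hz, funext_iff]
  refine or_congr Iff.rfl (and_congr Iff.rfl (and_congr Iff.rfl (and_iff_left ?_)))
  exact fun n _ m _ h => (ZFSet.notMem_empty _ h).elim

/-- The set with the only element `(0, 0)`. -/
noncomputable def zeroGraph : ZFSet.{u} :=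
  {ZFSet.pair ((0 : ℕ) : Ordinal.{u}).toZFSet ((0 : ℕ) : Ordinal.{u}).toZFSet}

/-- `indexGraph Nat.succ` makes `z` the sequence `s` without its first entry, and `zeroGraph` makes
that entry a member of the first entry of `z`. -/
theorem linked_succ_iff (hα : Order.IsSuccLimit α) (hω : Ordinal.omega0 < α)
    {s z : ZFSet.{u}} (hs : s ∈ V_ α) (hz : z ∈ V_ α) :
    Linked (V_ α) (indexGraph Nat.succ) zeroGraph s z ↔ (s = ∅ ∧ z = ∅) ∨ (¬ s = ∅ ∧ ¬ z = ∅ ∧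
      decode s 0 ∈ decode z 0 ∧ decode s = seqCons (decode s 0) (decode z)) := by
  rw [linked_vonNeumann_iff hα hω _ hs hz]
  refine or_congr Iff.rfl (and_congr Iff.rfl (and_congr Iff.rfl ?_))
  rw [and_comm]
  refine and_congr ?_ ?_
  · have h0 : ((0 : ℕ) : Ordinal.{u}).toZFSet ∈ V_ α :=
      ZFSet.mem_vonNeumann.2 ((rank_natCast_lt 0).trans hω)
    constructor
    · intro h
      obtain ⟨w, hw, hw'⟩ := h _ h0 _ h0 (ZFSet.mem_singleton.2 rfl)
      have : w = decode s 0 := by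
        ext x
        rw [hw', mem_decode]
      rw [mem_decode, ← this]
      exact hw
    · intro h n _ m _ hnm
      obtain ⟨rfl, rfl⟩ := ZFSet.pair_injective (ZFSet.mem_singleton.1 hnm)
      exact ⟨decode s 0, mem_decode.1 h, fun x => mem_decode⟩
  · constructor
    · intro h
      funext n
      cases n with
      | zero => rfl
      | succ n => exact (h n).symm
    · intro h n
      exact (congrFun h (n + 1)).symm

end

/-! ### Embeddings of products of the class -/

theorem mem_below_linkClass {β : Ordinal.{u}} {A : RelStruct natType.{u}}
    (hA : A ∈ below natType linkClass β) : ∃ α : Ordinal.{u}, Order.IsSuccLimit α ∧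
      Ordinal.omega0 < α ∧ α < β ∧ A = linkStruct α := by
  obtain ⟨⟨α, hα, hω, h⟩, hβ⟩ := hA
  obtain rfl := RelStruct.code_injective h
  refine ⟨α, hα, hω, ?_, rfl⟩
  have h₁ := rank_lt_rank_pair_left (linkStruct α).carrier (linkStruct α).relFamily
  rw [← RelStruct.code_eq] at h₁
  change (V_ (α + 1)).rank < _ at h₁
  rw [ZFSet.rank_vonNeumann] at h₁
  exact ((lt_add_one α).trans h₁).trans (ZFSet.mem_vonNeumann.1 hβ)

theorem linkStruct_mem_below {α β : Ordinal.{u}} (hα : Order.IsSuccLimit α)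
    (hω : Ordinal.omega0 < α) (hβ : Order.IsSuccLimit β) (hαβ : α + Ordinal.omega0 < β) :
    linkStruct α ∈ below natType linkClass β := by
  refine ⟨⟨α, hα, hω, rfl⟩, ZFSet.mem_vonNeumann.2 ?_⟩
  rw [linkStruct, code_natStruct]
  have hαβ' : α < β := le_self_add.trans_lt hαβ
  have hpos : (0 : Ordinal.{u}) < β := bot_le.trans_lt hαβ'
  have h₀ : (∅ : ZFSet.{u}).rank < β := by rwa [ZFSet.rank_empty]
  have h₁ : ({∅} : ZFSet.{u}).rank < β := by
    rw [ZFSet.rank_singleton]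
    exact hβ.succ_lt h₀
  have h₂ : ({∅, {∅}} : ZFSet.{u}).rank < β := by
    rw [ZFSet.rank_pair]
    exact max_lt (hβ.succ_lt h₀) (hβ.succ_lt h₁)
  have h₃ : (links α).rank < β := (ZFSet.rank_mono
    (mem_vonNeumann_add_one.1 (links_mem α))).trans_lt (by rwa [ZFSet.rank_vonNeumann])
  have h₄ : (memPairs (V_ (α + 1))).rank < β := by
    refine (ZFSet.rank_le_iff.2 fun q hq => ?_).trans_lt hαβ
    obtain ⟨-, x, y, rfl, -⟩ := ZFSet.mem_sep.1 hq
    obtain ⟨hx, hy, -⟩ := pair_mem_memPairs.1 hq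
    have h : α + 1 < α + Ordinal.omega0 := (add_lt_add_iff_left α).2 Ordinal.one_lt_omega0
    exact rank_pair_lt (Ordinal.isSuccLimit_add _ Ordinal.isSuccLimit_omega0)
      ((ZFSet.mem_vonNeumann.1 hx).trans h) ((ZFSet.mem_vonNeumann.1 hy).trans h)
  refine rank_pair_lt hβ ?_ ?_
  · rw [ZFSet.rank_vonNeumann]
    exact hβ.succ_lt hαβ'
  · rw [ZFSet.rank_pair]
    exact max_lt (hβ.succ_lt (rank_pair_lt hβ (rank_pair_lt hβ h₁ h₀) h₃))
      (hβ.succ_lt (rank_pair_lt hβ (rank_pair_lt hβ h₂ h₀) h₄))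

/-- A faithful chain-preserving elementary embedding of the product of the structures
`linkStruct α` with `α < κ`, together with a factor `linkStruct γ` of its target. -/
structure LinkEmbedding (κ γ : Ordinal.{u}) where
  omega0_lt : Ordinal.omega0 < κ
  add_omega0_lt : ∀ o < κ, o + Ordinal.omega0 < κ
  le : κ ≤ γ
  isSuccLimit : Order.IsSuccLimit γ
  exists_bound : ∀ o : ℕ → Ordinal.{u}, (∀ n, o n < γ) → ∃ b < γ, ∀ n, o n ≤ b
  target : Set (RelStruct natType.{u})
  map : Product (below natType linkClass κ) ↪ₑ[natType.{u}.lang] Product target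
  faithful : Faithful map
  chainPreserving : ChainPreserving map
  mem_target : linkStruct γ ∈ target

namespace LinkEmbedding

variable {κ γ : Ordinal.{u}}

theorem isSuccLimit_left (E : LinkEmbedding κ γ) : Order.IsSuccLimit κ := by
  refine ⟨fun h => ?_, Order.isSuccPrelimit_iff_succ_lt.2 fun a ha => ?_⟩
  · rw [isMin_iff_eq_bot] at h
    exact not_lt_bot (h ▸ E.omega0_lt)
  · refine lt_of_le_of_lt ?_ (E.add_omega0_lt a ha)
    exact (add_le_add_iff_left a).2 Ordinal.one_lt_omega0.le

theorem linkStruct_mem (E : LinkEmbedding κ γ) {α : Ordinal.{u}}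
    (hα : Order.IsSuccLimit α) (hω : Ordinal.omega0 < α) (hακ : α < κ) :
    linkStruct α ∈ below natType linkClass κ :=
  linkStruct_mem_below hα hω E.isSuccLimit_left (E.add_omega0_lt α hακ)

theorem omega0_lt_right (E : LinkEmbedding κ γ) : Ordinal.omega0 < γ := E.omega0_lt.trans_le E.le

/-- The coordinate of the image of `f` at `linkStruct γ`. -/
noncomputable def value (E : LinkEmbedding κ γ) (f : Product (below natType linkClass.{u} κ)) :
    (linkStruct γ).carrier :=
  E.map f ⟨linkStruct γ, E.mem_target⟩

/-- Truth at every factor is one statement about the product, so it survives the embedding and can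
be read at the factor `linkStruct γ`. -/
theorem coord (E : LinkEmbedding κ γ) {n : ℕ}
    {P : ∀ A : RelStruct natType.{u}, (Fin n → A.carrier) → Prop} (hP : CoordDef P)
    (v : Fin n → Product (below natType linkClass.{u} κ))
    (hv : ∀ (α : Ordinal.{u}) (hA : linkStruct α ∈ below natType linkClass κ),
      Order.IsSuccLimit α → Ordinal.omega0 < α → α < κ →
        P (linkStruct α) (fun k => v k ⟨linkStruct α, hA⟩)) :
    P (linkStruct γ) (fun k => E.value (v k)) := by
  refine (hP.map_iff E.map v).2 ?_ ⟨linkStruct γ, E.mem_target⟩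
  rintro ⟨A, hA⟩
  obtain ⟨α, hα, hω, hακ, rfl⟩ := mem_below_linkClass hA
  exact hv α hA hα hω hακ

/-- Faithfulness identifies the image of `f` at `linkStruct α` with `f` itself, and chain
preservation compares it with the image at `linkStruct γ`. Both properties enter the argument only
here. -/
theorem subset_value (E : LinkEmbedding κ γ) {f : Product (below natType linkClass.{u} κ)}
    (hf : IsSubsetChain f)
    {α : Ordinal.{u}} (hα : Order.IsSuccLimit α) (hω : Ordinal.omega0 < α) (hακ : α < κ) :
    (f ⟨_, E.linkStruct_mem hα hω hακ⟩).1 ⊆ (E.value f).1 := by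
  obtain ⟨hT, h⟩ := E.faithful f _ (E.linkStruct_mem hα hω hακ)
  rw [← h]
  refine E.chainPreserving f hf ⟨linkStruct α, hT⟩ ⟨linkStruct γ, E.mem_target⟩ ?_
  exact ZFSet.vonNeumann_subset_of_le (add_le_add_left (hακ.le.trans E.le) 1)

theorem mem_carrier_of_rank {A : RelStruct natType.{u}} (hA : A ∈ below natType linkClass κ)
    {e : ZFSet.{u}} (he : e.rank ≤ Ordinal.omega0) : e ∈ A.carrier := by
  obtain ⟨α, hα, hω, -, rfl⟩ := mem_below_linkClass hA
  exact mem_carrier_of_mem (ZFSet.mem_vonNeumann.2 (he.trans_lt hω))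

theorem singleton_mem_carrier_of_rank {A : RelStruct natType.{u}}
    (hA : A ∈ below natType linkClass κ) {e : ZFSet.{u}} (he : e.rank ≤ Ordinal.omega0) :
    ({e} : ZFSet.{u}) ∈ A.carrier := by
  obtain ⟨α, hα, hω, -, rfl⟩ := mem_below_linkClass hA
  refine mem_carrier_of_mem (ZFSet.mem_vonNeumann.2 ?_)
  rw [ZFSet.rank_singleton]
  exact hα.succ_lt (he.trans_lt hω)

/-- The element of the product that is constantly `e`. -/
def const {e : ZFSet.{u}} (he : e.rank ≤ Ordinal.omega0) :
    Product (below natType linkClass.{u} κ) := fun A => ⟨e, mem_carrier_of_rank A.2 he⟩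

/-- Elementarity shows that the value of the constant `{e}` is the singleton of the value of the
constant `e`. The constant `{e}` is a chain, so its value contains `e`. -/
theorem value_const (E : LinkEmbedding κ γ) {e : ZFSet.{u}} (he : e.rank ≤ Ordinal.omega0) :
    (E.value (const he)).1 = e := by
  let f : Product (below natType linkClass.{u} κ) :=
    fun A => ⟨{e}, singleton_mem_carrier_of_rank A.2 he⟩
  have h₁ := E.coord (CoordDef.structSingleton (0 : Fin 2) 1) ![f, const he]
    fun α hA _ _ _ => structSingleton_linkStruct.2 rfl
  have h₂ : (E.value f).1 = {(E.value (const he)).1} := structSingleton_linkStruct.1 h₁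
  have h₃ := E.subset_value (f := f) (fun _ _ _ => subset_rfl)
    (Ordinal.isSuccLimit_add Ordinal.omega0 Ordinal.isSuccLimit_omega0)
    ((lt_add_iff_pos_right _).2 Ordinal.omega0_pos) (E.add_omega0_lt _ E.omega0_lt)
  have h₄ : e ∈ (E.value f).1 := h₃ (ZFSet.mem_singleton.2 rfl)
  rw [h₂] at h₄
  exact (ZFSet.mem_singleton.1 h₄).symm

/-- The element of the product whose coordinate at `linkStruct α` is the set of the elements of
`V_ α` that are empty or code a sequence in `X`. -/
noncomputable def seqs (X : Set (ℕ → ZFSet.{u})) : Product (below natType linkClass.{u} κ) :=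
  fun A => ⟨ZFSet.sep (fun z => z = ∅ ∨ decode z ∈ X) (⋃₀ (A : RelStruct natType.{u}).carrier), by
    obtain ⟨A, hA⟩ := A
    obtain ⟨α, -, -, -, rfl⟩ := mem_below_linkClass hA
    refine mem_vonNeumann_add_one.2 fun z hz => ?_
    obtain ⟨y, hy, hz⟩ := ZFSet.mem_sUnion.1 (ZFSet.mem_sep.1 hz).1
    exact mem_of_mem_carrier hy hz⟩

theorem mem_seqs {X : Set (ℕ → ZFSet.{u})} {α : Ordinal.{u}}
    {hA : linkStruct α ∈ below natType linkClass κ} {z : ZFSet.{u}} :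
    z ∈ (seqs X ⟨linkStruct α, hA⟩).1 ↔ z ∈ V_ α ∧ (z = ∅ ∨ decode z ∈ X) := by
  rw [seqs, ZFSet.mem_sep, ZFSet.mem_sUnion]
  refine and_congr_left fun _ => ⟨fun ⟨y, hy, hz⟩ => mem_of_mem_carrier hy hz, fun hz =>
    ⟨V_ α, ZFSet.vonNeumann_mem_of_lt (lt_add_one α), hz⟩⟩

theorem empty_mem_seqs {X : Set (ℕ → ZFSet.{u})} {α : Ordinal.{u}} (hω : Ordinal.omega0 < α)
    {hA : linkStruct α ∈ below natType linkClass κ} : ∅ ∈ (seqs X ⟨linkStruct α, hA⟩).1 := by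
  refine mem_seqs.2 ⟨ZFSet.mem_vonNeumann.2 ?_, Or.inl rfl⟩
  rw [ZFSet.rank_empty]
  exact bot_le.trans_lt hω

theorem isSubsetChain_seqs (X : Set (ℕ → ZFSet.{u})) :
    IsSubsetChain (seqs (κ := κ) X) := by
  intro A B h z hz
  rw [seqs, ZFSet.mem_sep, ZFSet.mem_sUnion] at hz ⊢
  obtain ⟨⟨y, hy, hz⟩, hX⟩ := hz
  exact ⟨⟨y, h hy, hz⟩, hX⟩

/-- The codes of sequences on which the embedding puts the set `X`. -/
noncomputable def ev (E : LinkEmbedding κ γ) (X : Set (ℕ → ZFSet.{u})) : ZFSet.{u} :=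
  (E.value (seqs X)).1

theorem empty_mem_ev (E : LinkEmbedding κ γ) (X : Set (ℕ → ZFSet.{u})) : ∅ ∈ E.ev X :=
  E.subset_value (isSubsetChain_seqs X)
    (Ordinal.isSuccLimit_add Ordinal.omega0 Ordinal.isSuccLimit_omega0)
    ((lt_add_iff_pos_right _).2 Ordinal.omega0_pos) (E.add_omega0_lt _ E.omega0_lt)
    (empty_mem_seqs ((lt_add_iff_pos_right _).2 Ordinal.omega0_pos))

theorem mem_vonNeumann_of_mem_ev (E : LinkEmbedding κ γ) {X : Set (ℕ → ZFSet.{u})}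
    {z : ZFSet.{u}} (hz : z ∈ E.ev X) : z ∈ V_ γ := mem_of_mem_carrier (E.value (seqs X)).2 hz

theorem mem_ev_of_inter_subset (E : LinkEmbedding κ γ) {X Y Z : Set (ℕ → ZFSet.{u})}
    (h : X ∩ Y ⊆ Z) {z : ZFSet.{u}}
    (hX : z ∈ E.ev X) (hY : z ∈ E.ev Y) : z ∈ E.ev Z := by
  have h₁ := E.coord (CoordDef.structInter (0 : Fin 3) 1 2) ![seqs X, seqs Y, seqs Z]
    fun α hA _ hω _ => structInter_linkStruct.2 ⟨⟨∅, empty_mem_seqs hω, empty_mem_seqs hω⟩, ?_⟩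
  · exact (structInter_linkStruct.1 h₁).2 z hX hY
  · intro w hw hw'
    obtain ⟨hwα, hw⟩ := mem_seqs.1 hw
    obtain ⟨-, hw'⟩ := mem_seqs.1 hw'
    refine mem_seqs.2 ⟨hwα, ?_⟩
    rcases hw with hw | hw
    · exact Or.inl hw
    · exact hw'.imp_right fun hw' => h ⟨hw, hw'⟩

theorem ev_mono (E : LinkEmbedding κ γ) {X Y : Set (ℕ → ZFSet.{u})} (h : X ⊆ Y) :
    E.ev X ⊆ E.ev Y :=
  fun _ hz => E.mem_ev_of_inter_subset (Set.inter_subset_left.trans h) hz hz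

theorem mem_ev_or_compl (E : LinkEmbedding κ γ) (X : Set (ℕ → ZFSet.{u})) {z : ZFSet.{u}}
    (hz : z ∈ V_ γ) : z ∈ E.ev X ∨ z ∈ E.ev Xᶜ := by
  have h₁ := E.coord (CoordDef.structCover (0 : Fin 2) 1) ![seqs X, seqs Xᶜ]
    fun α hA _ hω _ => (structCover_linkStruct ⟨∅, empty_mem_seqs hω⟩ ⟨∅, empty_mem_seqs hω⟩).2
      fun w hw => ?_
  · exact (structCover_linkStruct ⟨∅, E.empty_mem_ev X⟩ ⟨∅, E.empty_mem_ev Xᶜ⟩).1 h₁ z hz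
  · by_cases h : decode w ∈ X
    · exact Or.inl (mem_seqs.2 ⟨hw, Or.inr h⟩)
    · exact Or.inr (mem_seqs.2 ⟨hw, Or.inr h⟩)

/-- Only the dummy element is left, so `seqs ∅` is constant with value `{∅}`. -/
theorem ev_empty (E : LinkEmbedding κ γ) : E.ev ∅ = {∅} := by
  have h₀ : ({∅} : ZFSet.{u}).rank ≤ Ordinal.omega0 := by
    rw [ZFSet.rank_singleton, ZFSet.rank_empty]
    exact Order.succ_le_of_lt Ordinal.omega0_pos
  rw [← E.value_const h₀, ev]
  congr 2
  funext ⟨A, hA⟩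
  obtain ⟨α, hα, hω, -, rfl⟩ := mem_below_linkClass hA
  refine Subtype.ext (ZFSet.ext fun z => ?_)
  rw [mem_seqs]
  constructor
  · rintro ⟨-, rfl | h⟩
    · exact ZFSet.mem_singleton.2 rfl
    · exact h.elim
  · intro hz
    obtain rfl := ZFSet.mem_singleton.1 hz
    exact mem_seqs.1 (empty_mem_seqs (hA := hA) hω)

theorem rank_zeroGraph_le : zeroGraph.{u}.rank ≤ Ordinal.omega0 := by
  rw [zeroGraph, ZFSet.rank_singleton]
  exact (Ordinal.isSuccLimit_omega0.succ_lt (rank_pair_lt Ordinal.isSuccLimit_omega0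
    (rank_natCast_lt _) (rank_natCast_lt _))).le

theorem rank_empty_le : (∅ : ZFSet.{u}).rank ≤ Ordinal.omega0 := by
  rw [ZFSet.rank_empty]
  exact bot_le

/-- Inclusion of the image of `seqs X` under a link in `seqs Y` is computed coordinatewise. The
dummy pair `(∅, ∅)`, linked for all `e₁` and `e₂`, makes the guard satisfiable. -/
theorem mem_ev_of_linked (E : LinkEmbedding κ γ) {X Y : Set (ℕ → ZFSet.{u})} {e₁ e₂ : ZFSet.{u}}
    (he₁ : e₁.rank ≤ Ordinal.omega0) (he₂ : e₂.rank ≤ Ordinal.omega0)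
    (h : ∀ α : Ordinal.{u}, Order.IsSuccLimit α → Ordinal.omega0 < α → ∀ s ∈ V_ α, ∀ z ∈ V_ α,
      s ≠ ∅ → z ≠ ∅ → decode s ∈ X → Linked (V_ α) e₁ e₂ s z → decode z ∈ Y)
    {s z : ZFSet.{u}} (hs : s ∈ E.ev X) (hz : z ∈ V_ γ) (hsz : Linked (V_ γ) e₁ e₂ s z) :
    z ∈ E.ev Y := by
  have h₁ := E.coord (CoordDef.structImageSubset (0 : Fin 4) 1 2 3)
    ![const he₁, const he₂, seqs X, seqs Y] fun α hA hα hω _ => ?_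
  · refine h₁.2 ⟨z, mem_carrier_of_mem hz⟩
      ⟨⟨s, mem_carrier_of_mem (E.mem_vonNeumann_of_mem_ev hs)⟩, hs,
      (structLink_linkStruct E.isSuccLimit).2 ?_⟩
    have h₂ : (E.value (![const he₁, const he₂, seqs X, seqs Y] 0)).1 = e₁ := E.value_const he₁
    have h₃ : (E.value (![const he₁, const he₂, seqs X, seqs Y] 1)).1 = e₂ := E.value_const he₂
    rw [h₂, h₃]
    exact ⟨⟨ZFSet.mem_vonNeumann.2 (he₁.trans_lt E.omega0_lt_right),
      ZFSet.mem_vonNeumann.2 (he₂.trans_lt E.omega0_lt_right), E.mem_vonNeumann_of_mem_ev hs, hz⟩,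
      hsz⟩
  · have he₁' : e₁ ∈ V_ α := ZFSet.mem_vonNeumann.2 (he₁.trans_lt hω)
    have he₂' : e₂ ∈ V_ α := ZFSet.mem_vonNeumann.2 (he₂.trans_lt hω)
    have h0 : (∅ : ZFSet.{u}) ∈ V_ α := (mem_seqs.1 (empty_mem_seqs (X := ∅) hω (hA := hA))).1
    refine ⟨⟨⟨∅, mem_carrier_of_mem h0⟩, ⟨∅, mem_carrier_of_mem h0⟩, empty_mem_seqs hω,
      (structLink_linkStruct hα).2 ⟨⟨he₁', he₂', h0, h0⟩, Or.inl ⟨rfl, rfl⟩⟩⟩, ?_⟩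
    rintro ⟨z, hz⟩ ⟨⟨s, hs⟩, hsX, hl⟩
    obtain ⟨⟨-, -, hsα, hzα⟩, hl⟩ := (structLink_linkStruct hα).1 hl
    refine mem_seqs.2 ⟨hzα, ?_⟩
    rcases hl with ⟨-, hz'⟩ | hl
    · exact Or.inl hz'
    · exact Or.inr (h α hα hω s hsα z hzα hl.1 hl.2.1
        ((mem_seqs.1 hsX).2.resolve_left hl.1) (Or.inr hl))

/-- The reverse inclusion of images. It produces new codes in `V_γ`, and thus the witnesses required
by `bounded`. -/
theorem exists_linked_of_mem_ev (E : LinkEmbedding κ γ) {X Y : Set (ℕ → ZFSet.{u})}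
    {e₁ e₂ : ZFSet.{u}} (he₁ : e₁.rank ≤ Ordinal.omega0) (he₂ : e₂.rank ≤ Ordinal.omega0)
    (h : ∀ α : Ordinal.{u}, Order.IsSuccLimit α → Ordinal.omega0 < α → ∀ z ∈ V_ α,
      z ≠ ∅ → decode z ∈ Y → ∃ s ∈ V_ α, decode s ∈ X ∧ Linked (V_ α) e₁ e₂ s z)
    {z : ZFSet.{u}} (hz : z ∈ E.ev Y) : ∃ s ∈ E.ev X, Linked (V_ γ) e₁ e₂ s z := by
  have h₁ := E.coord (CoordDef.structSubsetImage (0 : Fin 4) 1 2 3)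
    ![const he₁, const he₂, seqs X, seqs Y] fun α hA hα hω _ => ?_
  · obtain ⟨s, hs, hl⟩ := h₁.2 ⟨z, mem_carrier_of_mem (E.mem_vonNeumann_of_mem_ev hz)⟩ hz
    have h₂ : (E.value (![const he₁, const he₂, seqs X, seqs Y] 0)).1 = e₁ := E.value_const he₁
    have h₃ : (E.value (![const he₁, const he₂, seqs X, seqs Y] 1)).1 = e₂ := E.value_const he₂
    have hl := ((structLink_linkStruct E.isSuccLimit).1 hl).2
    rw [h₂, h₃] at hl
    exact ⟨s.1, hs, hl⟩
  · have he₁' : e₁ ∈ V_ α := ZFSet.mem_vonNeumann.2 (he₁.trans_lt hω)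
    have he₂' : e₂ ∈ V_ α := ZFSet.mem_vonNeumann.2 (he₂.trans_lt hω)
    have h0 : (∅ : ZFSet.{u}) ∈ V_ α := (mem_seqs.1 (empty_mem_seqs (X := ∅) hω (hA := hA))).1
    refine ⟨⟨⟨∅, mem_carrier_of_mem h0⟩, empty_mem_seqs hω⟩, ?_⟩
    rintro ⟨z, hz⟩ hzY
    obtain ⟨hzα, hz'⟩ := mem_seqs.1 hzY
    by_cases hz0 : z = ∅
    · subst hz0
      exact ⟨⟨∅, mem_carrier_of_mem h0⟩, empty_mem_seqs hω,
        (structLink_linkStruct hα).2 ⟨⟨he₁', he₂', h0, h0⟩, Or.inl ⟨rfl, rfl⟩⟩⟩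
    · obtain ⟨s, hs, hsX, hl⟩ := h α hα hω z hzα hz0 (hz'.resolve_left hz0)
      exact ⟨⟨s, mem_carrier_of_mem hs⟩, mem_seqs.2 ⟨hs, Or.inr hsX⟩,
        (structLink_linkStruct hα).2 ⟨⟨he₁', he₂', hs, hzα⟩, hl⟩⟩

/-- Countably many ranks below `γ` have a bound below `γ`; without it the code of a seed could fail
to lie in `V_γ`. -/
theorem encode_seed_mem (E : LinkEmbedding κ γ) (c : Seed γ) : encode c ∈ V_ γ := by
  obtain ⟨o, ho, hc⟩ := E.exists_bound (fun n => (c n).rank) c.2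
  exact encode_mem_vonNeumann E.isSuccLimit E.omega0_lt_right ho hc

/-- The ultrafilter that a sequence of sets of rank below `γ` generates. -/
noncomputable def ultra (E : LinkEmbedding κ γ) (c : Seed γ) : Ultrafilter (ℕ → ZFSet.{u}) :=
  Ultrafilter.ofComplNotMemIff
    { sets := {X | encode c ∈ E.ev X}
      univ_sets := (E.mem_ev_or_compl Set.univ (E.encode_seed_mem c)).elim id
        fun h => E.ev_mono (Set.subset_univ _) h
      sets_of_superset := fun {X Y} (h : encode c ∈ E.ev X) hXY =>
        show encode c ∈ E.ev Y from E.ev_mono hXY h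
      inter_sets := fun {X Y} hX hY =>
        E.mem_ev_of_inter_subset (z := encode c) (subset_refl (X ∩ Y)) hX hY } fun X => by
    change ¬ encode c ∈ E.ev Xᶜ ↔ encode c ∈ E.ev X
    constructor
    · exact (E.mem_ev_or_compl X (E.encode_seed_mem c)).resolve_right
    · intro h₁ h₂
      have h₃ := E.mem_ev_of_inter_subset (Set.inter_compl_self X).subset h₁ h₂
      rw [E.ev_empty, ZFSet.mem_singleton] at h₃
      exact encode_ne_empty _ h₃

theorem eventually_ultra (E : LinkEmbedding κ γ) {c : Seed γ} {P : (ℕ → ZFSet.{u}) → Prop} :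
    (∀ᶠ x : ℕ → ZFSet.{u} in E.ultra c, P x) ↔ encode c ∈ E.ev {x | P x} := Iff.rfl

theorem eventually_comp (E : LinkEmbedding κ γ) (c : Seed γ) (σ : ℕ → ℕ)
    {P : (ℕ → ZFSet.{u}) → Prop} (h : ∀ᶠ x : ℕ → ZFSet.{u} in E.ultra c, P (fun n => x (σ n))) :
    ∀ᶠ x : ℕ → ZFSet.{u} in E.ultra (c.comp σ), P x := by
  rw [eventually_ultra] at h ⊢
  refine E.mem_ev_of_linked (rank_indexGraph_le σ) rank_empty_le
    (fun α hα hω s hs z hz hs' hz' hsX hl => ?_) h (E.encode_seed_mem _)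
    ((linked_comp_iff E.isSuccLimit E.omega0_lt_right σ (E.encode_seed_mem _)
      (E.encode_seed_mem _)).2 (Or.inr ⟨encode_ne_empty _, encode_ne_empty _, ?_⟩))
  · rcases (linked_comp_iff hα hω σ hs hz).1 hl with hl | hl
    · exact (hs' hl.1).elim
    · rw [hl.2.2]
      exact hsX
  · rw [decode_encode, decode_encode]
    rfl

/-- The system of ultrafilters that a product embedding generates. -/
noncomputable def seedSystem (E : LinkEmbedding κ γ) : SeedSystem κ γ where
  U := E.ultra
  comp c σ P := by
    refine ⟨fun h => ?_, E.eventually_comp c σ⟩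
    -- One direction suffices: applied to the negation of `P`, it gives the other for ultrafilters.
    by_contra h'
    rw [← Ultrafilter.eventually_not] at h'
    obtain ⟨x, hx, hx'⟩ := (h.and (E.eventually_comp c σ (P := fun x => ¬ P x) h')).exists
    exact hx' hx
  bounded c P := by
    constructor
    · intro h
      rw [eventually_ultra] at h
      have h₁ := E.exists_linked_of_mem_ev (X := {x | P x})
        (rank_indexGraph_le Nat.succ) rank_zeroGraph_le (fun α hα hω z hz hz' hzY => ?_) h
      · obtain ⟨s, hs, hl⟩ := h₁
        rw [linked_succ_iff E.isSuccLimit E.omega0_lt_right (E.mem_vonNeumann_of_mem_ev hs)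
          (E.encode_seed_mem c), decode_encode] at hl
        rcases hl with hl | ⟨hs', -, hs0, hsc⟩
        · exact (encode_ne_empty _ hl.2).elim
        · refine ⟨decode s 0, hs0, ?_⟩
          rw [eventually_ultra]
          -- The set `s` need not be the canonical code of its sequence; the identity link passes
          -- between codes of the same sequence.
          refine E.mem_ev_of_linked (rank_indexGraph_le id) rank_empty_le
            (fun α hα hω s hs z hz hs' hz' hsX hl => ?_) hs (E.encode_seed_mem _)
            ((linked_comp_iff E.isSuccLimit E.omega0_lt_right id (E.mem_vonNeumann_of_mem_ev hs)
              (E.encode_seed_mem _)).2 (Or.inr ⟨hs', encode_ne_empty _, ?_⟩))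
          · rcases (linked_comp_iff hα hω id hs hz).1 hl with hl | hl
            · exact (hs' hl.1).elim
            · rw [hl.2.2]
              exact hsX
          · rw [decode_encode]
            exact hsc.symm
      · obtain ⟨y, hy, hP⟩ := hzY
        have hs : encode (seqCons y (decode z)) ∈ V_ α :=
          encode_mem_vonNeumann hα hω (ZFSet.mem_vonNeumann.1 hz) fun n => by
            cases n with
            | zero => exact (ZFSet.rank_lt_of_mem hy).le.trans (rank_decode_le z 0)
            | succ n => exact rank_decode_le z n
        refine ⟨_, hs, ?_, (linked_succ_iff hα hω hs hz).2
          (Or.inr ⟨encode_ne_empty _, hz', ?_, ?_⟩)⟩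
        · rw [decode_encode]
          exact hP
        · rw [decode_encode]
          exact hy
        · rw [decode_encode]
          rfl
    · rintro ⟨b, hb, h⟩
      rw [eventually_ultra] at h ⊢
      refine E.mem_ev_of_linked (rank_indexGraph_le Nat.succ) rank_zeroGraph_le
        (fun α hα hω s hs z hz hs' hz' hsX hl => ?_) h (E.encode_seed_mem _)
        ((linked_succ_iff E.isSuccLimit E.omega0_lt_right (E.encode_seed_mem _)
          (E.encode_seed_mem _)).2 (Or.inr ⟨encode_ne_empty _, encode_ne_empty _, ?_, ?_⟩))
      · rcases (linked_succ_iff hα hω hs hz).1 hl with hl | ⟨-, -, hs0, hsz⟩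
        · exact (hs' hl.1).elim
        · refine ⟨decode s 0, hs0, ?_⟩
          rw [← hsz]
          exact hsX
      · rw [decode_encode, decode_encode]
        exact hb
      · rw [decode_encode, decode_encode]
        rfl
  principal c o ho hc P hP := by
    rw [eventually_ultra]
    -- A limit above `o` and `ω` but below `κ`: at this factor the code of `c` is already present,
    -- and it stays in the value at `γ`.
    have hlim : Order.IsSuccLimit (max o Ordinal.omega0 + Ordinal.omega0) :=
      Ordinal.isSuccLimit_add _ Ordinal.isSuccLimit_omega0
    have hlt : max o Ordinal.omega0 < max o Ordinal.omega0 + Ordinal.omega0 :=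
      (lt_add_iff_pos_right _).2 Ordinal.omega0_pos
    refine E.subset_value (isSubsetChain_seqs _) hlim ((le_max_right _ _).trans_lt hlt)
      (E.add_omega0_lt _ (max_lt ho E.omega0_lt)) (mem_seqs.2 ⟨encode_mem_vonNeumann hlim
        ((le_max_right _ _).trans_lt hlt) ((le_max_left _ _).trans_lt hlt) hc, Or.inr ?_⟩)
    rw [decode_encode]
    exact hP
  rank_lt c := by
    rw [eventually_ultra]
    -- A sequence coded in `V_α` with `α < κ` has entries of rank below `κ`, so the restriction on
    -- ranks is void at every factor of the source.
    have h₁ : seqs (κ := κ) {x | ∀ n, (x n).rank < κ} = seqs Set.univ := by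
      funext ⟨A, hA⟩
      obtain ⟨α, hα, hω, hακ, rfl⟩ := mem_below_linkClass hA
      refine Subtype.ext (ZFSet.ext fun z => ?_)
      rw [mem_seqs, mem_seqs]
      refine and_congr_right fun hz => or_congr_right (iff_of_true (fun n => ?_) trivial)
      exact ((rank_decode_le z n).trans_lt (ZFSet.mem_vonNeumann.1 hz)).trans hακ
    rw [ev, h₁]
    exact E.eventually_ultra.1 (Filter.Eventually.of_forall (p := fun _ => True) fun _ => trivial)

end LinkEmbedding

/-! ### Product reflection implies strength -/

/-- Otherwise the source product has no factors, so `x ∈ x` for some `x` holds vacuously at all of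
them, and elementarity would give a set that is an element of itself at a factor of the target. -/
theorem omega0_lt_of_productReflects {κ : Cardinal.{u}}
    (h : ProductReflects natType linkClass.{u} κ) : Ordinal.omega0 < κ.ord := by
  by_contra hω
  have hlim : Order.IsSuccLimit (Ordinal.omega0.{u} + Ordinal.omega0) :=
    Ordinal.isSuccLimit_add _ Ordinal.isSuccLimit_omega0
  have hlt : Ordinal.omega0.{u} < Ordinal.omega0 + Ordinal.omega0 :=
    (lt_add_iff_pos_right _).2 Ordinal.omega0_pos
  set β := max κ.ord (Ordinal.omega0.{u} + Ordinal.omega0 + Ordinal.omega0) + Ordinal.omega0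
    with hβ
  have hβlim : Order.IsSuccLimit β := Ordinal.isSuccLimit_add _ Ordinal.isSuccLimit_omega0
  have hβlt : max κ.ord (Ordinal.omega0.{u} + Ordinal.omega0 + Ordinal.omega0) < β :=
    (lt_add_iff_pos_right _).2 Ordinal.omega0_pos
  obtain ⟨S, -, hS, j, -, -⟩ := h β ((le_max_left _ _).trans hβlt.le)
  have hmem := hS (linkStruct_mem_below hlim hlt hβlim ((le_max_right _ _).trans_lt hβlt))
  have hempty : ∀ A : below natType linkClass.{u} κ.ord, False := by
    rintro ⟨A, hA⟩
    obtain ⟨α, -, hα, hακ, -⟩ := mem_below_linkClass hA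
    exact hω (hα.trans hακ)
  have h₁ := ((CoordDef.ex (P := fun A (_ : Fin 0 → A.carrier) x => StructMem.{u} A x x)
    (CoordDef.structMem _ _)).map_iff j Fin.elim0).2 fun A => (hempty A).elim
  obtain ⟨x, hx⟩ := h₁ ⟨_, hmem⟩
  exact ZFSet.mem_irrefl x.1 hx

theorem isStrong_of_productReflects {κ : Cardinal.{u}}
    (h : ProductReflects natType linkClass.{u} κ) : IsStrong κ := by
  intro lam hlam
  have hω := omega0_lt_of_productReflects h
  have hκ : Cardinal.aleph0 < κ := by
    rwa [← Cardinal.ord_aleph0, Cardinal.ord_lt_ord] at hω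
  have hlim : Order.IsSuccLimit (Order.succ lam).ord :=
    Cardinal.isSuccLimit_ord ((hκ.trans hlam).le.trans (Order.le_succ _))
  have hlt : lam.ord < (Order.succ lam).ord := Cardinal.ord_lt_ord.2 (Order.lt_succ _)
  -- The successor cardinal is regular and uncountable, so countable sets of ordinals below `γ` are
  -- bounded below `γ`.
  set γ := (Order.succ lam).ord with hγ
  have hωγ : Ordinal.omega0 < γ := (hω.trans (Cardinal.ord_lt_ord.2 hlam)).trans hlt
  -- The code of `linkStruct γ` lies a few levels above `V_γ`; `γ + ω + ω` is a limit leaving enough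
  -- room for it.
  obtain ⟨S, -, hS, j, hj, hj'⟩ := h (γ + Ordinal.omega0 + Ordinal.omega0)
    ((Cardinal.ord_lt_ord.2 hlam).le.trans (hlt.le.trans (le_self_add.trans le_self_add)))
  refine SeedSystem.isStrongUpTo (l := γ) (LinkEmbedding.seedSystem
    { omega0_lt := hω
      add_omega0_lt := fun o ho => ?_
      le := ((Cardinal.ord_lt_ord.2 hlam).trans hlt).le
      isSuccLimit := hlim
      exists_bound := fun o ho => ?_
      target := S
      map := j
      faithful := hj
      chainPreserving := hj'
      mem_target := hS (linkStruct_mem_below hlim hωγ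
        (Ordinal.isSuccLimit_add _ Ordinal.isSuccLimit_omega0)
        ((lt_add_iff_pos_right _).2 Ordinal.omega0_pos)) }) hω hlam hlt
  · rw [Cardinal.lt_ord] at ho ⊢
    rw [Ordinal.card_add, Ordinal.card_omega0]
    exact Cardinal.add_lt_of_lt hκ.le ho hκ
  · refine ⟨⨆ n : ULift.{u} ℕ, o n.down, Ordinal.iSup_lt_of_lt_cof ?_ fun n => ho _,
      fun n => Ordinal.le_iSup (fun n : ULift.{u} ℕ => o n.down) ⟨n⟩⟩
    rw [hγ, (Cardinal.isRegular_succ (hκ.trans hlam).le).cof_ord]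
    simpa using (hκ.trans hlam).trans (Order.lt_succ lam)

end PSR

theorem corollary5p14 :
    (∀ κ : Cardinal.{u}, PSR.IsStrong κ ↔ PSR.WitnessesPi1PSR κ) ∧
    (∃ φ : PSR.LSet.Formula Unit, PSR.IsPi1 φ ∧
      PSR.IsProperClass (PSR.definedClass.{u} φ) ∧
      (∀ x ∈ PSR.definedClass.{u} φ,
        ∃ (α : Ordinal.{u}) (A : ZFSet.{u}) (hA : A ∈ V_ α), (PSR.natStruct α A hA).code = x) ∧
      ∀ κ : Cardinal.{u},
        PSR.ProductReflects PSR.natType (PSR.definedClass.{u} φ) κ → PSR.IsStrong κ) := by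
  obtain ⟨φ, hφ, hC⟩ := PSR.exists_isPi1_definedClass_eq.{u}
  refine ⟨fun κ => ⟨PSR.IsStrong.witnessesPi1PSR, fun h => ?_⟩, φ, hφ, ?_⟩
  · have h₁ := h φ PSR.natType hφ
    rw [hC] at h₁
    refine PSR.isStrong_of_productReflects (h₁ PSR.isProperClass_linkClass ?_)
    rintro _ ⟨α, -, -, rfl⟩
    exact ⟨_, rfl⟩
  · rw [hC]
    refine ⟨PSR.isProperClass_linkClass, ?_, fun κ => PSR.isStrong_of_productReflects⟩
    rintro _ ⟨α, -, -, rfl⟩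
    exact ⟨α + 1, PSR.links α, PSR.links_mem α, rfl⟩
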